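/- **Definitions.** An instance of Linear Ordering-AA consists of a finite set $V$, a finite multiset $\mathcal C$ of ordered triples (constraints) of distinct elements of $V$, and a parameter $k\in\mathbb N$, $k\ge 0$. A linear ordering is a bijection $\alpha:V\to\{1,\dots,|V|\}$; it satisfies the constraint $(u,v,w)$ if $\alpha(u)<\alpha(v)<\alpha(w)$. The instance is a yes-instance if some linear ordering satisfies at least $\frac16|\mathcal C|+k$ constraints of $\mathcal C$ (counted with multiplicity). A kernelization is a polynomial-time algorithm that maps every instance $(V,\mathcal C,k)$ to an instance $(V',\mathcal C',k')$ of the same problem such that $(V,\mathcal C,k)$ is a yes-instance if and only if $(V',\mathcal C',k')$ is, and such that both $k'$ and the encoding length of $(V',\mathcal C')$ are bounded by functions of $k$ alone. Given $(V,\mathcal C)$, let $A$ be the multiset of arcs that contains, for each $(u,v,w)\in\mathcal C$, the arcs $(u,v)$ and $(v,w)$, and let $\mathcal B$ be the multiset that contains, for each $(u,v,w)\in\mathcal C$, the betweenness constraint $(v,\{u,w\})$. Delete from $A$ pairs of opposite arcs $(u,v),(v,u)$ as long as there are any, and delete from $\mathcal B$ complete 3-sets $\{(u,\{v,w\}),(v,\{u,w\}),(w,\{u,v\})\}$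 as long as there are any. Let $r$ be the number of remaining arcs and $s$ the number of remaining betweenness constraints, both with multiplicity. **Theorem.** Linear Ordering-AA has a kernel with $O(k^2)$ variables and constraints. More precisely, there are a kernelization $(V,\mathcal C,k)\mapsto(V',\mathcal C',k')$ of Linear Ordering-AA, a constant $K$ and a constant $c>0$ such that for every instance $(V,\mathcal C,k)$: 1. $|V'|\le K k^2$ and $|\mathcal C'|\le K k^2$; 2. if $r+s\ge c k^2$, then $(V,\mathcal C,k)$ is a yes-instance; 3. if $r+s<ck^2$, then $k'=2k$ and, up to renaming variables, $\mathcal C'$ is the following multiset of triples over $V\cup\{\omega\}$, where $\omega\notin V$ is a new variable: the triples $(\omega,u,v)$, $(u,\omega,v)$, $(u,v,\omega)$ for each remaining arc $(u,v)$, and the triples $(b,a,c)$, $(c,a,b)$ for each remaining betweenness constraint $(a,\{b,c\})$; and $V'$ is the set of variables that occur in these triples. -/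

import Mathlib

/-! ## Parameterized problems and kernels -/

/-- A parameterized problem: instances `x`, written as words over a finite alphabet, together with
a parameter `k : ℕ`, and the set of yes-instances `(x, k)`. -/
structure ParamProblem where
  /-- the instances, without the parameter -/
  Inst : Type
  /-- the alphabet -/
  Sym : Type
  /-- the alphabet is finite -/
  symFintype : Fintype Sym
  /-- the encoding of instances as words -/
  enc : Computability.Encoding Inst Sym
  /-- `Yes x k` says that `(x, k)` is a yes-instance -/
  Yes : Inst → ℕ → Prop

namespace ParamProblem

/-- The word that encodes `(x, k)`: the word of `x`, followed by `k` in binary. -/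
def pairEnc (L : ParamProblem) : Computability.Encoding (L.Inst × ℕ) (L.Sym ⊕ Bool) :=
  Computability.encodingProd L.enc Computability.encodingNatBool

/-- `f` is a bikernelization from `L` to `L'`: it is computed by a Turing machine in polynomial
time, it preserves yes- and no-instances, and both the new parameter and the size of the new
instance are bounded in terms of the old parameter alone. -/
structure IsBikernelization (L L' : ParamProblem)
    (f : L.Inst × ℕ → L'.Inst × ℕ) : Prop where
  polyTime : Nonempty
    (Turing.TM2ComputableInPolyTime L.pairEnc.encode L'.pairEnc.encode f)
  equivalent : ∀ x k, L.Yes x k ↔ L'.Yes (f (x, k)).1 (f (x, k)).2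
  param_le : ∃ h : ℕ → ℕ, ∀ x k, (f (x, k)).2 ≤ h k
  size_le : ∃ g : ℕ → ℕ, ∀ x k, (L'.enc.encode (f (x, k)).1).length ≤ g k

/-- A kernelization of `L` is a bikernelization from `L` to itself. -/
def IsKernelization (L : ParamProblem) (f : L.Inst × ℕ → L.Inst × ℕ) : Prop :=
  IsBikernelization L L f

end ParamProblem

namespace PermCSP

/-! ## Ternary permutation constraint satisfaction problems -/

/-- A constraint over `V`: an ordered triple `(c 0, c 1, c 2)` of distinct variables. -/
abbrev Constraint (V : Type) : Type := Fin 3 ↪ V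

/-- A linear ordering of a finite set `V`: a bijection onto `{0, …, |V| - 1}`. -/
abbrev LinOrdering (V : Type) [Fintype V] : Type := V ≃ Fin (Fintype.card V)

/-- The constraint `c` is `Π`-satisfied by the linear ordering `α`. -/
def Satisfies {V : Type} [Fintype V] (P : Finset (Equiv.Perm (Fin 3))) (α : LinOrdering V)
    (c : Constraint V) : Prop :=
  ∃ π ∈ P, α (c (π 0)) < α (c (π 1)) ∧ α (c (π 1)) < α (c (π 2))

instance {V : Type} [Fintype V] (P : Finset (Equiv.Perm (Fin 3))) (α : LinOrdering V) :
    DecidablePred (Satisfies P α) := fun c => by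
  unfold Satisfies
  infer_instance

/-- Some linear ordering of `V` satisfies at least `(|Π| / 6) |C| + k` constraints of the
multiset `C`. -/
def IsYes {V : Type} [Fintype V] (P : Finset (Equiv.Perm (Fin 3)))
    (C : Multiset (Constraint V)) (k : ℕ) : Prop :=
  ∃ α : LinOrdering V,
    (P.card : ℚ) / 6 * (Multiset.card C : ℚ) + k ≤ (C.countP (Satisfies P α) : ℚ)

/-! ## Instances as words -/

/-- An instance `(V, C)` with `V = {0, …, n - 1}` and the multiset `C` given as a list, in any
order, with repetitions. -/
structure Instance where
  /-- the number of variables -/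
  n : ℕ
  /-- the constraints, listed with multiplicity -/
  constraints : List (Constraint (Fin n))

/-- The multiset of constraints of an instance. -/
def Instance.multiset (I : Instance) : Multiset (Constraint (Fin I.n)) := I.constraints

/-- A list of numbers as a word: each number is a block of `true`s closed by one `false`. -/
def unaryWord (l : List ℕ) : List Bool :=
  l.flatMap fun a => List.replicate a true ++ [false]

theorem unaryWord_injective : Function.Injective unaryWord := by
  have key : ∀ (a b : ℕ) (x y : List Bool),
      List.replicate a true ++ false :: x = List.replicate b true ++ false :: y →
        a = b ∧ x = y := by
    intro a
    induction a with
    | zero =>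
      intro b x y h
      cases b with
      | zero => simpa using h
      | succ b => simp [List.replicate_succ] at h
    | succ a ih =>
      intro b x y h
      cases b with
      | zero => simp [List.replicate_succ] at h
      | succ b =>
        simp only [List.replicate_succ, List.cons_append, List.cons.injEq, true_and] at h
        have := ih b x y h
        exact ⟨by omega, this.2⟩
  intro l
  induction l with
  | nil =>
    intro l' h
    cases l' with
    | nil => rfl
    | cons b l' => simp [unaryWord] at h
  | cons a l ih =>
    intro l' h
    cases l' with
    | nil => simp [unaryWord] at h
    | cons b l' =>
      simp only [unaryWord, List.flatMap_cons, List.append_assoc, List.singleton_append] at h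
      obtain ⟨h1, h2⟩ := key _ _ _ _ h
      rw [h1, ih h2]

/-- The numbers that describe an instance: `n`, then the variables of the constraints. -/
def Instance.code (I : Instance) : List ℕ :=
  I.n :: I.constraints.flatMap fun c => [(c 0 : ℕ), (c 1 : ℕ), (c 2 : ℕ)]

theorem Instance.code_injective : Function.Injective Instance.code := by
  rintro ⟨n, C⟩ ⟨m, D⟩ h
  simp only [Instance.code, List.cons.injEq] at h
  obtain ⟨rfl, h⟩ := h
  congr 1
  induction C generalizing D with
  | nil =>
    cases D with
    | nil => rfl
    | cons d D => simp at h
  | cons c C ih =>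
    cases D with
    | nil => simp at h
    | cons d D =>
      simp only [List.flatMap_cons, List.cons_append, List.nil_append, List.cons.injEq] at h
      obtain ⟨h0, h1, h2, h3⟩ := h
      rw [ih D h3]
      congr 1
      ext i
      fin_cases i
      · exact h0
      · exact h1
      · exact h2

open Classical in
/-- The encoding of instances as words over a two-letter alphabet. The variable set is written out,
so that the length of the word is polynomially related to `|V| + |C|`. -/
noncomputable def instanceEnc : Computability.Encoding Instance Bool where
  encode I := unaryWord I.code
  decode w := if h : ∃ I : Instance, unaryWord I.code = w then some h.choose else none
  decode_encode I := by
    have h : ∃ J : Instance, unaryWord J.code = unaryWord I.code := ⟨I, rfl⟩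
    rw [dif_pos h]
    exact congrArg some (Instance.code_injective (unaryWord_injective h.choose_spec))

/-- The problem `Π`-Above-Average, with parameter `k`. -/
noncomputable def aboveAverage (P : Finset (Equiv.Perm (Fin 3))) : ParamProblem where
  Inst := Instance
  Sym := Bool
  symFintype := inferInstance
  enc := instanceEnc
  Yes I k := IsYes P I.multiset k

/-- Linear Ordering Above Average: the case `Π = {(123)}`. -/
noncomputable def linearOrderingAA : ParamProblem := aboveAverage {1}

/-! ## Splitting, reducing and re-encoding -/

section Split

variable {V : Type} [Fintype V] [DecidableEq V]

/-- The arcs `(u, v)` and `(v, w)` of all constraints `(u, v, w)`. -/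
def arcs (C : Multiset (Constraint V)) : Multiset (V × V) :=
  C.map (fun c => (c 0, c 1)) + C.map (fun c => (c 1, c 2))

/-- The betweenness constraints `(v, {u, w})` of all constraints `(u, v, w)`. -/
def betweenness (C : Multiset (Constraint V)) : Multiset (V × Finset V) :=
  C.map fun c => (c 1, {c 0, c 2})

/-- Delete pairs of mutually opposite arcs as long as there are any: an arc `(u, v)` of
multiplicity `p` whose opposite has multiplicity `q` keeps the multiplicity `p - q`, or `0` if
`p < q`. -/
def reduceArcs (A : Multiset (V × V)) : Multiset (V × V) :=
  A - A.map Prod.swap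

/-- The complete set of betweenness constraints over `S = {u, v, w}`:
`(u, {v, w})`, `(v, {u, w})`, `(w, {u, v})`. -/
def completeSet (S : Finset V) : Multiset (V × Finset V) :=
  S.val.map fun v => (v, S.erase v)

/-- Delete complete 3-sets of betweenness constraints as long as there are any: over a 3-set `S`,
as many copies as the least multiplicity of its three constraints. -/
noncomputable def reduceBetweenness (B : Multiset (V × Finset V)) : Multiset (V × Finset V) :=
  B - ∑ S ∈ (Finset.univ : Finset V).powersetCard 3,
        (sInf ((fun v => B.count (v, S.erase v)) '' (S : Set V))) • completeSet S

/-- The number of arcs and betweenness constraints that remain. -/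
noncomputable def remaining (C : Multiset (Constraint V)) : ℕ :=
  Multiset.card (reduceArcs (arcs C)) + Multiset.card (reduceBetweenness (betweenness C))

/-- The triples of the new instance, over `V` and a new variable `ω = none`: the triples
`(ω, u, v)`, `(u, ω, v)`, `(u, v, ω)` for each remaining arc `(u, v)`, and the triples
`(b, a, c)`, `(c, a, b)` for each remaining betweenness constraint `(a, {b, c})`. -/
noncomputable def newTriples (C : Multiset (Constraint V)) : Multiset (Option V × Option V × Option V) :=
  ((reduceArcs (arcs C)).bind fun a =>
      {(none, some a.1, some a.2), (some a.1, none, some a.2), (some a.1, some a.2, none)}) +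
    (reduceBetweenness (betweenness C)).bind fun b =>
      b.2.offDiag.val.map fun p => (some p.1, some b.1, some p.2)

end Split

/-- `J` is, up to the names of the variables, the instance whose constraints are the new triples
of `I` and whose variables are those that occur in them. -/
def IsReencoding (I J : Instance) : Prop :=
  (∀ x : Fin J.n, ∃ c ∈ J.constraints, ∃ i, c i = x) ∧
    ∃ e : Fin J.n ↪ Option (Fin I.n),
      J.multiset.map (fun c => (e (c 0), e (c 1), e (c 2))) = newTriples I.multiset

end PermCSP

/-! ## Structured programs on stacks and their translation to Turing machines -/

/-! Score an ordering by its number of satisfied constraints minus the mean `|C|/6`. Twice the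
deviation of a triple `(u,v,w)` is the sum of the deviations of the arcs `(u,v)`, `(v,w)` and of the
betweenness constraint `(v,{u,w})` (`two_mul_tripleDev`). Deviations of opposite arcs cancel, and so
do those of a complete 3-set, because exactly one of its members holds in any ordering; hence
deletion does not change the doubled score (`two_mul_score`). Conversely, an arc has the same
deviation as the three ways of inserting `ω` into it together, and a betweenness constraint the same
as its two triples. So the new instance has exactly twice the old score wherever `ω` is placed
(`newTriples_score`), whence `k' = 2k`.

That many remaining constraints force a yes-instance is shown by Fourier analysis. Two random bits
give each vertex one of four levels; vertices are ordered by level, and ties are broken uniformly.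
The mean score over the tie-breaks, `gain`, has degree at most 6 in the bits and mean zero. Each
remaining arc or betweenness constraint is detected by a character (`mean_gain_arc`,
`mean_gain_between`), so Bessel's inequality bounds the second moment of `gain` from below by a
constant times `r + s`. Bonami's inequality, which compares the fourth moment with the second,
bounds it from above by a constant times the square of any upper bound for `gain`
(`mean_sq_le_of_le`). On a no-instance `gain < 2k`, so `r + s` is less than `2^36 k^2`
(`isYes_of_le_remaining`).

The kernelization counts the new triples, `3r + 2s` in number. If they are too many for the number
of binary digits of `k`, or if `k = 0`, it outputs a trivial yes-instance, otherwise the new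
instance. For the running time, the map is written in a small language of expressions with
polynomially long values (`Expr.output`), which is compiled to stack programs (`Ex.Related.runs`)
and these to Turing machines (`Exec.steps`). -/

namespace StackProgram

open Function

variable {Γ : Type}

/-- Structured programs that operate on stacks with names in `ℕ`. -/
inductive Cmd (Γ : Type) : Type
  | skip : Cmd Γ
  | push (k : ℕ) (a : Γ) : Cmd Γ
  | pop (k : ℕ) : Cmd Γ
  | move (k l : ℕ) : Cmd Γ
  | seq (c d : Cmd Γ) : Cmd Γ
  | ifTop (k : ℕ) (a : Γ) (c d : Cmd Γ) : Cmd Γ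
  | loop (k : ℕ) (c : Cmd Γ) : Cmd Γ

/-- The contents of all stacks. -/
abbrev Store (Γ : Type) : Type := ℕ → List Γ

/-- `Exec c S t T`: started on the store `S`, the program `c` ends after `t` steps with the
store `T`. -/
inductive Exec : Cmd Γ → Store Γ → ℕ → Store Γ → Prop
  | skip (S) : Exec .skip S 1 S
  | push (S k a) : Exec (.push k a) S 1 (update S k (a :: S k))
  | pop (S k) : Exec (.pop k) S 1 (update S k (S k).tail)
  | move_nil (S k l) : S k = [] → Exec (.move k l) S 1 S
  | move_cons (S k l a x) : S k = a :: x →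
      Exec (.move k l) S 1 (update (update S k x) l (a :: update S k x l))
  | seq {c d S T U s t} : Exec c S s T → Exec d T t U → Exec (.seq c d) S (s + t) U
  | if_pos {c d S T t k a} : (S k).head? = some a → Exec c S t T →
      Exec (.ifTop k a c d) S (1 + t) T
  | if_neg {c d S T t k a} : (S k).head? ≠ some a → Exec d S t T →
      Exec (.ifTop k a c d) S (1 + t) T
  | loop_nil {c S k} : S k = [] → Exec (.loop k c) S 1 S
  | loop_cons {c S T U k s t} : S k ≠ [] → Exec c S s T → Exec (.loop k c) T t U →
      Exec (.loop k c) S (1 + s + t) U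

/-- A bound for the names of the stacks that occur in a program. -/
def Cmd.width : Cmd Γ → ℕ
  | .skip => 0
  | .push k _ => k + 1
  | .pop k => k + 1
  | .move k l => max (k + 1) (l + 1)
  | .seq c d => max c.width d.width
  | .ifTop k _ c d => max (k + 1) (max c.width d.width)
  | .loop k c => max (k + 1) c.width

/-- The labels of the Turing machine for a program. -/
def Cmd.Label : Cmd Γ → Type
  | .skip => Unit
  | .push _ _ => Unit
  | .pop _ => Unit
  | .move _ _ => Unit
  | .seq c d => c.Label ⊕ d.Label
  | .ifTop _ _ c d => Option (c.Label ⊕ d.Label)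
  | .loop _ c => Option c.Label

theorem Cmd.finite_label (c : Cmd Γ) : Finite c.Label := by
  induction c with
  | skip => exact inferInstanceAs (Finite Unit)
  | push => exact inferInstanceAs (Finite Unit)
  | pop => exact inferInstanceAs (Finite Unit)
  | move => exact inferInstanceAs (Finite Unit)
  | seq c d => exact inferInstanceAs (Finite (c.Label ⊕ d.Label))
  | ifTop _ _ c d => exact inferInstanceAs (Finite (Option (c.Label ⊕ d.Label)))
  | loop _ c => exact inferInstanceAs (Finite (Option c.Label))

/-- The label at which a program starts. -/
def Cmd.entry : (c : Cmd Γ) → c.Label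
  | .skip => ()
  | .push _ _ => ()
  | .pop _ => ()
  | .move _ _ => ()
  | .seq c _ => Sum.inl c.entry
  | .ifTop _ _ _ _ => none
  | .loop _ _ => none

variable [DecidableEq Γ] [Inhabited Γ]

/-- The statements of the Turing machine for a program, whose labels are embedded by `inj` into the
labels of a larger machine, and which jumps to `exit` at its end. The internal state stores the
symbol read last. -/
def Cmd.stmt {K Λ : Type} (name : ℕ → K) :
    (c : Cmd Γ) → (c.Label → Λ) → Λ → c.Label →
      Turing.TM2.Stmt (fun _ : K => Γ) Λ (Option Γ)
  | .skip, _, exit, _ => .goto fun _ => exit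
  | .push k a, _, exit, _ => .push (name k) (fun _ => a) (.goto fun _ => exit)
  | .pop k, _, exit, _ => .pop (name k) (fun s _ => s) (.goto fun _ => exit)
  | .move k l, _, exit, _ => .pop (name k) (fun _ o => o)
      (.branch (fun s => s.isSome)
        (.push (name l) (fun s => s.getD default) (.goto fun _ => exit)) (.goto fun _ => exit))
  | .seq c d, inj, exit, x =>
    match x with
    | .inl x => c.stmt name (fun y => inj (Sum.inl y)) (inj (Sum.inr d.entry)) x
    | .inr x => d.stmt name (fun y => inj (Sum.inr y)) exit x
  | .ifTop k a c d, inj, exit, x =>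
    match x with
    | none => .peek (name k) (fun _ o => o) (.branch (fun s => decide (s = some a))
        (.goto fun _ => inj (some (Sum.inl c.entry))) (.goto fun _ => inj (some (Sum.inr d.entry))))
    | some (.inl x) => c.stmt name (fun y => inj (some (Sum.inl y))) exit x
    | some (.inr x) => d.stmt name (fun y => inj (some (Sum.inr y))) exit x
  | .loop k c, inj, exit, x =>
    match x with
    | none => .peek (name k) (fun _ o => o) (.branch (fun s => s.isSome)
        (.goto fun _ => inj (some c.entry)) (.goto fun _ => exit))
    | some x => c.stmt name (fun y => inj (some y)) (inj none) x

/-- `n` steps of a Turing machine lead from `a` to `b`. -/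
def Steps {α : Type} (f : α → Option α) (n : ℕ) (a b : α) : Prop :=
  (flip bind f)^[n] (some a) = some b

theorem Steps.trans {α : Type} {f : α → Option α} {m n : ℕ} {a b c : α} (h : Steps f m a b)
    (h' : Steps f n b c) : Steps f (m + n) a c := by
  unfold Steps at *
  rw [Nat.add_comm, iterate_add_apply, h, h']

theorem Steps.one {α : Type} {f : α → Option α} {a b : α} (h : f a = some b) : Steps f 1 a b := h

omit [DecidableEq Γ] [Inhabited Γ] in
theorem restrict_update {R : ℕ} {name : ℕ → Fin R} (hname : ∀ k < R, (name k : ℕ) = k)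
    (S : Store Γ) {k : ℕ} (hk : k < R) (x : List Γ) :
    (update (fun i : Fin R => S i) (name k) x) = fun i : Fin R => update S k x i := by
  funext i
  by_cases h : i = name k
  · subst h
    simp [hname k hk]
  · have : (i : ℕ) ≠ k := by
      rintro rfl
      exact h (Fin.ext (hname _ hk).symm)
    simp [h, this]

/-- The induction is on the execution, not on the program, so that the later rounds of a loop are
covered by an induction hypothesis. Commands and tests cost one machine step each, hence the step
counts agree exactly. The internal state at entry is arbitrary, since every branching is preceded by
a fresh reading of a stack. -/
theorem Exec.steps {R : ℕ} {Λ : Type} {name : ℕ → Fin R} (hname : ∀ k < R, (name k : ℕ) = k)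
    (M : Λ → Turing.TM2.Stmt (fun _ : Fin R => Γ) Λ (Option Γ)) {c : Cmd Γ} {S T : Store Γ}
    {t : ℕ} (h : Exec c S t T) (hc : c.width ≤ R) (inj : c.Label → Λ) (exit : Λ)
    (hM : ∀ x, M (inj x) = c.stmt name inj exit x) (v : Option Γ) :
    ∃ v', Steps (Turing.TM2.step M) t ⟨some (inj c.entry), v, fun i => S i⟩
      ⟨some exit, v', fun i => T i⟩ := by
  induction h generalizing exit v with
  | skip S =>
    refine ⟨v, Steps.one ?_⟩
    simp [hM, Cmd.stmt]
  | push S k a =>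
    simp only [Cmd.width] at hc
    refine ⟨v, Steps.one ?_⟩
    simp [hM, Cmd.stmt, restrict_update hname S hc, hname k hc]
  | pop S k =>
    simp only [Cmd.width] at hc
    refine ⟨v, Steps.one ?_⟩
    simp [hM, Cmd.stmt, restrict_update hname S hc, hname k hc]
  | move_nil S k l hS =>
    simp only [Cmd.width, max_le_iff] at hc
    refine ⟨none, Steps.one ?_⟩
    simp only [Turing.TM2.step, hM, Cmd.stmt, Turing.TM2.stepAux, hname k hc.1, hS,
      restrict_update hname S hc.1]
    simp only [List.head?_nil, Option.isSome_none, cond_false, List.tail_nil]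
    rw [← hS, update_eq_self]
  | move_cons S k l a x hS =>
    simp only [Cmd.width, max_le_iff] at hc
    refine ⟨some a, Steps.one ?_⟩
    simp only [Turing.TM2.step, hM, Cmd.stmt, Turing.TM2.stepAux, hname k hc.1, hS,
      restrict_update hname S hc.1, hname l hc.2, restrict_update hname _ hc.2]
    simp
  | seq _ _ ih ih' =>
    simp only [Cmd.width, max_le_iff] at hc
    obtain ⟨v', h1⟩ := ih hc.1 (fun y => inj (Sum.inl y)) _ (fun x => hM (Sum.inl x)) v
    obtain ⟨v'', h2⟩ := ih' hc.2 (fun y => inj (Sum.inr y)) exit (fun x => hM (Sum.inr x)) v'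
    exact ⟨v'', h1.trans h2⟩
  | @if_pos c d S T t k a hS _ ih =>
    simp only [Cmd.width, max_le_iff] at hc
    obtain ⟨v', h1⟩ := ih hc.2.1 (fun y => inj (some (Sum.inl y))) exit
      (fun x => hM (some (Sum.inl x))) (some a)
    refine ⟨v', Steps.trans (Steps.one ?_) h1⟩
    have hM0 := hM none
    simp only [Cmd.stmt] at hM0
    simp [Turing.TM2.step, Cmd.entry, hM0, hname k hc.1, hS]
  | @if_neg c d S T t k a hS _ ih =>
    simp only [Cmd.width, max_le_iff] at hc
    obtain ⟨v', h1⟩ := ih hc.2.2 (fun y => inj (some (Sum.inr y))) exit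
      (fun x => hM (some (Sum.inr x))) (S k).head?
    refine ⟨v', Steps.trans (Steps.one ?_) h1⟩
    have hM0 := hM none
    simp only [Cmd.stmt] at hM0
    simp [Turing.TM2.step, Cmd.entry, hM0, hname k hc.1, hS]
  | @loop_nil c S k hS =>
    simp only [Cmd.width, max_le_iff] at hc
    refine ⟨none, Steps.one ?_⟩
    have hM0 := hM none
    simp only [Cmd.stmt] at hM0
    simp [Turing.TM2.step, Cmd.entry, hM0, hname k hc.1, hS]
  | @loop_cons c S T U k s t hS _ _ ih ih' =>
    have hc' := hc
    simp only [Cmd.width, max_le_iff] at hc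
    obtain ⟨v', h1⟩ := ih hc.2 (fun y => inj (some y)) (inj none)
      (fun x => hM (some x)) (S k).head?
    obtain ⟨v'', h2⟩ := ih' hc' inj exit hM v'
    refine ⟨v'', Steps.trans (Steps.trans (Steps.one ?_) h1) h2⟩
    obtain ⟨a, x, hx⟩ := List.exists_cons_of_ne_nil hS
    have hM0 := hM none
    simp only [Cmd.stmt] at hM0
    simp [Turing.TM2.step, Cmd.entry, hM0, hname k hc.1, hx]

/-- The Turing machine for a program, with input on stack `0` and output on stack `1`. -/
noncomputable def machine [Fintype Γ] (c : Cmd Γ) : Turing.FinTM2 :=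
  haveI := c.finite_label
  letI := Fintype.ofFinite c.Label
  { K := Fin (c.width + 2)
    k₀ := 0
    k₁ := 1
    Γ := fun _ => Γ
    Λ := Option c.Label
    main := some c.entry
    ΛFin := inferInstance
    σ := Option Γ
    initialState := none
    m := fun l =>
      match l with
      | none => .load (fun _ => none) .halt
      | some x => c.stmt (fun k => Fin.ofNat (c.width + 2) k) some none x }

/-- A function is computable in polynomial time if a program maps the code of each argument to the
code of its value in polynomial time, and leaves the other stacks empty. -/
theorem computable_of_exec [Fintype Γ] {α β : Type} {ea : α → List Γ} {eb : β → List Γ} {f : α → β}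
    (c : Cmd Γ) (p : Polynomial ℕ)
    (h : ∀ x, ∃ t ≤ p.eval (ea x).length,
      Exec c (update (fun _ => []) 0 (ea x)) t (update (fun _ => []) 1 (eb (f x)))) :
    Nonempty (Turing.TM2ComputableInPolyTime ea eb f) := by
  refine ⟨{ tm := machine c
            inputAlphabet := Equiv.refl _
            outputAlphabet := Equiv.refl _
            time := p + 1
            outputsFun := fun x => ?_ }⟩
  choose t ht h using h
  have hname : ∀ k < c.width + 2, ((Fin.ofNat (c.width + 2) k : Fin _) : ℕ) = k :=
    fun k hk => Nat.mod_eq_of_lt hk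
  -- The extra step is the one at the label `none`, which resets the internal state and halts.
  refine { steps := t x + 1, evals_in_steps := ?_, steps_le_m := by simpa using ht x }
  obtain ⟨v, hv⟩ := (h x).steps hname (machine c).m (by omega) some none (fun _ => rfl) none
  have h2 : Steps (Turing.TM2.step (machine c).m) 1
      ⟨some none, v, fun i : Fin (c.width + 2) => update (fun _ => []) 1 (eb (f x)) (i : ℕ)⟩
      ⟨none, none, fun i : Fin (c.width + 2) => update (fun _ => []) 1 (eb (f x)) (i : ℕ)⟩ := rfl
  have h3 := hv.trans h2
  have e1 : Turing.initList (machine c) (List.map (Equiv.refl Γ).invFun (ea x)) =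
      ⟨some (some c.entry), none,
        fun i : Fin (c.width + 2) => update (fun _ => []) 0 (ea x) (i : ℕ)⟩ := by
    unfold Turing.initList
    congr 1
    funext i
    by_cases hi : i = (0 : Fin (c.width + 2))
    · subst hi
      simp [machine]
      rfl
    · have : Fin.val i ≠ 0 := fun h' => hi (Fin.ext h')
      simp only [machine] at hi ⊢
      simp [hi, update_of_ne this]
  have e2 : Turing.haltList (machine c) (List.map (Equiv.refl Γ).invFun (eb (f x))) =
      ⟨none, none,
        fun i : Fin (c.width + 2) => update (fun _ => []) 1 (eb (f x)) (i : ℕ)⟩ := by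
    unfold Turing.haltList
    congr 1
    funext i
    by_cases hi : i = (1 : Fin (c.width + 2))
    · subst hi
      simp [machine]
      rfl
    · have : Fin.val i ≠ 1 := fun h' => hi (Fin.ext (by simpa using h'))
      simp only [machine] at hi ⊢
      simp [hi, update_of_ne this]
  simp only [Option.map_some]
  erw [e1, e2]
  exact h3

end StackProgram

/-! ## A language of polynomially bounded expressions -/

namespace StackProgram

open Function

variable {Γ : Type}

/-- Expressions whose values are words; the length of the value of an expression is its numerical
value. The variables, which range over natural numbers, are represented by elements of `V`. -/
inductive Ex (Γ V : Type) : Type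
  | nil : Ex Γ V
  | emit (a : Γ) : Ex Γ V
  | app (e₁ e₂ : Ex Γ V) : Ex Γ V
  | var (x : V) : Ex Γ V
  | len : Ex Γ V
  | test (a : Γ) (e : Ex Γ V) : Ex Γ V
  | sub (e₁ e₂ : Ex Γ V) : Ex Γ V
  | rep (e : Ex Γ V) (f : V → Ex Γ V) : Ex Γ V

/-- The value of an expression for the input word `w`; numbers are written in unary with the
symbol `u`. -/
def Ex.eval [DecidableEq Γ] (u : Γ) (w : List Γ) : Ex Γ ℕ → List Γ
  | nil => []
  | emit a => [a]
  | app e₁ e₂ => e₁.eval u w ++ e₂.eval u w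
  | var x => List.replicate x u
  | len => List.replicate w.length u
  | test a e => if w[(e.eval u w).length]? = some a then [u] else []
  | sub e₁ e₂ => List.replicate ((e₁.eval u w).length - (e₂.eval u w).length) u
  | rep e f => (List.range (e.eval u w).length).flatMap fun i => (f i).eval u w

/-- Two expressions agree up to the representation of variables, which is given by `G`. -/
inductive Ex.Related {V W : Type} : List (V × W) → Ex Γ V → Ex Γ W → Prop
  | nil {G} : Related G .nil .nil
  | emit {G} (a) : Related G (.emit a) (.emit a)
  | app {G e₁ e₂ e₁' e₂'} : Related G e₁ e₁' → Related G e₂ e₂' →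
      Related G (.app e₁ e₂) (.app e₁' e₂')
  | var {G x x'} : (x, x') ∈ G → Related G (.var x) (.var x')
  | len {G} : Related G .len .len
  | test {G e e'} (a) : Related G e e' → Related G (.test a e) (.test a e')
  | sub {G e₁ e₂ e₁' e₂'} : Related G e₁ e₁' → Related G e₂ e₂' →
      Related G (.sub e₁ e₂) (.sub e₁' e₂')
  | rep {G e e' f f'} : Related G e e' →
      (∀ x x', Related ((x, x') :: G) (f x) (f' x')) → Related G (.rep e f) (.rep e' f')

/-- Push as many copies of `u` on stack `d` as stack `k` has symbols, by means of the empty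
stack `b`. -/
def Cmd.count (u : Γ) (k d b : ℕ) : Cmd Γ :=
  .seq (.loop k (.seq (.move k b) (.push d u))) (.loop b (.move b k))

/-- The program that pushes the value of an expression on stack `d`. The input is on stack `0`, and
the stacks from `b` on are free. -/
def Ex.compile (u : Γ) : Ex Γ ℕ → ℕ → ℕ → Cmd Γ
  | nil, _, _ => .skip
  | emit a, d, _ => .push d a
  | app e₁ e₂, d, b => .seq (e₁.compile u d b) (e₂.compile u d b)
  | var x, d, b => Cmd.count u x d b
  | len, d, b => Cmd.count u 0 d b
  -- The value of `e` counts how many letters are carried from the input to stack `b + 1`; the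
  -- letter in question is then on top, and afterwards the input is restored.
  | test a e, d, b => .seq (e.compile u b (b + 2))
      (.seq (.loop b (.seq (.pop b) (.move 0 (b + 1))))
        (.seq (.ifTop 0 a (.push d u) .skip) (.loop (b + 1) (.move (b + 1) 0))))
  | sub e₁ e₂, d, b => .seq (e₁.compile u b (b + 2))
      (.seq (e₂.compile u (b + 1) (b + 2))
        (.seq (.loop (b + 1) (.seq (.pop (b + 1)) (.pop b)))
          (.loop b (.seq (.pop b) (.push d u)))))
  -- Stack `b` counts the remaining rounds; stack `b + 1` holds the loop index in unary and is the
  -- name under which the body refers to it.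
  | rep e f, d, b => .seq (e.compile u b (b + 2))
      (.seq (.loop b (.seq (.pop b) (.seq ((f (b + 1)).compile u d (b + 2)) (.push (b + 1) u))))
        (.loop (b + 1) (.pop (b + 1))))

/-- A polynomial that bounds both the length of the value and the running time. -/
noncomputable def Ex.bound : Ex Γ ℕ → ℕ → Polynomial ℕ
  | nil, _ => 1
  | emit _, _ => 1
  | app e₁ e₂, b => e₁.bound b + e₂.bound b
  | var _, _ => 5 * .X + 2
  | len, _ => 5 * .X + 2
  | test _ e, b => 6 * e.bound (b + 2) + 10
  | sub e₁ e₂, b => 5 * e₁.bound (b + 2) + 5 * e₂.bound (b + 2) + 5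
  -- The loop index is less than the value of `e`, so inside the body the bound on all variables
  -- grows by `e.bound`; hence the composition.
  | rep e f, b => e.bound (b + 2) *
      (((f (b + 1)).bound (b + 2)).comp (.X + e.bound (b + 2)) + 6) + 5

/-- `Runs c S n T`: the program `c` leads from `S` to `T` in at most `n` steps. -/
def Runs (c : Cmd Γ) (S : Store Γ) (n : ℕ) (T : Store Γ) : Prop :=
  ∃ t ≤ n, Exec c S t T

theorem Runs.mono {c : Cmd Γ} {S T : Store Γ} {m n : ℕ} (h : Runs c S m T) (hmn : m ≤ n) :
    Runs c S n T :=
  let ⟨t, ht, h⟩ := h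
  ⟨t, ht.trans hmn, h⟩

theorem Runs.congr {c : Cmd Γ} {S T T' : Store Γ} {m n : ℕ} (h : Runs c S m T) (hmn : m ≤ n)
    (hT : T = T') : Runs c S n T' :=
  hT ▸ h.mono hmn

theorem Exec.runs {c : Cmd Γ} {S T : Store Γ} {t : ℕ} (h : Exec c S t T) : Runs c S t T :=
  ⟨t, le_rfl, h⟩

theorem Runs.seq {c d : Cmd Γ} {S T U : Store Γ} {m n : ℕ} (h : Runs c S m T)
    (h' : Runs d T n U) : Runs (.seq c d) S (m + n) U :=
  let ⟨s, hs, h⟩ := h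
  let ⟨t, ht, h'⟩ := h'
  ⟨s + t, add_le_add hs ht, .seq h h'⟩

/-- A loop that shortens stack `k` by one symbol at each iteration; `I i` is the store after
`i` iterations. -/
theorem runs_loop {c : Cmd Γ} {k : ℕ} (n m : ℕ) (I : ℕ → Store Γ)
    (hI : ∀ i ≤ n, (I i k).length = n - i) (h : ∀ i < n, Runs c (I i) m (I (i + 1))) :
    Runs (.loop k c) (I 0) (n * (m + 1) + 1) (I n) := by
  induction n generalizing I with
  | zero =>
    refine (Exec.loop_nil ?_).runs.mono (by omega)
    have := hI 0 le_rfl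
    exact List.length_eq_zero_iff.1 (by simpa using this)
  | succ n ih =>
    obtain ⟨s, hs, h0⟩ := h 0 (by omega)
    obtain ⟨t, ht, h1⟩ := ih (fun i => I (i + 1))
      (fun i hi => by rw [hI (i + 1) (by omega)]; omega) (fun i hi => h (i + 1) (by omega))
    refine ⟨1 + s + t, ?_, .loop_cons ?_ h0 h1⟩
    · have : (n + 1) * (m + 1) = n * (m + 1) + m + 1 := by ring
      omega
    · intro h'
      have := hI 0 (by omega)
      simp [h'] at this

/-- A single formula for both cases of `move`: on an empty stack both updates are trivial. -/
theorem exec_move {S : Store Γ} {k l : ℕ} (hkl : k ≠ l) :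
    Exec (.move k l) S 1
      (update (update S k (S k).tail) l ((S k).head?.toList ++ S l)) := by
  rcases h : S k with _ | ⟨a, x⟩
  · convert Exec.move_nil S k l h using 1
    simp only [List.tail_nil, List.head?_nil, Option.toList_none, List.nil_append]
    rw [← h, update_eq_self, update_eq_self]
  · convert Exec.move_cons S k l a x h using 2
    · rfl
    · rw [update_of_ne hkl.symm]
      rfl

theorem runs_move_all {S : Store Γ} {k l : ℕ} (hkl : k ≠ l) :
    Runs (.loop k (.move k l)) S (2 * (S k).length + 1)
      (update (update S k []) l ((S k).reverse ++ S l)) := by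
  have := runs_loop (c := .move k l) (k := k) (S k).length 1
    (fun i => update (update S k ((S k).drop i)) l (((S k).take i).reverse ++ S l))
    (fun i hi => by simp [update_of_ne hkl])
    (fun i hi => by
      convert (exec_move hkl).runs using 1
      funext j
      by_cases hj : j = l
      · subst hj
        simp only [update_self, update_of_ne hkl]
        rw [List.head?_drop, List.take_add_one, List.reverse_append, List.append_assoc]
        simp [List.getElem?_eq_getElem hi]
      · by_cases hk : j = k
        · subst hk
          simp [hj]
        · simp [hj, hk])
  simp only [List.drop_zero, List.take_zero, List.reverse_nil, List.nil_append, update_eq_self,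
    List.drop_length, List.take_length] at this
  exact this.mono (by omega)

/-- Stack `k` is reversed onto `b` with one push on `d` per symbol, and the second loop reverses it
back. -/
theorem runs_count {S : Store Γ} (u : Γ) {k d b : ℕ} (hkd : k ≠ d) (hkb : k ≠ b) (hdb : d ≠ b)
    (hb : S b = []) :
    Runs (Cmd.count u k d b) S (5 * (S k).length + 2)
      (update S d (List.replicate (S k).length u ++ S d)) := by
  have h1 := runs_loop (c := .seq (.move k b) (.push d u)) (k := k) (S k).length 2
    (fun i => update (update (update S k ((S k).drop i)) b ((S k).take i).reverse) d
      (List.replicate i u ++ S d))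
    (fun i hi => by simp [update_of_ne hkd, update_of_ne hkb])
    (fun i hi => by
      refine ((exec_move hkb).runs.seq (Exec.push _ _ _).runs).congr (by omega) ?_
      funext j
      by_cases hj : j = d
      · subst hj
        simp [update_of_ne hdb, update_of_ne hkd.symm, List.replicate_succ]
      · by_cases hk : j = b
        · subst hk
          simp only [update_of_ne hdb.symm, update_self, update_of_ne hkd, update_of_ne hkb]
          rw [List.head?_drop, List.take_add_one, List.reverse_append]
          simp [List.getElem?_eq_getElem hi]
        · by_cases hk' : j = k
          · subst hk'
            simp [hj, hk]
          · simp [hj, hk, hk'])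
  have h2 := runs_move_all (S := update (update (update S k []) b (S k).reverse) d
      (List.replicate (S k).length u ++ S d)) hkb.symm
  simp only [List.drop_zero, List.take_zero, List.reverse_nil, update_eq_self, List.replicate_zero,
    List.nil_append, List.drop_length, List.take_length] at h1
  rw [show update S b [] = S by rw [← hb, update_eq_self], update_eq_self] at h1
  refine (h1.seq h2).congr ?_ ?_
  · simp [update_of_ne hdb.symm]
    omega
  · funext j
    by_cases hj : j = d
    · subst hj
      simp [update_of_ne hdb, update_of_ne hkd.symm]
    · by_cases hk : j = k
      · subst hk
        simp [update_of_ne hkd, update_of_ne hkb, update_of_ne hdb.symm]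
      · by_cases hk' : j = b
        · subst hk'
          simp [hj, hk, hb]
        · simp [hj, hk, hk']

/-- Variables of the compiled expression `e` are stack names, those of the evaluated expression `e'`
are numbers, and `G` pairs each stack with the number that it holds in unary. `M` bounds the input
length and all variables. The value appears reversed on `d` because it is pushed letter by letter.
Length and running time are bounded together, since the length of a value controls the number of
rounds of a loop. -/
theorem Ex.Related.runs [DecidableEq Γ] (u : Γ) (w : List Γ) {G : List (ℕ × ℕ)} {e e' : Ex Γ ℕ}
    (h : Ex.Related G e e') (b d M : ℕ) (S : Store Γ) (hw : S 0 = w) (hM : w.length ≤ M)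
    (hS : ∀ k ≥ b, S k = []) (hd : 0 < d) (hdb : d < b)
    (hG : ∀ p ∈ G, p.1 < b ∧ p.1 ≠ d ∧ S p.1 = List.replicate p.2 u ∧ p.2 ≤ M) :
    (e'.eval u w).length ≤ (e.bound b).eval M ∧
      Runs (e.compile u d b) S ((e.bound b).eval M)
        (update S d ((e'.eval u w).reverse ++ S d)) := by
  induction h generalizing b d M S with
  | nil =>
    simp only [Ex.eval, Ex.compile, Ex.bound]
    refine ⟨by simp, (Exec.skip S).runs.congr (by simp) (by simp)⟩
  | emit a =>
    simp only [Ex.eval, Ex.compile, Ex.bound]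
    refine ⟨by simp, (Exec.push S d a).runs.congr (by simp) (by simp)⟩
  | @app G e₁ e₂ e₁' e₂' h₁ h₂ ih₁ ih₂ =>
    simp only [Ex.eval, Ex.compile, Ex.bound, Polynomial.eval_add, List.length_append]
    obtain ⟨l1, r1⟩ := ih₁ b d M S hw hM hS hd hdb hG
    obtain ⟨l2, r2⟩ := ih₂ b d M (update S d ((e₁'.eval u w).reverse ++ S d)) (by rw [update_of_ne hd.ne]; exact hw) hM
      (fun k hk => by rw [update_of_ne (by omega)]; exact hS k hk) hd hdb
      (fun p hp => by rw [update_of_ne (hG p hp).2.1]; exact hG p hp)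
    exact ⟨by omega, (r1.seq r2).congr le_rfl (by simp)⟩
  | @var G x x' hx =>
    obtain ⟨h1, h2, h3, h4⟩ := hG _ hx
    simp only at h1 h2 h3 h4
    simp only [Ex.eval, Ex.compile, Ex.bound, Polynomial.eval_add, Polynomial.eval_mul,
      Polynomial.eval_X, Polynomial.eval_ofNat, List.length_replicate]
    refine ⟨by omega, (runs_count u h2 (by omega) (by omega) (hS b le_rfl)).congr ?_ ?_⟩
    · rw [h3, List.length_replicate]
      omega
    · rw [h3, List.length_replicate, List.reverse_replicate]
  | len =>
    simp only [Ex.eval, Ex.compile, Ex.bound, Polynomial.eval_add, Polynomial.eval_mul,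
      Polynomial.eval_X, Polynomial.eval_ofNat, List.length_replicate]
    refine ⟨by omega, (runs_count u hd.ne (by omega) (by omega) (hS b le_rfl)).congr ?_ ?_⟩
    · rw [hw]
      omega
    · rw [hw, List.reverse_replicate]
  | @test G e e' a h ih =>
    simp only [Ex.eval, Ex.compile, Ex.bound, Polynomial.eval_add, Polynomial.eval_mul,
      Polynomial.eval_ofNat]
    obtain ⟨l1, r1⟩ := ih (b + 2) b M S hw hM (fun k hk => hS k (by omega)) (by omega) (by omega)
      (fun p hp => ⟨by have := (hG p hp).1; omega, by have := (hG p hp).1; omega, (hG p hp).2.2⟩)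
    set l := e'.eval u w
    set p := (e.bound (b + 2)).eval M
    -- If the index is beyond the end of the input, the surplus moves act on an empty stack and the
    -- test then finds no symbol, in accordance with `w[i]? = none`.
    have r2 := runs_loop (c := .seq (.pop b) (.move 0 (b + 1))) (k := b) l.length 2
      (fun i => update (update (update S b (l.reverse.drop i)) 0 (w.drop i)) (b + 1)
        (w.take i).reverse)
      (fun i hi => by simp [update_of_ne (show b ≠ 0 by omega)])
      (fun i hi => by
        refine ((Exec.pop _ _).runs.seq (exec_move (by omega)).runs).congr (by omega) ?_
        funext j
        by_cases hj : j = b + 1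
        · subst hj
          simp only [update_self, update_of_ne (show b + 1 ≠ b by omega),
            update_of_ne (show 0 ≠ b + 1 by omega),
            update_of_ne (show 0 ≠ b by omega)]
          rw [List.head?_drop, List.take_add_one, List.reverse_append]
          cases w[i]? <;> simp
        · by_cases hk : j = 0
          · subst hk
            simp [update_of_ne (show 0 ≠ b by omega)]
          · by_cases hk' : j = b
            · subst hk'
              simp [hk]
            · simp [hj, hk, hk'])
    have hb0 : b ≠ 0 := by omega
    have hbd : b ≠ d := by omega
    have r3 : Runs (.ifTop 0 a (.push d u) .skip)
        (update (update (update S b []) 0 (w.drop l.length)) (b + 1) (w.take l.length).reverse) 2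
        (update (update (update (update S b []) 0 (w.drop l.length)) (b + 1)
          (w.take l.length).reverse) d ((if w[l.length]? = some a then [u] else []) ++ S d)) := by
      split_ifs with hif
      · refine (Exec.if_pos ?_ (Exec.push _ _ _)).runs.congr (by omega) ?_
        · simp [hif]
        · simp [update_of_ne hd.ne', update_of_ne hdb.ne, update_of_ne (show d ≠ b + 1 by omega)]
      · refine (Exec.if_neg ?_ (Exec.skip _)).runs.congr (by omega) ?_
        · simp [hif]
        · funext j
          by_cases hj : j = d
          · subst hj
            simp [update_of_ne hd.ne', update_of_ne hdb.ne, update_of_ne (show j ≠ b + 1 by omega)]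
          · simp [hj]
    have r4 := runs_move_all (S := update (update (update (update S b []) 0 (w.drop l.length)) (b + 1)
          (w.take l.length).reverse) d ((if w[l.length]? = some a then [u] else []) ++ S d))
          (show b + 1 ≠ 0 by omega)
    have e2 : update S b (l.reverse ++ S b) =
      update (update (update S b (l.reverse.drop 0)) 0 (w.drop 0)) (b + 1) (w.take 0).reverse := by
      funext j
      by_cases hj : j = b + 1
      · subst hj
        simp [hS]
      · by_cases hk : j = 0
        · subst hk
          simp [hb0.symm, hw]
        · by_cases hk' : j = b
          · subst hk'
            simp [hk, hS]
          · simp [hj, hk, hk']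
    rw [e2] at r1
    rw [show l.reverse.drop l.length = [] by simp] at r2
    refine ⟨by split_ifs <;> simp, (r1.seq (r2.seq (r3.seq r4))).congr ?_ ?_⟩
    · simp only [update_of_ne (show b + 1 ≠ d by omega), update_self, List.length_reverse,
        List.length_take]
      have := min_le_left l.length w.length
      omega
    · funext j
      by_cases hj : j = 0
      · subst hj
        simp [hd.ne, hw, update_of_ne (show b + 1 ≠ d by omega)]
      · by_cases hk : j = b + 1
        · subst hk
          simp [update_of_ne (show b + 1 ≠ d by omega), hS]
        · by_cases hk' : j = d
          · subst hk'
            simp only [update_of_ne hj, update_of_ne hk, update_self]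
            split_ifs <;> simp
          · by_cases hk'' : j = b
            · subst hk''
              simp [hj, hk', hS]
            · simp [hj, hk, hk', hk'']
  | @sub G e₁ e₂ e₁' e₂' h₁ h₂ ih₁ ih₂ =>
    simp only [Ex.eval, Ex.compile, Ex.bound, Polynomial.eval_add, Polynomial.eval_mul,
      Polynomial.eval_ofNat, List.length_replicate, List.reverse_replicate]
    obtain ⟨l1, r1⟩ := ih₁ (b + 2) b M S hw hM (fun k hk => hS k (by omega)) (by omega) (by omega)
      (fun p hp => ⟨by have := (hG p hp).1; omega, by have := (hG p hp).1; omega, (hG p hp).2.2⟩)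
    obtain ⟨l2, r2⟩ := ih₂ (b + 2) (b + 1) M (update S b ((e₁'.eval u w).reverse ++ S b))
      (by rw [update_of_ne (by omega)]; exact hw) hM
      (fun k hk => by rw [update_of_ne (by omega)]; exact hS k (by omega)) (by omega) (by omega)
      (fun p hp => by
        have := (hG p hp).1
        rw [update_of_ne (by omega)]
        exact ⟨by omega, by omega, (hG p hp).2.2⟩)
    set l := e₁'.eval u w
    set m := e₂'.eval u w
    set p := (e₁.bound (b + 2)).eval M
    set q := (e₂.bound (b + 2)).eval M
    have hbd : b ≠ d := by omega
    -- Popping an empty stack has no effect, which makes the subtraction truncated.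
    have r3 := runs_loop (c := .seq (.pop (b + 1)) (.pop b)) (k := b + 1) m.length 2
      (fun i => update (update S b (l.reverse.drop i)) (b + 1) (m.reverse.drop i))
      (fun i hi => by simp)
      (fun i hi => by
        refine ((Exec.pop _ _).runs.seq (Exec.pop _ _).runs).congr (by omega) ?_
        funext j
        by_cases hj : j = b + 1
        · subst hj
          simp
        · by_cases hk : j = b
          · subst hk
            simp
          · simp [hj, hk])
    have r4 := runs_loop (c := .seq (.pop b) (.push d u)) (k := b) (l.length - m.length) 2
      (fun i => update (update S b (l.reverse.drop (m.length + i))) d (List.replicate i u ++ S d))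
      (fun i hi => by simp [update_of_ne hbd]; omega)
      (fun i hi => by
        refine ((Exec.pop _ _).runs.seq (Exec.push _ _ _).runs).congr (by omega) ?_
        funext j
        by_cases hj : j = d
        · subst hj
          simp [hbd.symm, List.replicate_succ]
        · by_cases hk : j = b
          · subst hk
            simp [hj, add_assoc]
          · simp [hj, hk])
    have e2 : update (update S b (l.reverse ++ S b)) (b + 1)
        (m.reverse ++ update S b (l.reverse ++ S b) (b + 1)) =
        update (update S b (l.reverse.drop 0)) (b + 1) (m.reverse.drop 0) := by
      simp [hS]
    rw [e2] at r2
    have e3 : update (update S b (l.reverse.drop m.length)) (b + 1) (m.reverse.drop m.length) =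
        update (update S b (l.reverse.drop (m.length + 0))) d (List.replicate 0 u ++ S d) := by
      funext j
      by_cases hj : j = d
      · subst hj
        simp [hbd.symm, update_of_ne (show j ≠ b + 1 by omega)]
      · by_cases hk : j = b + 1
        · subst hk
          simp [hj, hS]
        · simp [hj, hk]
    rw [e3] at r3
    refine ⟨by omega, (r1.seq (r2.seq (r3.seq r4))).congr (by omega) ?_⟩
    funext j
    by_cases hj : j = d
    · subst hj
      simp
    · by_cases hk : j = b
      · subst hk
        simp [hj, hS]
        omega
      · simp [hj, hk]
  | @rep G e e' f f' h hf ih ihf =>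
    simp only [Ex.eval, Ex.compile, Ex.bound, Polynomial.eval_add, Polynomial.eval_mul,
      Polynomial.eval_ofNat, Polynomial.eval_comp, Polynomial.eval_X]
    obtain ⟨l1, r1⟩ := ih (b + 2) b M S hw hM (fun k hk => hS k (by omega)) (by omega) (by omega)
      (fun p hp => ⟨by have := (hG p hp).1; omega, by have := (hG p hp).1; omega, (hG p hp).2.2⟩)
    set l := e'.eval u w
    set p := (e.bound (b + 2)).eval M
    set q := ((f (b + 1)).bound (b + 2)).eval (M + p)
    have hbd : b ≠ d := by omega
    -- The invariant: after `i` rounds, `i` symbols are gone from the counter, the index stack holds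
    -- `i`, and `d` has received the first `i` values.
    let I : ℕ → Store Γ := fun i => update (update (update S b (l.reverse.drop i)) (b + 1)
      (List.replicate i u)) d (((List.range i).flatMap fun i => (f' i).eval u w).reverse ++ S d)
    have body : ∀ i < l.length, ((f' i).eval u w).length ≤ q ∧
        Runs ((f (b + 1)).compile u d (b + 2)) (update (I i) b (l.reverse.drop (i + 1))) q
          (update (update (I i) b (l.reverse.drop (i + 1))) d
            (((f' i).eval u w).reverse ++ update (I i) b (l.reverse.drop (i + 1)) d)) := by
      intro i hi
      -- The loop variable is the stack `b + 1` on one side and the number `i` on the other; `i <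
      -- l.length ≤ p` gives the bound `M + p`.
      refine ihf (b + 1) i (b + 2) d (M + p) _ ?_ (by omega) ?_ hd (by omega) ?_
      · simp [I, hd.ne, hw, update_of_ne (show 0 ≠ b by omega)]
      · intro k hk
        simp [I, update_of_ne (show k ≠ d by omega), update_of_ne (show k ≠ b + 1 by omega),
          update_of_ne (show k ≠ b by omega), hS k (by omega)]
      · intro r hr
        rcases List.mem_cons.1 hr with rfl | hr
        · refine ⟨by omega, by simp only; omega, ?_, by simp only; omega⟩
          simp [I, update_of_ne (show b + 1 ≠ d by omega)]
        · obtain ⟨h1, h2, h3, h4⟩ := hG r hr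
          refine ⟨by omega, h2, ?_, by omega⟩
          simp [I, update_of_ne h2, update_of_ne (show r.1 ≠ b + 1 by omega),
            update_of_ne (show r.1 ≠ b by omega), h3]
    have r2 := runs_loop (k := b) l.length (q + 2) I
      (c := .seq (.pop b) (.seq ((f (b + 1)).compile u d (b + 2)) (.push (b + 1) u)))
      (fun i hi => by simp [I, update_of_ne hbd])
      (fun i hi => by
        have h1 : Runs (.pop b) (I i) 1 (update (I i) b (l.reverse.drop (i + 1))) := by
          refine (Exec.pop _ _).runs.congr le_rfl ?_
          simp [I, update_of_ne hbd]
        refine (h1.seq ((body i hi).2.seq (Exec.push _ _ _).runs)).congr (by omega) ?_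
        funext j
        by_cases hj : j = d
        · subst hj
          simp [I, hbd.symm, update_of_ne (show j ≠ b + 1 by omega), List.range_succ]
        · by_cases hk : j = b + 1
          · subst hk
            simp [I, hj, List.replicate_succ]
          · by_cases hk' : j = b
            · subst hk'
              simp [I, hj]
            · simp [I, hj, hk, hk'])
    have r3 := runs_loop (c := .pop (b + 1)) (k := b + 1) l.length 1
      (fun i => update (I l.length) (b + 1) (List.replicate (l.length - i) u))
      (fun i hi => by simp)
      (fun i hi => by
        refine (Exec.pop _ _).runs.congr le_rfl ?_
        simp [Nat.sub_sub])
    have e1 : update S b (l.reverse ++ S b) = I 0 := by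
      funext j
      by_cases hj : j = d
      · subst hj
        simp [I, hbd.symm]
      · by_cases hk : j = b + 1
        · subst hk
          simp [I, hj, hS]
        · by_cases hk' : j = b
          · subst hk'
            simp [I, hj, hS]
          · simp [I, hj, hk, hk']
    rw [e1] at r1
    have e2 : update (I l.length) (b + 1) (List.replicate (l.length - 0) u) = I l.length := by
      funext j
      by_cases hk : j = b + 1
      · subst hk
        simp [I, update_of_ne (show b + 1 ≠ d by omega)]
      · simp [hk]
    simp only [e2] at r3
    have hlen : ∀ n ≤ l.length,
        ((List.range n).flatMap fun i => (f' i).eval u w).length ≤ n * q := by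
      intro n hn
      induction n with
      | zero => simp
      | succ n ih =>
        rw [List.range_succ, List.flatMap_append, List.length_append, add_mul]
        have := (body n (by omega)).1
        have := ih (by omega)
        simp only [List.flatMap_cons, List.flatMap_nil, List.append_nil]
        omega
    have hlq : l.length * (q + 6) ≤ p * (q + 6) := Nat.mul_le_mul_right _ l1
    refine ⟨?_, (r1.seq (r2.seq r3)).congr ?_ ?_⟩
    · have := hlen _ le_rfl
      nlinarith
    · nlinarith
    · funext j
      by_cases hj : j = d
      · subst hj
        simp [I, update_of_ne (show j ≠ b + 1 by omega)]
      · by_cases hk : j = b + 1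
        · subst hk
          simp [hj, hS]
        · by_cases hk' : j = b
          · subst hk'
            simp [I, hj, hS]
          · simp [I, hj, hk, hk']

/-- A function that is given by an expression is computable in polynomial time. -/
theorem computable_of_eval [DecidableEq Γ] [Inhabited Γ] [Fintype Γ] {α β : Type}
    {ea : α → List Γ} {eb : β → List Γ} {f : α → β} (u : Γ) (e : Ex Γ ℕ) (he : e.Related [] e)
    (h : ∀ x, e.eval u (ea x) = eb (f x)) :
    Nonempty (Turing.TM2ComputableInPolyTime ea eb f) := by
  -- The value is built in reverse on stack `2`; the input is erased, and moving the value to the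
  -- output stack `1` undoes the reversal.
  refine computable_of_exec (.seq (e.compile u 2 3) (.seq (.loop 0 (.pop 0))
    (.loop 2 (.move 2 1)))) (3 * e.bound 3 + 2 * .X + 5) fun x => ?_
  set w := ea x
  set S : Store Γ := update (fun _ => []) 0 w
  obtain ⟨l1, r1⟩ := he.runs u w 3 2 w.length S (by simp [S]) le_rfl
    (fun k hk => by simp [S, show k ≠ 0 by omega]) (by omega) (by omega) (by simp)
  have r2 := runs_loop (c := .pop 0) (k := 0) w.length 1
    (fun i => update (update S 2 ((e.eval u w).reverse)) 0 (w.drop i))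
    (fun i hi => by simp)
    (fun i hi => by
      refine (Exec.pop _ _).runs.congr le_rfl ?_
      simp)
  have r3 := runs_move_all (k := 2) (l := 1)
    (S := update (update S 2 ((e.eval u w).reverse)) 0 (w.drop w.length)) (by omega)
  have e1 : update S 2 ((e.eval u w).reverse ++ S 2) =
      update (update S 2 ((e.eval u w).reverse)) 0 (w.drop 0) := by
    funext j
    by_cases hj : j = 0
    · subst hj
      simp [S]
    · by_cases hk : j = 2
      · subst hk
        simp [S]
      · simp [hj, hk]
  rw [e1] at r1
  refine (r1.seq (r2.seq r3)).congr ?_ ?_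
  · simp
    omega
  · funext j
    by_cases hj : j = 0
    · subst hj
      simp
    · by_cases hk : j = 1
      · subst hk
        simp [S, h, w]
      · by_cases hk' : j = 2
        · subst hk'
          simp
        · simp [S, hj, hk, hk']

end StackProgram

/-! ## Scores of linear orderings -/

namespace PermCSP

open Function

section Score

variable {V : Type}

/-- The deviation from the mean of the indicator of `f u < f v`. -/
def arcDev (f : V → ℕ) (u v : V) : ℚ := (if f u < f v then 1 else 0) - 1 / 2

/-- The deviation from the mean of the indicator of `f a` lying between `f b` and `f c`. -/
def betweenDev (f : V → ℕ) (a b c : V) : ℚ :=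
  (if f b < f a ∧ f a < f c ∨ f c < f a ∧ f a < f b then 1 else 0) - 1 / 3

/-- The deviation from the mean of the indicator of `f u < f v < f w`. -/
def tripleDev (f : V → ℕ) (t : V × V × V) : ℚ :=
  (if f t.1 < f t.2.1 ∧ f t.2.1 < f t.2.2 then 1 else 0) - 1 / 6

/-- The variables of a constraint. -/
def toTriple (c : Constraint V) : V × V × V := (c 0, c 1, c 2)

theorem arcDev_swap {f : V → ℕ} (hf : Injective f) {u v : V} (h : u ≠ v) :
    arcDev f u v + arcDev f v u = 0 := by
  have := hf.ne h
  unfold arcDev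
  rcases lt_or_gt_of_ne this with h | h
  · simp [h, h.not_gt]; norm_num
  · simp [h, h.not_gt]; norm_num

theorem betweenDev_comm (f : V → ℕ) (a b c : V) : betweenDev f a b c = betweenDev f a c b := by
  unfold betweenDev
  simp only [or_comm]

/-- Exactly one of three distinct elements lies between the other two, so the indicators add up to
`1 = 3 · 1/3`. -/
theorem betweenDev_rotate {f : V → ℕ} (hf : Injective f) {a b c : V} (hab : a ≠ b) (hac : a ≠ c)
    (hbc : b ≠ c) : betweenDev f a b c + betweenDev f b c a + betweenDev f c a b = 0 := by
  have h1 := hf.ne hab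
  have h2 := hf.ne hac
  have h3 := hf.ne hbc
  unfold betweenDev
  rcases lt_or_gt_of_ne h1 with h1 | h1 <;> rcases lt_or_gt_of_ne h2 with h2 | h2 <;>
    rcases lt_or_gt_of_ne h3 with h3 | h3 <;>
    first
    | (exfalso; omega)
    | (simp [h1, h2, h3, h1.not_gt, h2.not_gt, h3.not_gt]; norm_num)

/-- Of the conditions `a < b`, `b < c` and `b` between `a` and `c`, all three hold if `a < b < c`,
and exactly one holds in each of the other five orders. -/
theorem two_mul_tripleDev {f : V → ℕ} (hf : Injective f) {a b c : V} (hab : a ≠ b) (hac : a ≠ c)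
    (hbc : b ≠ c) :
    2 * tripleDev f (a, b, c) = arcDev f a b + arcDev f b c + betweenDev f b a c := by
  have h1 := hf.ne hab
  have h2 := hf.ne hac
  have h3 := hf.ne hbc
  unfold betweenDev arcDev tripleDev
  rcases lt_or_gt_of_ne h1 with h1 | h1 <;> rcases lt_or_gt_of_ne h2 with h2 | h2 <;>
    rcases lt_or_gt_of_ne h3 with h3 | h3 <;>
    first
    | (exfalso; omega)
    | (simp [h1, h3, h1.not_gt, h3.not_gt]; norm_num)

theorem sum_tripleDev (f : V → ℕ) (T : Multiset (V × V × V)) :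
    (T.map (tripleDev f)).sum =
      (T.countP fun t => f t.1 < f t.2.1 ∧ f t.2.1 < f t.2.2) - (Multiset.card T : ℚ) / 6 := by
  induction T using Multiset.induction_on with
  | empty => simp
  | cons t T ih =>
    rw [Multiset.map_cons, Multiset.sum_cons, ih, Multiset.countP_cons, Multiset.card_cons]
    unfold tripleDev
    split_ifs <;> push_cast <;> ring

theorem sum_tripleDev_map {W : Type} (f : V → ℕ) (e : W → V) (T : Multiset (W × W × W)) :
    ((T.map fun t => (e t.1, e t.2.1, e t.2.2)).map (tripleDev f)).sum =
      (T.map (tripleDev (f ∘ e))).sum := by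
  rw [Multiset.map_map]
  rfl

theorem exists_linOrdering [Fintype V] {f : V → ℕ} (hf : Injective f) :
    ∃ α : LinOrdering V, ∀ u v, α u < α v ↔ f u < f v := by
  let _ : LinearOrder V := LinearOrder.lift' f hf
  refine ⟨(Fintype.orderIsoFinOfCardEq V rfl).symm.toEquiv, fun u v => ?_⟩
  exact (Fintype.orderIsoFinOfCardEq V rfl).symm.lt_iff_lt

/-- Only comparisons matter, so orderings may be replaced by injective maps to `ℕ`, which are easier
to restrict and to extend. -/
theorem isYes_iff [Fintype V] (C : Multiset (Constraint V)) (k : ℕ) :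
    IsYes {1} C k ↔ ∃ f : V → ℕ, Injective f ∧ (k : ℚ) ≤ ((C.map toTriple).map (tripleDev f)).sum := by
  have key : ∀ (α : LinOrdering V) (f : V → ℕ), (∀ u v, α u < α v ↔ f u < f v) →
      (((({1} : Finset (Equiv.Perm (Fin 3))).card : ℚ) / 6 * (Multiset.card C : ℚ) + k ≤
        (C.countP (Satisfies {1} α) : ℚ)) ↔
        (k : ℚ) ≤ ((C.map toTriple).map (tripleDev f)).sum) := by
    intro α f h
    rw [sum_tripleDev, Multiset.countP_map, ← Multiset.countP_eq_card_filter, Multiset.card_map]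
    have : C.countP (Satisfies {1} α) = C.countP (fun c => f (toTriple c).1 < f (toTriple c).2.1 ∧
        f (toTriple c).2.1 < f (toTriple c).2.2) := by
      refine Multiset.countP_congr rfl fun c _ => ?_
      simp [Satisfies, toTriple, h]
    rw [this, Finset.card_singleton]
    push_cast
    constructor <;> intro h <;> linarith
  constructor
  · rintro ⟨α, h⟩
    exact ⟨fun v => α v, fun u v h => α.injective (Fin.ext h), (key α _ fun u v => Iff.rfl).1 h⟩
  · rintro ⟨f, hf, h⟩
    obtain ⟨α, hα⟩ := exists_linOrdering hf
    exact ⟨α, (key α f hα).2 h⟩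

end Score

/-! ### Multiplicities of remaining constraints, and invariance of the score under deletion -/

section Counts

variable {V : Type} [Fintype V] [DecidableEq V]

/-- The multiplicity of the arc `(u, v)` that remains. -/
noncomputable def arcMult (C : Multiset (Constraint V)) (u v : V) : ℕ :=
  (reduceArcs (arcs C)).count (u, v)

/-- The multiplicity of the betweenness constraint `(a, {b, c})` that remains. -/
noncomputable def betweenMult (C : Multiset (Constraint V)) (a b c : V) : ℕ :=
  (reduceBetweenness (betweenness C)).count (a, {b, c})

omit [Fintype V] in
theorem count_arcs (C : Multiset (Constraint V)) (u v : V) :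
    (arcs C).count (u, v) =
      C.countP (fun c => c 0 = u ∧ c 1 = v) + C.countP (fun c => c 1 = u ∧ c 2 = v) := by
  simp only [arcs, Multiset.count_add, Multiset.count_map, Multiset.countP_eq_card_filter,
    Prod.mk.injEq]
  simp only [eq_comm]

omit [Fintype V] in
theorem arcMult_eq (C : Multiset (Constraint V)) (u v : V) :
    arcMult C u v = (arcs C).count (u, v) - (arcs C).count (v, u) := by
  unfold arcMult reduceArcs
  rw [Multiset.count_sub]
  congr 1
  exact Multiset.count_map_eq_count' Prod.swap _ Prod.swap_injective (v, u)

omit [Fintype V] in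
theorem pair_eq_pair_iff' {a b x y : V} (h : a ≠ b) :
    ({x, y} : Finset V) = {a, b} ↔ x = a ∧ y = b ∨ x = b ∧ y = a := by
  constructor
  · intro hxy
    have h1 : a ∈ ({x, y} : Finset V) := by rw [hxy]; simp
    have h2 : b ∈ ({x, y} : Finset V) := by rw [hxy]; simp
    simp only [Finset.mem_insert, Finset.mem_singleton] at h1 h2
    rcases h1 with rfl | rfl <;> rcases h2 with rfl | rfl
    · exact absurd rfl h
    · simp
    · simp
    · exact absurd rfl h
  · rintro (⟨rfl, rfl⟩ | ⟨rfl, rfl⟩)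
    · rfl
    · exact Finset.pair_comm _ _

omit [Fintype V] in
theorem count_betweenness (C : Multiset (Constraint V)) {a b c : V} (hbc : b ≠ c) :
    (betweenness C).count (a, {b, c}) =
      C.countP (fun x => x 1 = a ∧ (x 0 = b ∧ x 2 = c ∨ x 0 = c ∧ x 2 = b)) := by
  simp only [betweenness, Multiset.count_map, Multiset.countP_eq_card_filter, Prod.mk.injEq]
  congr 1
  refine Multiset.filter_congr fun x _ => ?_
  rw [eq_comm, eq_comm (a := ({b, c} : Finset V)), pair_eq_pair_iff' hbc]

/-- The constraint `b` is formed from three distinct variables. -/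
def IsProper (b : V × Finset V) : Prop := b.2.card = 2 ∧ b.1 ∉ b.2

omit [Fintype V] in
theorem isProper_of_mem_betweenness {C : Multiset (Constraint V)} {b : V × Finset V}
    (hb : b ∈ betweenness C) : IsProper b := by
  obtain ⟨c, -, rfl⟩ := Multiset.mem_map.1 hb
  refine ⟨Finset.card_pair (c.injective.ne (by decide)), ?_⟩
  simp [c.injective.eq_iff]

theorem isProper_of_mem_reduceBetweenness {C : Multiset (Constraint V)} {b : V × Finset V}
    (hb : b ∈ reduceBetweenness (betweenness C)) : IsProper b :=
  isProper_of_mem_betweenness (Multiset.mem_of_le (Multiset.sub_le_self _ _) hb)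

omit [Fintype V] in
theorem isProper_pair {a b c : V} (h : IsProper (a, ({b, c} : Finset V))) :
    a ≠ b ∧ a ≠ c ∧ b ≠ c := by
  obtain ⟨h1, h2⟩ := h
  simp only [Finset.mem_insert, Finset.mem_singleton, not_or] at h2
  refine ⟨h2.1, h2.2, ?_⟩
  rintro rfl
  simp at h1

omit [Fintype V] in
theorem count_eq_zero_of_proper {B : Multiset (V × Finset V)} (hB : ∀ x ∈ B, IsProper x) {a b c : V}
    (h : ¬ (a ≠ b ∧ a ≠ c ∧ b ≠ c)) : B.count (a, {b, c}) = 0 :=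
  Multiset.count_eq_zero.2 fun h' => h (isProper_pair (hB _ h'))

/-- Among the subtracted complete sets only the one on `{a, b, c}` contains `(a, {b, c})`, and it
does so once; the infimum of its three multiplicities is their minimum. -/
theorem betweenMult_eq (C : Multiset (Constraint V)) {a b c : V} (hab : a ≠ b) (hac : a ≠ c)
    (hbc : b ≠ c) :
    betweenMult C a b c = (betweenness C).count (a, {b, c}) -
      min ((betweenness C).count (a, {b, c}))
        (min ((betweenness C).count (b, {c, a})) ((betweenness C).count (c, {a, b}))) := by
  unfold betweenMult reduceBetweenness
  rw [Multiset.count_sub, Multiset.count_sum']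
  congr 1
  have ecard : ({a, b, c} : Finset V).card = 3 := Finset.card_eq_three.2 ⟨a, b, c, hab, hac, hbc, rfl⟩
  have hcount : ∀ S : Finset V, (completeSet S).count (a, {b, c}) =
      if S = {a, b, c} then 1 else 0 := by
    intro S
    unfold completeSet
    split_ifs with h
    · subst h
      rw [Multiset.count_map, Multiset.card_eq_one]
      refine ⟨a, ?_⟩
      have : Multiset.filter (fun x => (a, ({b, c} : Finset V)) = (x, ({a, b, c} : Finset V).erase x))
          ({a, b, c} : Finset V).val = (Finset.filter
          (fun x => (a, ({b, c} : Finset V)) = (x, ({a, b, c} : Finset V).erase x)) {a, b, c}).val :=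
        rfl
      rw [this]
      have h2 : Finset.filter
          (fun x => (a, ({b, c} : Finset V)) = (x, ({a, b, c} : Finset V).erase x)) {a, b, c} = {a} := by
        ext x
        simp only [Finset.mem_filter, Prod.mk.injEq, Finset.mem_singleton]
        constructor
        · rintro ⟨-, h, -⟩
          exact h.symm
        · rintro rfl
          refine ⟨by simp, rfl, ?_⟩
          rw [Finset.erase_insert (by simp [hab, hac])]
      rw [h2]
      rfl
    · rw [Multiset.count_eq_zero]
      intro h'
      obtain ⟨x, hx, hxe⟩ := Multiset.mem_map.1 h'
      simp only [Prod.mk.injEq] at hxe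
      obtain ⟨rfl, hxe⟩ := hxe
      apply h
      rw [← hxe, Finset.insert_erase hx]
  simp only [Multiset.count_nsmul, hcount, mul_ite, mul_one, mul_zero]
  rw [Finset.sum_ite_eq' , if_pos (by simp [Finset.mem_powersetCard, ecard])]
  have e1 : ({a, b, c} : Finset V).erase a = {b, c} := Finset.erase_insert (by simp [hab, hac])
  have e2 : ({a, b, c} : Finset V).erase b = {c, a} := by
    rw [show ({a, b, c} : Finset V) = {b, c, a} by ext; simp; tauto]
    exact Finset.erase_insert (by simp [hbc, hab.symm])
  have e3 : ({a, b, c} : Finset V).erase c = {a, b} := by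
    rw [show ({a, b, c} : Finset V) = {c, a, b} by ext; simp; tauto]
    exact Finset.erase_insert (by simp [hac.symm, hbc.symm])
  rw [Finset.coe_insert, Finset.coe_insert, Finset.coe_singleton, Set.image_insert_eq,
    Set.image_insert_eq, Set.image_singleton, e1, e2, e3, csInf_insert (OrderBot.bddBelow _)
    (Set.insert_nonempty _ _), csInf_insert (OrderBot.bddBelow _) (Set.singleton_nonempty _),
    csInf_singleton]

theorem sum_arcs (A : Multiset (V × V)) (g : V → V → ℚ) :
    (A.map fun a => g a.1 a.2).sum = ∑ u, ∑ v, (A.count (u, v) : ℚ) * g u v := by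
  rw [Finset.sum_multiset_map_count, ← Fintype.sum_prod_type' (f := fun u v => (A.count (u, v) : ℚ) * g u v)]
  simp only [nsmul_eq_mul]
  refine Finset.sum_subset (Finset.subset_univ _) fun x _ hx => ?_
  rw [Multiset.count_eq_zero.2 (by simpa using hx)]
  simp

/-- Both sides count each constraint twice, once for each order of its unordered pair. This is the
source of the factor `1/2` in `totalDev`. -/
theorem sum_proper (B : Multiset (V × Finset V)) (hB : ∀ x ∈ B, IsProper x) (g : V → V → V → ℚ) :
    (B.map fun b => ∑ p ∈ b.2.offDiag, g b.1 p.1 p.2).sum =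
      ∑ a, ∑ b, ∑ c, (B.count (a, {b, c}) : ℚ) * g a b c := by
  induction B using Multiset.induction_on with
  | empty => simp
  | cons x B ih =>
    rw [Multiset.map_cons, Multiset.sum_cons, ih fun y hy => hB y (Multiset.mem_cons_of_mem hy)]
    obtain ⟨h1, h2⟩ := hB x (Multiset.mem_cons_self _ _)
    obtain ⟨d, P⟩ := x
    have : ∑ p ∈ P.offDiag, g d p.1 p.2 =
        ∑ a, ∑ b, ∑ c, (if (a, {b, c}) = (d, P) then 1 else 0 : ℚ) * g a b c := by
      rw [Finset.sum_eq_single d (fun a _ ha => by simp [ha]) (by simp)]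
      rw [← Fintype.sum_prod_type' (f := fun b c => (if (d, {b, c}) = (d, P) then 1 else 0 : ℚ) * g d b c)]
      simp only [ite_mul, one_mul, zero_mul, Prod.mk.injEq, true_and]
      rw [← Finset.sum_filter]
      refine Finset.sum_congr ?_ fun _ _ => rfl
      ext ⟨b, c⟩
      obtain ⟨x, y, hxy, rfl⟩ := Finset.card_eq_two.1 h1
      simp only [Finset.mem_offDiag, Finset.mem_insert, Finset.mem_singleton, ne_eq,
        Finset.mem_filter, Finset.mem_univ, true_and, pair_eq_pair_iff' hxy]
      constructor
      · rintro ⟨rfl | rfl, rfl | rfl, h⟩ <;> simp_all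
      · rintro (⟨rfl, rfl⟩ | ⟨rfl, rfl⟩)
        · simp [hxy]
        · simp [Ne.symm hxy]
    rw [this, ← Finset.sum_add_distrib]
    refine Finset.sum_congr rfl fun a _ => ?_
    rw [← Finset.sum_add_distrib]
    refine Finset.sum_congr rfl fun b _ => ?_
    rw [← Finset.sum_add_distrib]
    refine Finset.sum_congr rfl fun c _ => ?_
    rw [Multiset.count_cons]
    split_ifs <;> push_cast <;> ring

/-- The total deviation of the remaining arcs and betweenness constraints. -/
noncomputable def totalDev (C : Multiset (Constraint V)) (f : V → ℕ) : ℚ :=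
  ∑ u, ∑ v, (arcMult C u v : ℚ) * arcDev f u v +
    1 / 2 * ∑ a, ∑ b, ∑ c, (betweenMult C a b c : ℚ) * betweenDev f a b c

/-- The deleted multiplicity `min (p, q)` is symmetric in `u` and `v`, while `arcDev` is
antisymmetric, so the deleted arcs contribute nothing. -/
theorem sum_arcs_reduce (C : Multiset (Constraint V)) {f : V → ℕ} (hf : Injective f) :
    ∑ u, ∑ v, ((arcs C).count (u, v) : ℚ) * arcDev f u v =
      ∑ u, ∑ v, (arcMult C u v : ℚ) * arcDev f u v := by
  have h : ∀ u v, ((arcs C).count (u, v) : ℚ) =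
      arcMult C u v + min ((arcs C).count (u, v)) ((arcs C).count (v, u)) := by
    intro u v
    rw [arcMult_eq]
    norm_cast
    omega
  have hloop : ∀ u, (arcs C).count (u, u) = 0 := by
    intro u
    rw [count_arcs, Multiset.countP_eq_zero.2, Multiset.countP_eq_zero.2]
    · rintro c - ⟨h1, h2⟩
      exact absurd (c.injective (h1.trans h2.symm)) (by decide)
    · rintro c - ⟨h1, h2⟩
      exact absurd (c.injective (h1.trans h2.symm)) (by decide)
  set m : V → V → ℚ := fun u v =>
    ((min ((arcs C).count (u, v)) ((arcs C).count (v, u)) : ℕ) : ℚ) with hm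
  have hz : ∑ u, ∑ v, m u v * arcDev f u v = 0 := by
    have h1 : ∑ u, ∑ v, m u v * arcDev f u v = ∑ u, ∑ v, m v u * arcDev f v u :=
      Finset.sum_comm
    have h2 : ∑ u, ∑ v, (m u v * arcDev f u v + m v u * arcDev f v u) = 0 := by
      refine Finset.sum_eq_zero fun u _ => Finset.sum_eq_zero fun v _ => ?_
      by_cases huv : u = v
      · subst huv
        simp [hm, hloop]
      · have e : m v u = m u v := by simp only [hm, min_comm]
        rw [e, ← mul_add, arcDev_swap hf huv, mul_zero]
    simp only [Finset.sum_add_distrib] at h2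
    linarith
  calc _ = ∑ u, ∑ v, ((arcMult C u v : ℚ) * arcDev f u v + m u v * arcDev f u v) := by
        refine Finset.sum_congr rfl fun u _ => Finset.sum_congr rfl fun v _ => ?_
        rw [h, add_mul]
    _ = _ := by
      simp only [Finset.sum_add_distrib]
      rw [hz, add_zero]

omit [DecidableEq V] in
theorem sum_rotate (g : V → V → V → ℚ) :
    ∑ a, ∑ b, ∑ c, g a b c = ∑ a, ∑ b, ∑ c, g b c a := by
  rw [Finset.sum_comm]
  calc _ = ∑ b, ∑ c, ∑ a, g a b c := Finset.sum_congr rfl fun b _ => Finset.sum_comm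
    _ = ∑ c, ∑ b, ∑ a, g a b c := Finset.sum_comm
    _ = ∑ c, ∑ a, ∑ b, g a b c := Finset.sum_congr rfl fun b _ => Finset.sum_comm

/-- The deleted multiplicity `m` is invariant under rotation of `(a, b, c)`. Three times its
contribution is therefore a sum over full rotations, which vanishes by `betweenDev_rotate`. Triples
with a repetition have multiplicity zero throughout. -/
theorem sum_betweenness_reduce (C : Multiset (Constraint V)) {f : V → ℕ} (hf : Injective f) :
    ∑ a, ∑ b, ∑ c, ((betweenness C).count (a, {b, c}) : ℚ) * betweenDev f a b c =
      ∑ a, ∑ b, ∑ c, (betweenMult C a b c : ℚ) * betweenDev f a b c := by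
  set q : V → V → V → ℕ := fun a b c => (betweenness C).count (a, {b, c}) with hq
  have hq0 : ∀ a b c, ¬ (a ≠ b ∧ a ≠ c ∧ b ≠ c) → q a b c = 0 := fun a b c h =>
    count_eq_zero_of_proper (fun x hx => isProper_of_mem_betweenness hx) h
  set m : V → V → V → ℚ := fun a b c => ((min (q a b c) (min (q b c a) (q c a b)) : ℕ) : ℚ) with hm
  have h : ∀ a b c, (q a b c : ℚ) = betweenMult C a b c + m a b c := by
    intro a b c
    by_cases hd : a ≠ b ∧ a ≠ c ∧ b ≠ c
    · rw [betweenMult_eq C hd.1 hd.2.1 hd.2.2, hm]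
      rw [← Nat.cast_add, Nat.cast_inj]
      exact (Nat.sub_add_cancel (min_le_left _ _)).symm
    · have : betweenMult C a b c = 0 :=
        count_eq_zero_of_proper (fun x hx => isProper_of_mem_reduceBetweenness hx) hd
      simp only [hm]
      rw [this, hq0 a b c hd]
      simp
  have hz : ∑ a, ∑ b, ∑ c, m a b c * betweenDev f a b c = 0 := by
    have h1 := sum_rotate fun a b c => m a b c * betweenDev f a b c
    have h2 := sum_rotate fun a b c => m b c a * betweenDev f b c a
    have h3 : ∑ a, ∑ b, ∑ c, (m a b c * betweenDev f a b c + m b c a * betweenDev f b c a +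
        m c a b * betweenDev f c a b) = 0 := by
      refine Finset.sum_eq_zero fun a _ => Finset.sum_eq_zero fun b _ =>
        Finset.sum_eq_zero fun c _ => ?_
      have e1 : m b c a = m a b c := by
        simp only [hm, Nat.cast_inj]
        omega
      have e2 : m c a b = m a b c := by
        simp only [hm, Nat.cast_inj]
        omega
      rw [e1, e2, ← mul_add, ← mul_add]
      by_cases hd : a ≠ b ∧ a ≠ c ∧ b ≠ c
      · rw [betweenDev_rotate hf hd.1 hd.2.1 hd.2.2, mul_zero]
      · simp only [hm]
        rw [hq0 a b c hd]
        simp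
    simp only [Finset.sum_add_distrib] at h3
    linarith
  calc _ = ∑ a, ∑ b, ∑ c, ((betweenMult C a b c : ℚ) * betweenDev f a b c +
        m a b c * betweenDev f a b c) := by
        refine Finset.sum_congr rfl fun u _ => Finset.sum_congr rfl fun v _ =>
          Finset.sum_congr rfl fun w _ => ?_
        rw [← add_mul, ← h]
    _ = _ := by
      simp only [Finset.sum_add_distrib]
      rw [hz, add_zero]

theorem two_mul_score (C : Multiset (Constraint V)) {f : V → ℕ} (hf : Injective f) :
    2 * ((C.map toTriple).map (tripleDev f)).sum = totalDev C f := by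
  have h1 : 2 * ((C.map toTriple).map (tripleDev f)).sum =
      ((arcs C).map fun a => arcDev f a.1 a.2).sum + 1 / 2 *
        ((betweenness C).map fun b => ∑ p ∈ b.2.offDiag, betweenDev f b.1 p.1 p.2).sum := by
    induction C using Multiset.induction_on with
    | empty => simp [arcs, betweenness]
    | cons c C ih =>
      have hd : ∀ i j : Fin 3, i ≠ j → c i ≠ c j := fun i j h => c.injective.ne h
      have h2 := two_mul_tripleDev hf (hd 0 1 (by decide)) (hd 0 2 (by decide)) (hd 1 2 (by decide))
      have h3 : ∑ p ∈ ({c 0, c 2} : Finset V).offDiag, betweenDev f (c 1) p.1 p.2 =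
          2 * betweenDev f (c 1) (c 0) (c 2) := by
        have : ({c 0, c 2} : Finset V).offDiag = {(c 0, c 2), (c 2, c 0)} := by
          ext ⟨x, y⟩
          have := hd 0 2 (by decide)
          simp only [Finset.mem_offDiag, Finset.mem_insert, Finset.mem_singleton, Prod.mk.injEq]
          constructor
          · rintro ⟨rfl | rfl, rfl | rfl, h⟩ <;> simp_all
          · rintro (⟨rfl, rfl⟩ | ⟨rfl, rfl⟩)
            · simp [this]
            · simp [Ne.symm this]
        rw [this, Finset.sum_pair, betweenDev_comm f (c 1) (c 2)]
        · ring
        · simp [hd 0 2 (by decide)]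
      simp only [arcs, betweenness, Multiset.map_cons, Multiset.sum_cons, Multiset.map_add,
        Multiset.sum_add, h3] at ih ⊢
      simp only [toTriple] at h2 ih ⊢
      linarith
  rw [h1, sum_arcs _ (arcDev f), sum_proper _ (fun x hx => isProper_of_mem_betweenness hx)
    (betweenDev f), sum_arcs_reduce C hf, sum_betweenness_reduce C hf, totalDev]

theorem sum_newTriples (C : Multiset (Constraint V)) (h : Option V × Option V × Option V → ℚ) :
    ((newTriples C).map h).sum =
      ∑ u, ∑ v, (arcMult C u v : ℚ) * (h (none, some u, some v) + h (some u, none, some v) +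
        h (some u, some v, none)) +
      ∑ a, ∑ b, ∑ c, (betweenMult C a b c : ℚ) * h (some b, some a, some c) := by
  unfold newTriples arcMult betweenMult
  rw [← sum_arcs _ fun u v => h (none, some u, some v) + h (some u, none, some v) +
        h (some u, some v, none),
    ← sum_proper _ (fun x hx => isProper_of_mem_reduceBetweenness hx)
    fun a b c => h (some b, some a, some c), Multiset.map_add, Multiset.sum_add, Multiset.map_bind,
    Multiset.map_bind, Multiset.sum_bind, Multiset.sum_bind]
  congr 3
  · funext a
    simp [add_assoc]
  · funext a
    rw [Multiset.map_map]
    rfl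

/-- If `u < v`, exactly one of the three triples with `ω` is satisfied, wherever `ω` is placed, and
otherwise none is; the means add up to `3 · 1/6 = 1/2`. The two triples of a betweenness constraint
exclude each other and have total mean `2 · 1/6 = 1/3`. -/
theorem newTriples_score (C : Multiset (Constraint V)) {f : Option V → ℕ} (hf : Injective f) :
    ((newTriples C).map (tripleDev f)).sum = totalDev C (f ∘ some) := by
  rw [sum_newTriples, totalDev]
  congr 1
  · refine Finset.sum_congr rfl fun u _ => Finset.sum_congr rfl fun v _ => ?_
    by_cases huv : u = v
    · subst huv
      rw [arcMult_eq]
      simp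
    congr 1
    have h1 : f none ≠ f (some u) := hf.ne (by simp)
    have h2 : f none ≠ f (some v) := hf.ne (by simp)
    have h3 : f (some u) ≠ f (some v) := hf.ne (by simpa using huv)
    unfold tripleDev arcDev
    rcases lt_or_gt_of_ne h1 with h1 | h1 <;> rcases lt_or_gt_of_ne h2 with h2 | h2 <;>
    rcases lt_or_gt_of_ne h3 with h3 | h3 <;>
    first
    | (exfalso; omega)
    | (simp [h1, h2, h3, h1.not_gt, h2.not_gt, h3.not_gt]; norm_num)
  · have e : ∀ g : V → V → V → ℚ, ∑ a, ∑ b, ∑ c, g a b c = ∑ a, ∑ b, ∑ c, g a c b := fun g =>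
      Finset.sum_congr rfl fun a _ => Finset.sum_comm
    -- The two triples contribute equally to the sum over all `b` and `c`, by exchanging these; the
    -- factor `1/2` leaves one of the two halves.
    have h1 : ∑ a, ∑ b, ∑ c, (betweenMult C a b c : ℚ) * betweenDev (f ∘ some) a b c =
        ∑ a, ∑ b, ∑ c, (betweenMult C a b c : ℚ) * (tripleDev f (some b, some a, some c)) +
        ∑ a, ∑ b, ∑ c, (betweenMult C a b c : ℚ) * (tripleDev f (some c, some a, some b)) := by
      simp only [← Finset.sum_add_distrib]
      refine Finset.sum_congr rfl fun a _ => Finset.sum_congr rfl fun b _ =>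
        Finset.sum_congr rfl fun c _ => ?_
      rw [← mul_add]
      congr 1
      unfold betweenDev tripleDev
      simp only [comp_apply]
      split_ifs <;> first | (exfalso; omega) | norm_num
    have h2 := e fun a b c => (betweenMult C a b c : ℚ) * (tripleDev f (some c, some a, some b))
    have h3 : ∀ a b c, betweenMult C a c b = betweenMult C a b c := fun a b c => by
      unfold betweenMult
      rw [Finset.pair_comm]
    simp only [h3] at h2
    rw [h1, h2]
    ring

end Counts

/-- Elements outside the range of `e` are placed above all values of `g`. -/
theorem exists_injective_extension {n : ℕ} {W : Type} [Fintype W] (e : Fin n ↪ W) {g : Fin n → ℕ}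
    (hg : Injective g) : ∃ f : W → ℕ, Injective f ∧ ∀ x, f (e x) = g x := by
  classical
  obtain ⟨B, hB⟩ : ∃ B, ∀ x, g x < B := by
    refine ⟨∑ x, g x + 1, fun x => Nat.lt_succ_of_le ?_⟩
    exact Finset.single_le_sum (f := g) (fun _ _ => Nat.zero_le _) (Finset.mem_univ x)
  refine ⟨fun w => if h : ∃ x, e x = w then g h.choose else B + Fintype.equivFin W w, ?_, ?_⟩
  · intro w w' h
    simp only at h
    split_ifs at h with h1 h2 h2
    · rw [← h1.choose_spec, ← h2.choose_spec, hg h]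
    · have := hB h1.choose
      omega
    · have := hB h2.choose
      omega
    · exact (Fintype.equivFin W).injective (Fin.ext (by omega))
  · intro x
    have h : ∃ y, e y = e x := ⟨x, rfl⟩
    simp only [h, dif_pos]
    rw [e.injective h.choose_spec]

/-- Orderings are restricted along `e` in one direction and extended in the other. Elements outside
the range of `e` occur in no new triple, so the score does not see them. -/
theorem yes_iff_of_isReencoding {I J : Instance} (h : IsReencoding I J) (k : ℕ) :
    IsYes {1} I.multiset k ↔ IsYes {1} J.multiset (2 * k) := by
  obtain ⟨-, e, he⟩ := h
  have he' : (J.multiset.map toTriple).map (fun t => (e t.1, e t.2.1, e t.2.2)) =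
      newTriples I.multiset := by
    rw [← he, Multiset.map_map]
    rfl
  have key : ∀ f : Option (Fin I.n) → ℕ, Injective f →
      ((J.multiset.map toTriple).map (tripleDev (f ∘ e))).sum =
        2 * ((I.multiset.map toTriple).map (tripleDev (f ∘ some))).sum := by
    intro f hf
    rw [← sum_tripleDev_map, he', newTriples_score _ hf,
      two_mul_score _ (hf.comp (Option.some_injective _))]
  rw [isYes_iff, isYes_iff]
  push_cast
  constructor
  · rintro ⟨f, hf, h⟩
    -- The place of `ω` is irrelevant for the score; here it comes first.
    let f' : Option (Fin I.n) → ℕ := fun o => o.elim 0 fun v => f v + 1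
    have hf' : Injective f' := by
      rintro (_ | u) (_ | v) h
      · rfl
      · simp [f'] at h
      · simp [f'] at h
      · simpa [f', hf.eq_iff] using h
    refine ⟨f' ∘ e, hf'.comp e.injective, ?_⟩
    rw [key f' hf']
    have : tripleDev (f' ∘ some) = tripleDev f := by
      funext t
      simp [tripleDev, f']
    rw [this]
    linarith
  · rintro ⟨g, hg, h⟩
    obtain ⟨f, hf, hfe⟩ := exists_injective_extension e hg
    refine ⟨f ∘ some, hf.comp (Option.some_injective _), ?_⟩
    have : f ∘ e = g := funext hfe
    have h2 := key f hf
    rw [this] at h2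
    linarith

end PermCSP

/-! ## Functions of low degree on the discrete cube -/

namespace BooleanCube

open Function

variable {ι : Type} [Fintype ι] [DecidableEq ι]

/-- The mean of a function on the discrete cube. -/
noncomputable def mean (f : (ι → Bool) → ℝ) : ℝ :=
  (∑ x, f x) / Fintype.card (ι → Bool)

theorem card_pos : (0 : ℝ) < Fintype.card (ι → Bool) := by
  exact_mod_cast Fintype.card_pos

theorem mean_add (f g : (ι → Bool) → ℝ) : mean (fun x => f x + g x) = mean f + mean g := by
  simp only [mean, Finset.sum_add_distrib, add_div]

theorem mean_sub (f g : (ι → Bool) → ℝ) : mean (fun x => f x - g x) = mean f - mean g := by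
  simp only [mean, Finset.sum_sub_distrib, sub_div]

theorem mean_const_mul (c : ℝ) (f : (ι → Bool) → ℝ) : mean (fun x => c * f x) = c * mean f := by
  simp only [mean, ← Finset.mul_sum, mul_div_assoc]

theorem mean_sum {κ : Type} (s : Finset κ) (f : κ → (ι → Bool) → ℝ) :
    mean (fun x => ∑ j ∈ s, f j x) = ∑ j ∈ s, mean (f j) := by
  simp only [mean]
  rw [Finset.sum_comm, Finset.sum_div]

theorem mean_const (c : ℝ) : mean (fun _ : ι → Bool => c) = c := by
  have := card_pos (ι := ι)
  simp only [mean, Finset.sum_const, Finset.card_univ, nsmul_eq_mul]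
  field_simp

theorem mean_mono {f g : (ι → Bool) → ℝ} (h : ∀ x, f x ≤ g x) : mean f ≤ mean g :=
  div_le_div_of_nonneg_right (Finset.sum_le_sum fun x _ => h x) card_pos.le

theorem mean_nonneg {f : (ι → Bool) → ℝ} (h : ∀ x, 0 ≤ f x) : 0 ≤ mean f :=
  div_nonneg (Finset.sum_nonneg fun x _ => h x) card_pos.le

theorem mean_mul_sq_le (f g : (ι → Bool) → ℝ) :
    mean (fun x => f x * g x) ^ 2 ≤ mean (fun x => f x ^ 2) * mean (fun x => g x ^ 2) := by
  simp only [mean]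
  rw [div_pow, div_mul_div_comm, ← sq]
  exact div_le_div_of_nonneg_right (Finset.sum_mul_sq_le_sq_mul_sq _ _ _) (sq_nonneg _)

theorem mean_comp_equiv (e : (ι → Bool) ≃ (ι → Bool)) (f : (ι → Bool) → ℝ) :
    mean (fun x => f (e x)) = mean f := by
  simp only [mean]
  rw [Equiv.sum_comp e f]

theorem mean_flip (i : ι) (f : (ι → Bool) → ℝ) :
    mean (fun x => f (update x i (!x i))) = mean f := by
  have h : Involutive fun x : ι → Bool => update x i (!x i) := fun x => by simp
  exact mean_comp_equiv h.toPerm f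

theorem mean_compl (f : (ι → Bool) → ℝ) : mean (fun x => f fun i => !x i) = mean f := by
  have h : Involutive fun (x : ι → Bool) i => !x i := fun x => by simp
  exact mean_comp_equiv h.toPerm f

/-- The mean over the values of one coordinate. -/
noncomputable def condMean (i : ι) (f : (ι → Bool) → ℝ) (x : ι → Bool) : ℝ :=
  (f (update x i true) + f (update x i false)) / 2

/-- The derivative in the direction of one coordinate. -/
noncomputable def derivative (i : ι) (f : (ι → Bool) → ℝ) (x : ι → Bool) : ℝ :=
  (f (update x i true) - f (update x i false)) / 2

theorem mean_condMean (i : ι) (f : (ι → Bool) → ℝ) : mean (condMean i f) = mean f := by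
  have h : ∀ x, condMean i f x = 1 / 2 * f x + 1 / 2 * f (update x i (!x i)) := by
    intro x
    unfold condMean
    cases hx : x i
    · rw [Bool.not_false, show update x i false = x by rw [← hx, update_eq_self]]
      ring
    · rw [Bool.not_true, show update x i true = x by rw [← hx, update_eq_self]]
      ring
  rw [show condMean i f = fun x => 1 / 2 * f x + 1 / 2 * f (update x i (!x i)) from funext h,
    mean_add, mean_const_mul, mean_const_mul, mean_flip]
  ring

/-- The functions of degree at most `d`: the linear combinations of functions of at most `d`
coordinates. -/
def lowDegree (ι : Type) (d : ℕ) : Submodule ℝ ((ι → Bool) → ℝ) :=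
  Submodule.span ℝ {g | ∃ S : Finset ι, S.card ≤ d ∧ DependsOn g (S : Set ι)}

omit [Fintype ι] in
theorem dependsOn_comp_update {f : (ι → Bool) → ℝ} {S : Finset ι} (h : DependsOn f (S : Set ι))
    (i : ι) (b : Bool) : DependsOn (fun x => f (update x i b)) (S.erase i : Set ι) := by
  intro x y hxy
  refine h fun j hj => ?_
  by_cases hji : j = i
  · subst hji
    simp
  · rw [update_of_ne hji, update_of_ne hji]
    exact hxy j (by simpa [hji] using hj)

omit [Fintype ι] in
theorem dependsOn_condMean {f : (ι → Bool) → ℝ} {S : Finset ι} (h : DependsOn f (S : Set ι))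
    (i : ι) : DependsOn (condMean i f) (S.erase i : Set ι) := fun x y hxy => by
  have h1 := dependsOn_comp_update h i true hxy
  have h2 := dependsOn_comp_update h i false hxy
  simp only at h1 h2
  rw [condMean, condMean, h1, h2]

omit [Fintype ι] in
theorem dependsOn_derivative {f : (ι → Bool) → ℝ} {S : Finset ι} (h : DependsOn f (S : Set ι))
    (i : ι) : DependsOn (derivative i f) (S.erase i : Set ι) := fun x y hxy => by
  have h1 := dependsOn_comp_update h i true hxy
  have h2 := dependsOn_comp_update h i false hxy
  simp only at h1 h2
  rw [derivative, derivative, h1, h2]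

omit [Fintype ι] in
theorem condMean_mem_lowDegree {f : (ι → Bool) → ℝ} {d : ℕ} (hf : f ∈ lowDegree ι d) (i : ι) :
    condMean i f ∈ lowDegree ι d := by
  induction hf using Submodule.span_induction with
  | mem g hg =>
    obtain ⟨S, hS, hg⟩ := hg
    exact Submodule.subset_span ⟨S.erase i, (Finset.card_erase_le).trans hS, dependsOn_condMean hg i⟩
  | zero =>
    convert (lowDegree ι d).zero_mem using 1
    funext x
    simp [condMean]
  | add f g _ _ ihf ihg =>
    convert (lowDegree ι d).add_mem ihf ihg using 1
    funext x
    simp only [condMean, Pi.add_apply]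
    ring
  | smul c f _ ih =>
    convert (lowDegree ι d).smul_mem c ih using 1
    funext x
    simp only [condMean, Pi.smul_apply, smul_eq_mul]
    ring

omit [Fintype ι] in
theorem derivative_eq_zero {g : (ι → Bool) → ℝ} {S : Finset ι} (hg : DependsOn g (S : Set ι))
    {i : ι} (hi : i ∉ S) : derivative i g = 0 := by
  funext x
  have : g (update x i true) = g (update x i false) := hg fun j hj => by
    have : j ≠ i := fun h => hi (h ▸ hj)
    simp [this]
  simp [derivative, this]

omit [Fintype ι] in
theorem derivative_mem_lowDegree {f : (ι → Bool) → ℝ} {d : ℕ} (hf : f ∈ lowDegree ι (d + 1))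
    (i : ι) : derivative i f ∈ lowDegree ι d := by
  induction hf using Submodule.span_induction with
  | mem g hg =>
    obtain ⟨S, hS, hg⟩ := hg
    by_cases hi : i ∈ S
    · refine Submodule.subset_span ⟨S.erase i, ?_, dependsOn_derivative hg i⟩
      rw [Finset.card_erase_of_mem hi]
      omega
    · rw [derivative_eq_zero hg hi]
      exact Submodule.zero_mem _
  | zero =>
    convert (lowDegree ι d).zero_mem using 1
    funext x
    simp [derivative]
  | add f g _ _ ihf ihg =>
    convert (lowDegree ι d).add_mem ihf ihg using 1
    funext x
    simp only [derivative, Pi.add_apply]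
    ring
  | smul c f _ ih =>
    convert (lowDegree ι d).smul_mem c ih using 1
    funext x
    simp only [derivative, Pi.smul_apply, smul_eq_mul]
    ring

omit [Fintype ι] in
theorem derivative_eq_zero_of_mem_lowDegree {f : (ι → Bool) → ℝ} (hf : f ∈ lowDegree ι 0) (i : ι) :
    derivative i f = 0 := by
  induction hf using Submodule.span_induction with
  | mem g hg =>
    obtain ⟨S, hS, hg⟩ := hg
    rw [Nat.le_zero, Finset.card_eq_zero] at hS
    exact derivative_eq_zero hg (by simp [hS])
  | zero =>
    funext x
    simp [derivative]
  | add f g _ _ ihf ihg =>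
    funext x
    have h1 := congrFun ihf x
    have h2 := congrFun ihg x
    simp only [derivative, Pi.add_apply, Pi.zero_apply] at h1 h2 ⊢
    linarith
  | smul c f _ ih =>
    funext x
    have h1 := congrFun ih x
    simp only [derivative, Pi.smul_apply, smul_eq_mul, Pi.zero_apply] at h1 ⊢
    linear_combination c * h1

/-- On the two values of bit `i` the function is `g + h` and `g - h`, with `g` the conditional mean
and `h` the derivative. Averaging removes the terms that are odd in `h`; the same applies to the
fourth power. -/
theorem mean_pow_two_eq (i : ι) (f : (ι → Bool) → ℝ) :
    mean (fun x => f x ^ 2) =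
      mean (fun x => condMean i f x ^ 2) + mean (fun x => derivative i f x ^ 2) := by
  rw [← mean_condMean i, ← mean_add]
  congr 1
  funext x
  simp only [condMean, derivative]
  ring

theorem mean_pow_four_eq (i : ι) (f : (ι → Bool) → ℝ) :
    mean (fun x => f x ^ 4) =
      mean (fun x => condMean i f x ^ 4) +
        6 * mean (fun x => condMean i f x ^ 2 * derivative i f x ^ 2) +
        mean (fun x => derivative i f x ^ 4) := by
  rw [← mean_condMean i, ← mean_const_mul, ← mean_add, ← mean_add]
  congr 1
  funext x
  simp only [condMean, derivative]
  ring

/-- Bonami's inequality: the fourth moment of a function of low degree is bounded by the square of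
its second moment. -/
theorem mean_pow_four_le {d : ℕ} {f : (ι → Bool) → ℝ} (hf : f ∈ lowDegree ι d) :
    mean (fun x => f x ^ 4) ≤ 9 ^ d * mean (fun x => f x ^ 2) ^ 2 := by
  -- Induction on the set of relevant coordinates, for all degrees at once, because the derivative
  -- has lower degree.
  have key : ∀ (t : Finset ι) (d : ℕ) (f : (ι → Bool) → ℝ), f ∈ lowDegree ι d →
      DependsOn f (t : Set ι) → mean (fun x => f x ^ 4) ≤ 9 ^ d * mean (fun x => f x ^ 2) ^ 2 := by
    intro t
    induction t using Finset.induction_on with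
    | empty =>
      intro d f _ hf
      have : f = fun _ => f default := funext fun x => hf (by simp)
      rw [this, mean_const, mean_const]
      have : (1 : ℝ) ≤ 9 ^ d := one_le_pow₀ (by norm_num)
      nlinarith [sq_nonneg (f default ^ 2)]
    | insert i t hi ih =>
      intro d f hd hf
      have hg := ih d _ (condMean_mem_lowDegree hd i)
        (by simpa [Finset.erase_insert hi] using dependsOn_condMean hf i)
      rw [mean_pow_two_eq i, mean_pow_four_eq i]
      set g := condMean i f with hg'
      set h := derivative i f with hh'
      have ha : 0 ≤ mean fun x => g x ^ 2 := mean_nonneg fun x => sq_nonneg _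
      have hb : 0 ≤ mean fun x => h x ^ 2 := mean_nonneg fun x => sq_nonneg _
      rcases d with _ | d
      · have : h = 0 := derivative_eq_zero_of_mem_lowDegree hd i
        simp only [this, Pi.zero_apply]
        simpa [mean_const] using hg
      · have hh := ih d h (derivative_mem_lowDegree hd i)
          (by simpa [Finset.erase_insert hi] using dependsOn_derivative hf i)
        have hgh := mean_mul_sq_le (fun x => g x ^ 2) (fun x => h x ^ 2)
        simp only [← pow_mul, Nat.reduceMul] at hgh
        set a := mean fun x => g x ^ 2
        set b := mean fun x => h x ^ 2
        set m := mean fun x => g x ^ 2 * h x ^ 2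
        have hc : (1 : ℝ) ≤ 9 ^ d := one_le_pow₀ (by norm_num)
        set c : ℝ := 9 ^ d
        -- Cauchy–Schwarz and the induction hypotheses give `m ^ 2 ≤ (9 * c * a ^ 2) * (c * b ^ 2)`.
        -- Then `6 * m` is at most `18 * c * a * b`, the cross term of `9 * c * (a + b) ^ 2`.
        have hm : m ≤ 3 * c * (a * b) := by
          refine abs_le_of_sq_le_sq' ?_ (by positivity) |>.2
          refine hgh.trans ((mul_le_mul hg hh (mean_nonneg fun x => by positivity)
            (by positivity)).trans (le_of_eq ?_))
          rw [pow_succ]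
          ring
        rw [pow_succ] at hg ⊢
        have h1 : 0 ≤ c * b ^ 2 := by positivity
        nlinarith
  exact key Finset.univ d f hf fun x y h => congrArg f (funext fun i => h i (by simp))

/-- A function of low degree with mean zero has small variance if it is bounded from above. -/
theorem mean_sq_le_of_le {d : ℕ} {f : (ι → Bool) → ℝ} (hf : f ∈ lowDegree ι d) (h0 : mean f = 0)
    {M : ℝ} (hM : ∀ x, f x ≤ M) : mean (fun x => f x ^ 2) ≤ 9 ^ (d + 1) * M ^ 2 := by
  have hM0 : 0 ≤ M := by
    have := mean_mono hM
    rwa [h0, mean_const] at this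
  set A := mean fun x => f x ^ 2 with hA
  have hA0 : 0 ≤ A := mean_nonneg fun x => sq_nonneg _
  rcases hA0.eq_or_lt with hz | hpos
  · rw [← hz]
    positivity
  -- Pointwise `|f| ≤ 2 * M - f`, and `f` has mean zero.
  have habs : mean (fun x => |f x|) ≤ 2 * M := by
    have : mean (fun x => |f x|) ≤ mean fun x => 2 * M - f x := mean_mono fun x => by
      rcases abs_cases (f x) with ⟨h, _⟩ | ⟨h, _⟩ <;> rw [h] <;> linarith [hM x]
    rw [mean_sub, mean_const, h0] at this
    linarith
  -- With this scale, Bonami's inequality reads: the fourth moment is at most `s ^ 2 * A`.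
  set s : ℝ := 3 ^ d * Real.sqrt A with hs
  have hs0 : 0 < s := by positivity
  have hs2 : s ^ 2 = 9 ^ d * A := by
    rw [hs, mul_pow, Real.sq_sqrt hA0, ← pow_mul, mul_comm d 2, pow_mul]
    norm_num
  -- A lower bound for `|f|` by second and fourth powers: it prevents the first absolute moment from
  -- being small. Taking means yields `3 * s ^ 2 * A ≤ 8 * s ^ 3 * M`.
  have hpt : ∀ x, 4 * s ^ 2 * f x ^ 2 - f x ^ 4 ≤ 4 * s ^ 3 * |f x| := by
    intro x
    rw [← sq_abs (f x), show f x ^ 4 = |f x| ^ 4 by rw [← abs_pow, abs_of_nonneg (by positivity)]]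
    set y := |f x|
    have hy : 0 ≤ y := abs_nonneg _
    have : 0 ≤ 4 * s ^ 3 - 4 * s ^ 2 * y + y ^ 3 := by
      nlinarith [mul_nonneg hs0.le (sq_nonneg (2 * s - y)), mul_nonneg hy (sq_nonneg (2 * s - y)),
        mul_nonneg hy (sq_nonneg (s - y)), mul_nonneg hs0.le (sq_nonneg (s - y)),
        mul_nonneg hs0.le (sq_nonneg (8 * s - 7 * y)), mul_nonneg hy (sq_nonneg (8 * s - 7 * y))]
    nlinarith
  have h1 := mean_mono hpt
  rw [mean_sub, mean_const_mul, mean_const_mul] at h1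
  have h4 := mean_pow_four_le hf
  rw [← hA] at h1 h4
  have h5 : 3 * (9 ^ d * A) * A ≤ 8 * (9 ^ d * A) * s * M := by
    have h6 : 4 * s ^ 3 * mean (fun x => |f x|) ≤ 4 * s ^ 3 * (2 * M) :=
      mul_le_mul_of_nonneg_left habs (by positivity)
    rw [show s ^ 3 = s ^ 2 * s by ring, hs2] at h6 h1
    nlinarith
  have h7 : 3 * A ≤ 8 * s * M := by
    have : 0 < 9 ^ d * A := by positivity
    nlinarith
  have h8 : (3 * A) ^ 2 ≤ (8 * s * M) ^ 2 := pow_le_pow_left₀ (by positivity) h7 2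
  -- Since `64 / 9 ≤ 9`, one more factor `9` suffices in the conclusion.
  have h9 : 9 * A ≤ 64 * 9 ^ d * M ^ 2 := by
    have : (8 * s * M) ^ 2 = (64 * 9 ^ d * M ^ 2) * A := by
      rw [mul_pow, mul_pow, hs2]
      ring
    rw [this] at h8
    nlinarith
  have h10 : 0 ≤ 9 ^ d * M ^ 2 := by positivity
  rw [pow_succ]
  nlinarith

/-! ### Characters of the cube -/

/-- The sign of a bit. -/
def sign (b : Bool) : ℤ := if b then 1 else -1

/-- The character of a set of coordinates. -/
def character (S : Finset ι) (x : ι → Bool) : ℝ := ∏ i ∈ S, (sign (x i) : ℝ)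

theorem sign_not (b : Bool) : sign (!b) = -sign b := by cases b <;> rfl

theorem sign_mul_self (b : Bool) : (sign b : ℝ) * sign b = 1 := by
  cases b <;> norm_num [sign]

omit [Fintype ι] in
theorem character_flip {S : Finset ι} {i : ι} (hi : i ∈ S) (x : ι → Bool) :
    character S (update x i (!x i)) = -character S x := by
  unfold character
  rw [← Finset.mul_prod_erase S _ hi, ← Finset.mul_prod_erase S _ hi, update_self, sign_not]
  rw [Finset.prod_congr rfl fun j hj => by rw [update_of_ne (Finset.ne_of_mem_erase hj)]]
  push_cast
  ring

omit [Fintype ι] in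
theorem character_flip_of_notMem {S : Finset ι} {i : ι} (hi : i ∉ S) (x : ι → Bool) (b : Bool) :
    character S (update x i b) = character S x := by
  unfold character
  refine Finset.prod_congr rfl fun j hj => ?_
  rw [update_of_ne (ne_of_mem_of_not_mem hj hi)]

omit [Fintype ι] [DecidableEq ι] in
theorem character_mul_self (S : Finset ι) (x : ι → Bool) : character S x * character S x = 1 := by
  unfold character
  rw [← Finset.prod_mul_distrib]
  exact Finset.prod_eq_one fun i _ => sign_mul_self _

theorem mean_eq_zero_of_flip {f : (ι → Bool) → ℝ} (i : ι)
    (h : ∀ x, f (update x i (!x i)) = -f x) : mean f = 0 := by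
  have h1 := mean_flip i f
  simp only [h] at h1
  have h2 := mean_const_mul (-1) f
  simp only [neg_mul, one_mul] at h2
  linarith

theorem mean_eq_zero_of_compl {f : (ι → Bool) → ℝ} (h : ∀ x, f (fun i => !x i) = -f x) :
    mean f = 0 := by
  have h1 := mean_compl f
  simp only [h] at h1
  have h2 := mean_const_mul (-1) f
  simp only [neg_mul, one_mul] at h2
  linarith

/-- Flipping a coordinate that lies in just one of the two sets negates the product. -/
theorem mean_character_mul {S T : Finset ι} (h : S ≠ T) :
    mean (fun x => character S x * character T x) = 0 := by
  obtain ⟨i, hi⟩ : ∃ i, ¬ (i ∈ S ↔ i ∈ T) := by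
    by_contra! h'
    exact h (Finset.ext h')
  refine mean_eq_zero_of_flip i fun x => ?_
  by_cases hS : i ∈ S
  · have hT : i ∉ T := by tauto
    rw [character_flip hS, character_flip_of_notMem hT]
    ring
  · have hT : i ∈ T := by tauto
    rw [character_flip hT, character_flip_of_notMem hS]
    ring

/-- Bessel's inequality. -/
theorem sum_sq_le_mean_sq {κ : Type} [DecidableEq κ] (J : Finset κ) (S : κ → Finset ι)
    (hS : Set.InjOn S J) (f : (ι → Bool) → ℝ) :
    ∑ j ∈ J, mean (fun x => f x * character (S j) x) ^ 2 ≤ mean (fun x => f x ^ 2) := by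
  set c : κ → ℝ := fun j => mean fun x => f x * character (S j) x with hc
  -- The squared distance from `f` to its projection on the span of the characters is expanded.
  have h0 : 0 ≤ mean fun x => (f x - ∑ j ∈ J, c j * character (S j) x) ^ 2 :=
    mean_nonneg fun x => sq_nonneg _
  have h1 : (fun x => (f x - ∑ j ∈ J, c j * character (S j) x) ^ 2) = fun x =>
      f x ^ 2 - 2 * ∑ j ∈ J, c j * (f x * character (S j) x) +
        ∑ j ∈ J, ∑ k ∈ J, c j * c k * (character (S j) x * character (S k) x) := by
    funext x
    have e1 : ∑ j ∈ J, c j * (f x * character (S j) x) =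
        f x * ∑ j ∈ J, c j * character (S j) x := by
      rw [Finset.mul_sum]
      exact Finset.sum_congr rfl fun j _ => by ring
    have e2 : ∑ j ∈ J, ∑ k ∈ J, c j * c k * (character (S j) x * character (S k) x) =
        (∑ j ∈ J, c j * character (S j) x) * ∑ j ∈ J, c j * character (S j) x := by
      rw [Finset.sum_mul_sum]
      exact Finset.sum_congr rfl fun j _ => Finset.sum_congr rfl fun k _ => by ring
    rw [e1, e2]
    ring
  have h2 : mean (fun x => ∑ j ∈ J, ∑ k ∈ J, c j * c k * (character (S j) x * character (S k) x)) =
      ∑ j ∈ J, c j ^ 2 := by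
    rw [mean_sum]
    refine Finset.sum_congr rfl fun j hj => ?_
    rw [mean_sum, Finset.sum_eq_single j]
    · rw [mean_const_mul]
      simp only [character_mul_self, mean_const]
      ring
    · intro k hk hkj
      rw [mean_const_mul, mean_character_mul (fun h => hkj (hS hj hk h).symm), mul_zero]
    · exact fun h => absurd hj h
  have h3 : mean (fun x => ∑ j ∈ J, c j * (f x * character (S j) x)) = ∑ j ∈ J, c j ^ 2 := by
    rw [mean_sum]
    refine Finset.sum_congr rfl fun j _ => ?_
    rw [mean_const_mul, sq]
  rw [h1, mean_add, mean_sub, mean_const_mul, h2, h3] at h0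
  linarith

/-- One bit is averaged out. Iterated over the bits of two or three vertices, this turns a mean into
a finite sum that `decide` can evaluate. -/
theorem mean_coordinate (i : ι) (H : Bool → (ι → Bool) → ℝ)
    (hH : ∀ b x c, H b (update x i c) = H b x) :
    mean (fun x => H (x i) x) = mean fun x => (∑ b, H b x) / 2 := by
  rw [← mean_condMean i]
  congr 1
  funext x
  simp [condMean, hH]

end BooleanCube

/-! ## Instances with many remaining constraints are yes-instances -/

namespace PermCSP

open Function BooleanCube

/-- The number with two given binary digits. -/
def level (p q : Bool) : ℕ := (if p then 2 else 0) + (if q then 1 else 0)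

/-- Twice the mean deviation of `u < v`, if `u` and `v` have levels `i` and `j` and ties are broken
at random. -/
def arcSign (i j : ℕ) : ℤ := if i < j then 1 else if j < i then -1 else 0

/-- Six times the mean deviation of `a` lying between `b` and `c`, if these have levels `i`, `j` and
`k` and ties are broken at random. -/
def betweenSign (i j k : ℕ) : ℤ :=
  if j < i ∧ i < k ∨ k < i ∧ i < j then 4
  else if i = j ∧ j = k then 0
  else if i = j ∨ i = k then 1
  else -2

theorem betweenSign_comm (i j k : ℕ) : betweenSign i j k = betweenSign i k j := by
  unfold betweenSign
  split_ifs <;> omega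

/-! ### Ordering by random levels, with random tie-breaking -/

section Lower

variable {V : Type} [Fintype V]

/-- The level of a vertex. -/
def label (x : V × Bool → Bool) (v : V) : ℕ := level (x (v, true)) (x (v, false))

/-- The position of a vertex if ties are broken by `σ`. -/
def position (x : V × Bool → Bool) (σ : LinOrdering V) (v : V) : ℕ :=
  label x v * Fintype.card V + σ v

theorem position_lt_of_label_lt {x : V × Bool → Bool} (σ : LinOrdering V) {u v : V}
    (h : label x u < label x v) : position x σ u < position x σ v := by
  unfold position
  have h1 := (σ u).isLt
  have h2 : (label x u + 1) * Fintype.card V ≤ label x v * Fintype.card V :=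
    Nat.mul_le_mul_right _ h
  rw [add_mul, one_mul] at h2
  omega

theorem position_injective (x : V × Bool → Bool) (σ : LinOrdering V) :
    Injective (position x σ) := by
  intro u v h
  rcases lt_trichotomy (label x u) (label x v) with h1 | h1 | h1
  · exact absurd h (position_lt_of_label_lt σ h1).ne
  · unfold position at h
    rw [h1] at h
    exact σ.injective (Fin.ext (by omega))
  · exact absurd h (position_lt_of_label_lt σ h1).ne'

variable [DecidableEq V]

/-- Exchanging `u` and `v` in the tie-breaking order permutes these orders, and for vertices of
equal level it has the same effect as exchanging `u` and `v` in the final order. -/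
theorem sum_position_swap {x : V × Bool → Bool} {u v : V} (h : label x u = label x v)
    (g : (V → ℕ) → ℚ) :
    ∑ σ, g (position x σ ∘ Equiv.swap u v) = ∑ σ, g (position x σ) := by
  have hinv : Involutive fun σ : LinOrdering V => (Equiv.swap u v).trans σ := fun σ => by
    ext w
    simp
  rw [← Equiv.sum_comp hinv.toPerm fun σ => g (position x σ)]
  refine Finset.sum_congr rfl fun σ _ => congrArg g (funext fun w => ?_)
  have : label x (Equiv.swap u v w) = label x w := by
    rw [Equiv.swap_apply_def]
    split_ifs with h1 h2
    · rw [h1, h]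
    · rw [h2, h]
    · rfl
  simp [position, this]

/-- The number of tie-breaking orders. -/
def orders (V : Type) [Fintype V] [DecidableEq V] : ℕ := Fintype.card (LinOrdering V)

theorem sum_orders_const (c : ℚ) : ∑ _σ : LinOrdering V, c = orders V * c := by
  simp [orders]

/-- Distinct levels decide the comparison for every `σ`; for equal levels the exchange of `u` and
`v` pairs each deviation with its negative. -/
theorem sum_arcDev_position (x : V × Bool → Bool) {u v : V} (huv : u ≠ v) :
    ∑ σ, arcDev (position x σ) u v = orders V * (arcSign (label x u) (label x v) / 2) := by
  rcases lt_trichotomy (label x u) (label x v) with h | h | h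
  · rw [← sum_orders_const]
    refine Finset.sum_congr rfl fun σ _ => ?_
    have := position_lt_of_label_lt σ h
    simp [arcDev, arcSign, h, this]
    norm_num
  · have h1 := sum_position_swap h fun f => arcDev f u v
    have h2 : ∑ σ, (arcDev (position x σ) u v + arcDev (position x σ) v u) = 0 :=
      Finset.sum_eq_zero fun σ _ => arcDev_swap (position_injective x σ) huv
    have h3 : ∀ f : V → ℕ, arcDev (f ∘ Equiv.swap u v) u v = arcDev f v u := fun f => by
      simp [arcDev]
    simp only [h3] at h1
    rw [Finset.sum_add_distrib] at h2
    simp only [arcSign, h, lt_irrefl, if_false]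
    push_cast
    linarith
  · rw [← sum_orders_const]
    refine Finset.sum_congr rfl fun σ _ => ?_
    have := position_lt_of_label_lt σ h
    simp [arcDev, arcSign, h, h.not_gt, this.not_gt]
    norm_num

/-- By symmetry the three rotations have the same sum, and together they give zero. -/
theorem sum_betweenDev_of_eq (x : V × Bool → Bool) {a b c : V} (hab : a ≠ b) (hac : a ≠ c)
    (hbc : b ≠ c) (h1 : label x a = label x b) (h2 : label x b = label x c) :
    ∑ σ, betweenDev (position x σ) a b c = 0 := by
  have e1 := sum_position_swap h1 fun f => betweenDev f a b c
  have e2 := sum_position_swap h2 fun f => betweenDev f b c a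
  have h3 : ∀ f : V → ℕ, betweenDev (f ∘ Equiv.swap a b) a b c = betweenDev f b c a := fun f => by
    rw [betweenDev_comm f]
    simp [betweenDev, Equiv.swap_apply_of_ne_of_ne hac.symm hbc.symm]
  have h4 : ∀ f : V → ℕ, betweenDev (f ∘ Equiv.swap b c) b c a = betweenDev f c a b := fun f => by
    rw [betweenDev_comm f]
    simp [betweenDev, Equiv.swap_apply_of_ne_of_ne hab hac]
  simp only [h3, h4] at e1 e2
  have h5 : ∑ σ, (betweenDev (position x σ) a b c + betweenDev (position x σ) b c a +
      betweenDev (position x σ) c a b) = 0 :=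
    Finset.sum_eq_zero fun σ _ => betweenDev_rotate (position_injective x σ) hab hac hbc
  simp only [Finset.sum_add_distrib] at h5
  linarith

/-- The vertex `c` is on one known side of `a` and `b`, so betweenness depends only on the order of
these two. It holds half of the time, and `1/2 - 1/3 = 1/6`. -/
theorem sum_betweenDev_of_eq_of_ne (x : V × Bool → Bool) {a b c : V} (hab : a ≠ b)
    (h1 : label x a = label x b) (h2 : label x a ≠ label x c) :
    ∑ σ, betweenDev (position x σ) a b c = orders V * (1 / 6) := by
  rcases lt_or_gt_of_ne h2 with h | h
  · have e := sum_arcDev_position x hab.symm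
    rw [h1, arcSign, if_neg (lt_irrefl _), if_neg (lt_irrefl _)] at e
    have : ∀ σ, betweenDev (position x σ) a b c = 1 / 6 + arcDev (position x σ) b a := fun σ => by
      have := position_lt_of_label_lt σ h
      simp only [betweenDev, arcDev, this, this.not_gt, and_true, false_and, or_false]
      ring
    simp only [this]
    rw [Finset.sum_add_distrib, e, sum_orders_const]
    push_cast
    ring
  · have e := sum_arcDev_position x hab
    rw [h1, arcSign, if_neg (lt_irrefl _), if_neg (lt_irrefl _)] at e
    have : ∀ σ, betweenDev (position x σ) a b c = 1 / 6 + arcDev (position x σ) a b := fun σ => by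
      have := position_lt_of_label_lt σ h
      simp only [betweenDev, arcDev, this, this.not_gt, and_false, true_and, false_or]
      ring
    simp only [this]
    rw [Finset.sum_add_distrib, e, sum_orders_const]
    push_cast
    ring

theorem sum_betweenDev_position (x : V × Bool → Bool) {a b c : V} (hab : a ≠ b) (hac : a ≠ c)
    (hbc : b ≠ c) :
    ∑ σ, betweenDev (position x σ) a b c =
      orders V * (betweenSign (label x a) (label x b) (label x c) / 6) := by
  by_cases h1 : label x a = label x b
  · by_cases h2 : label x a = label x c
    · rw [sum_betweenDev_of_eq x hab hac hbc h1 (h1.symm.trans h2)]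
      simp [betweenSign, ← h1, ← h2]
    · rw [sum_betweenDev_of_eq_of_ne x hab h1 h2]
      simp [betweenSign, ← h1, h2]
  · by_cases h2 : label x a = label x c
    · simp only [betweenDev_comm _ a b c]
      rw [sum_betweenDev_of_eq_of_ne x hac h2 h1]
      simp [betweenSign, ← h2, h1]
    · rw [← sum_orders_const]
      refine Finset.sum_congr rfl fun σ _ => ?_
      have key : ∀ u v, label x u ≠ label x v →
          (position x σ u < position x σ v ↔ label x u < label x v) := fun u v h => by
        rcases lt_or_gt_of_ne h with h | h
        · simp [h, position_lt_of_label_lt σ h]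
        · simp [h.not_gt, (position_lt_of_label_lt σ h).not_gt]
      unfold betweenDev betweenSign
      simp only [key a b h1, key a c h2, key b a (Ne.symm h1), key c a (Ne.symm h2), h1, h2,
        false_and, or_self, if_false]
      split_ifs <;> norm_num

/-- The mean of the total deviation over all ways to break ties. -/
noncomputable def gain (C : Multiset (Constraint V)) (x : V × Bool → Bool) : ℚ :=
  ∑ u, ∑ v, (arcMult C u v : ℚ) / 2 * arcSign (label x u) (label x v) +
    ∑ a, ∑ b, ∑ c, (betweenMult C a b c : ℚ) / 12 *
      betweenSign (label x a) (label x b) (label x c)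

omit [Fintype V] in
theorem arcMult_self (C : Multiset (Constraint V)) (u : V) : arcMult C u u = 0 := by
  rw [arcMult_eq, Nat.sub_self]

theorem betweenMult_eq_zero (C : Multiset (Constraint V)) {a b c : V}
    (h : ¬ (a ≠ b ∧ a ≠ c ∧ b ≠ c)) : betweenMult C a b c = 0 :=
  count_eq_zero_of_proper (fun _ hx => isProper_of_mem_reduceBetweenness hx) h

theorem sum_totalDev (C : Multiset (Constraint V)) (x : V × Bool → Bool) :
    ∑ σ, totalDev C (position x σ) = orders V * gain C x := by
  unfold totalDev gain
  rw [Finset.sum_add_distrib, ← Finset.mul_sum, mul_add]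
  congr 1
  · rw [Finset.sum_comm, Finset.mul_sum]
    refine Finset.sum_congr rfl fun u _ => ?_
    rw [Finset.sum_comm, Finset.mul_sum]
    refine Finset.sum_congr rfl fun v _ => ?_
    rw [← Finset.mul_sum]
    by_cases huv : u = v
    · subst huv
      simp [arcMult_self]
    · rw [sum_arcDev_position x huv]
      ring
  · rw [Finset.sum_comm, Finset.mul_sum, Finset.mul_sum]
    refine Finset.sum_congr rfl fun a _ => ?_
    rw [Finset.sum_comm, Finset.mul_sum, Finset.mul_sum]
    refine Finset.sum_congr rfl fun b _ => ?_
    rw [Finset.sum_comm, Finset.mul_sum, Finset.mul_sum]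
    refine Finset.sum_congr rfl fun c _ => ?_
    rw [← Finset.mul_sum]
    by_cases h : a ≠ b ∧ a ≠ c ∧ b ≠ c
    · rw [sum_betweenDev_position x h.1 h.2.1 h.2.2]
      ring
    · simp [betweenMult_eq_zero C h]

/-- On a no-instance every tie-break has total deviation below `2 * k`, as this is twice the score;
hence so does their mean. -/
theorem gain_lt_of_not_isYes {C : Multiset (Constraint V)} {k : ℕ} (h : ¬ IsYes {1} C k)
    (x : V × Bool → Bool) : gain C x < 2 * k := by
  have h1 : ∀ σ, totalDev C (position x σ) < 2 * k := by
    intro σ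
    by_contra! h2
    refine h ((isYes_iff C k).2 ⟨position x σ, position_injective x σ, ?_⟩)
    have := two_mul_score C (position_injective x σ)
    linarith
  have h2 : ∑ σ, totalDev C (position x σ) < ∑ _σ : LinOrdering V, (2 * k : ℚ) :=
    Finset.sum_lt_sum_of_nonempty ⟨Fintype.equivFin V, Finset.mem_univ _⟩ fun σ _ => h1 σ
  rw [sum_totalDev, sum_orders_const] at h2
  exact lt_of_mul_lt_mul_left h2 (by positivity)

omit [Fintype V] in
theorem label_update {x : V × Bool → Bool} {v w : V} (h : w ≠ v) (p q : Bool) :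
    label (update x (v, p) q) w = label x w := by
  simp [label, update_of_ne, h]

omit [Fintype V] [DecidableEq V] in
theorem label_mem_lowDegree (T : Finset V) (g : (V → ℕ) → ℝ) (d : ℕ) (hd : 2 * T.card ≤ d)
    (hg : ∀ l l' : V → ℕ, (∀ v ∈ T, l v = l' v) → g l = g l') :
    (fun x : V × Bool → Bool => g (label x)) ∈ lowDegree (V × Bool) d := by
  refine Submodule.subset_span ⟨T ×ˢ Finset.univ, ?_, ?_⟩
  · rw [Finset.card_product]
    simpa [mul_comm] using hd
  · intro x y h
    refine hg _ _ fun v hv => ?_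
    unfold label
    rw [h (v, true) (by simpa using hv), h (v, false) (by simpa using hv)]

/-- Each summand involves at most three vertices with two bits each. -/
theorem gain_mem_lowDegree (C : Multiset (Constraint V)) :
    (fun x => (gain C x : ℝ)) ∈ lowDegree (V × Bool) 6 := by
  have h1 : (fun x => (gain C x : ℝ)) =
      ∑ u, ∑ v, ((arcMult C u v : ℝ) / 2) • (fun x : V × Bool → Bool =>
        (arcSign (label x u) (label x v) : ℝ)) +
      ∑ a, ∑ b, ∑ c, ((betweenMult C a b c : ℝ) / 12) • (fun x : V × Bool → Bool =>
      (betweenSign (label x a) (label x b) (label x c) : ℝ)) := by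
    funext x
    simp only [gain, Pi.add_apply, Finset.sum_apply, Pi.smul_apply, smul_eq_mul]
    push_cast
    rfl
  rw [h1]
  refine Submodule.add_mem _ (Submodule.sum_mem _ fun u _ => Submodule.sum_mem _ fun v _ =>
    Submodule.smul_mem _ _ ?_) (Submodule.sum_mem _ fun a _ => Submodule.sum_mem _ fun b _ =>
    Submodule.sum_mem _ fun c _ => Submodule.smul_mem _ _ ?_)
  · refine label_mem_lowDegree {u, v} (fun l => (arcSign (l u) (l v) : ℝ)) 6 ?_ ?_
    · have := Finset.card_le_two (a := u) (b := v)
      omega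
    · intro l l' h
      simp only [h u (by simp), h v (by simp)]
  · refine label_mem_lowDegree {a, b, c} (fun l => (betweenSign (l a) (l b) (l c) : ℝ)) 6 ?_ ?_
    · have := Finset.card_le_three (a := a) (b := b) (c := c)
      omega
    · intro l l' h
      simp only [h a (by simp), h b (by simp), h c (by simp)]

/-! ### Fourier coefficients of the gain -/

theorem mean_gain_mul (C : Multiset (Constraint V)) (g : (V × Bool → Bool) → ℝ) :
    mean (fun x => (gain C x : ℝ) * g x) =
      ∑ u, ∑ v, (arcMult C u v : ℝ) / 2 *
        mean (fun x => (arcSign (label x u) (label x v) : ℝ) * g x) +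
      ∑ a, ∑ b, ∑ c, (betweenMult C a b c : ℝ) / 12 *
        mean (fun x => (betweenSign (label x a) (label x b) (label x c) : ℝ) * g x) := by
  have h1 : (fun x => (gain C x : ℝ) * g x) = fun x =>
      ∑ u, ∑ v, (arcMult C u v : ℝ) / 2 * ((arcSign (label x u) (label x v) : ℝ) * g x) +
      ∑ a, ∑ b, ∑ c, (betweenMult C a b c : ℝ) / 12 *
        ((betweenSign (label x a) (label x b) (label x c) : ℝ) * g x) := by
    funext x
    simp only [gain]
    push_cast
    rw [add_mul]
    simp only [Finset.sum_mul, mul_assoc]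
  rw [h1, mean_add]
  simp only [mean_sum, mean_const_mul]

theorem mean_four {u v : V} (huv : u ≠ v) (h : Bool → Bool → Bool → Bool → ℤ) :
    mean (fun x : V × Bool → Bool =>
      (h (x (u, true)) (x (u, false)) (x (v, true)) (x (v, false)) : ℝ)) =
      ((∑ p, ∑ q, ∑ r, ∑ s, h p q r s : ℤ) : ℝ) / 16 := by
  have hvu := huv.symm
  rw [mean_coordinate (u, true) (fun p x => (h p (x (u, false)) (x (v, true)) (x (v, false)) : ℝ))
    (by intros; simp [hvu]),
    mean_coordinate (u, false) (fun q x => (∑ p, (h p q (x (v, true)) (x (v, false)) : ℝ)) / 2)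
    (by intros; simp [hvu]),
    mean_coordinate (v, true) (fun r x => (∑ q, (∑ p, (h p q r (x (v, false)) : ℝ)) / 2) / 2)
    (by intros; simp),
    mean_coordinate (v, false) (fun s x => (∑ r, (∑ q, (∑ p, (h p q r s : ℝ)) / 2) / 2) / 2)
    (by intros; simp), mean_const]
  simp only [Fintype.sum_bool]
  push_cast
  ring

theorem mean_six {u v w : V} (huv : u ≠ v) (huw : u ≠ w) (hvw : v ≠ w)
    (h : Bool → Bool → Bool → Bool → Bool → Bool → ℤ) :
    mean (fun x : V × Bool → Bool =>
      (h (x (u, true)) (x (u, false)) (x (v, true)) (x (v, false)) (x (w, true))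
        (x (w, false)) : ℝ)) =
      ((∑ p, ∑ q, ∑ r, ∑ s, ∑ t, ∑ z, h p q r s t z : ℤ) : ℝ) / 64 := by
  have hvu := huv.symm
  have hwu := huw.symm
  have hwv := hvw.symm
  rw [mean_coordinate (u, true) (fun p x => (h p (x (u, false)) (x (v, true)) (x (v, false))
      (x (w, true)) (x (w, false)) : ℝ)) (by intros; simp [hvu, hwu]),
    mean_coordinate (u, false) (fun q x => (∑ p, (h p q (x (v, true)) (x (v, false))
      (x (w, true)) (x (w, false)) : ℝ)) / 2) (by intros; simp [hvu, hwu]),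
    mean_coordinate (v, true) (fun r x => (∑ q, (∑ p, (h p q r (x (v, false))
      (x (w, true)) (x (w, false)) : ℝ)) / 2) / 2) (by intros; simp [hwv]),
    mean_coordinate (v, false) (fun s x => (∑ r, (∑ q, (∑ p, (h p q r s
      (x (w, true)) (x (w, false)) : ℝ)) / 2) / 2) / 2) (by intros; simp [hwv]),
    mean_coordinate (w, true) (fun t x => (∑ s, (∑ r, (∑ q, (∑ p, (h p q r s
      t (x (w, false)) : ℝ)) / 2) / 2) / 2) / 2) (by intros; simp),
    mean_coordinate (w, false) (fun z x => (∑ t, (∑ s, (∑ r, (∑ q, (∑ p, (h p q r s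
      t z : ℝ)) / 2) / 2) / 2) / 2) / 2) (by intros; simp), mean_const]
  simp only [Fintype.sum_bool]
  push_cast
  ring

/-- Complementing both bits replaces a level `i` by `3 - i` and so reverses the order of levels.
Arcs are odd and betweenness constraints even under this, which separates their Fourier
coefficients. -/
theorem arcSign_not : ∀ p q r s : Bool,
    arcSign (level (!p) (!q)) (level (!r) (!s)) = -arcSign (level p q) (level r s) := by
  decide

theorem betweenSign_not : ∀ p q r s t z : Bool,
    betweenSign (level (!p) (!q)) (level (!r) (!s)) (level (!t) (!z)) =
      betweenSign (level p q) (level r s) (level t z) := by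
  decide

theorem mean_arcSign (u v : V) :
    mean (fun x : V × Bool → Bool => (arcSign (label x u) (label x v) : ℝ)) = 0 :=
  mean_eq_zero_of_compl fun x => by
    simp only [label, arcSign_not]
    push_cast
    rfl

theorem mean_betweenSign {a b c : V} (hab : a ≠ b) (hac : a ≠ c) (hbc : b ≠ c) :
    mean (fun x : V × Bool → Bool => (betweenSign (label x a) (label x b) (label x c) : ℝ)) = 0 := by
  have := mean_six hab hac hbc fun p q r s t z => betweenSign (level p q) (level r s) (level t z)
  have e : ∑ p, ∑ q, ∑ r, ∑ s, ∑ t, ∑ z,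
      betweenSign (level p q) (level r s) (level t z) = 0 := by decide
  rw [e] at this
  simpa [label] using this

theorem mean_gain (C : Multiset (Constraint V)) : mean (fun x => (gain C x : ℝ)) = 0 := by
  have h := mean_gain_mul C fun _ => 1
  simp only [mul_one] at h
  rw [h, Finset.sum_eq_zero, Finset.sum_eq_zero, add_zero]
  · refine fun a _ => Finset.sum_eq_zero fun b _ => Finset.sum_eq_zero fun c _ => ?_
    by_cases hd : a ≠ b ∧ a ≠ c ∧ b ≠ c
    · rw [mean_betweenSign hd.1 hd.2.1 hd.2.2, mul_zero]
    · simp [betweenMult_eq_zero C hd]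
  · exact fun u _ => Finset.sum_eq_zero fun v _ => by rw [mean_arcSign, mul_zero]

/-- The coordinates of the character that detects the arcs between `u` and `v`. -/
def arcSupport (u v : V) : Finset (V × Bool) := {(u, true), (v, true), (v, false)}

/-- The coordinates of the character that detects the betweenness constraints on
`{a, b, c}`. -/
def betweenSupport (a b c : V) : Finset (V × Bool) :=
  {(a, true), (a, false), (b, true), (c, false)}

omit [Fintype V] in
theorem character_arcSupport {u v : V} (huv : u ≠ v) (x : V × Bool → Bool) :
    character (arcSupport u v) x =
      ((sign (x (u, true)) * sign (x (v, true)) * sign (x (v, false)) : ℤ) : ℝ) := by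
  unfold character arcSupport
  rw [Finset.prod_insert (by simp [huv]), Finset.prod_pair (by simp)]
  push_cast
  ring

omit [Fintype V] in
theorem character_betweenSupport {a b c : V} (hab : a ≠ b) (hac : a ≠ c) (x : V × Bool → Bool) :
    character (betweenSupport a b c) x =
      ((sign (x (a, true)) * sign (x (a, false)) * sign (x (b, true)) * sign (x (c, false)) : ℤ) :
        ℝ) := by
  unfold character betweenSupport
  rw [Finset.prod_insert (by simp [hab]), Finset.prod_insert (by simp [hac]),
    Finset.prod_pair (by simp)]
  push_cast
  ring

/-- Flipping the bit `(w, p)` negates the character without changing `g`. So a constraint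
contributes only to characters all of whose vertices it involves. -/
theorem mean_mul_character_eq_zero {S : Finset (V × Bool)} {w : V} {p : Bool} (hw : (w, p) ∈ S)
    (g : (V → ℕ) → ℝ) (hg : ∀ l l' : V → ℕ, (∀ v ≠ w, l v = l' v) → g l = g l') :
    mean (fun x => g (label x) * character S x) = 0 := by
  refine mean_eq_zero_of_flip (w, p) fun x => ?_
  rw [character_flip hw, hg (label (update x (w, p) !x (w, p))) (label x)
    fun v hv => label_update hv _ _]
  ring

theorem sum_two {u v : V} (huv : u ≠ v) (g : V → V → ℝ)
    (hg : ∀ a b, (u ≠ a ∧ u ≠ b) ∨ (v ≠ a ∧ v ≠ b) → g a b = 0) :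
    ∑ a, ∑ b, g a b = g u v + g v u := by
  rw [← Fintype.sum_prod_type' (f := g),
    ← Finset.sum_subset (Finset.subset_univ {(u, v), (v, u)}), Finset.sum_pair]
  · simp [huv]
  · rintro ⟨a, b⟩ - h
    refine hg a b ?_
    simp only [Finset.mem_insert, Finset.mem_singleton, Prod.mk.injEq, not_or] at h
    by_contra! h'
    obtain ⟨h1, h2⟩ := h'
    by_cases ha : u = a
    · subst ha
      exact h.1 ⟨rfl, (h2 huv.symm).symm⟩
    · have := h1 ha
      subst this
      refine h.2 ⟨?_, rfl⟩
      by_contra hv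
      exact huv (h2 (Ne.symm hv)).symm

theorem sum_six {u v w : V} (huv : u ≠ v) (huw : u ≠ w) (hvw : v ≠ w)
    (g : V → V → V → ℝ)
    (hg : ∀ a b c, (u ≠ a ∧ u ≠ b ∧ u ≠ c) ∨ (v ≠ a ∧ v ≠ b ∧ v ≠ c) ∨ (w ≠ a ∧ w ≠ b ∧ w ≠ c) →
      g a b c = 0) :
    ∑ a, ∑ b, ∑ c, g a b c =
      g u v w + g u w v + g v u w + g v w u + g w u v + g w v u := by
  have e : ∑ a, ∑ b, ∑ c, g a b c = ∑ p : V × V × V, g p.1 p.2.1 p.2.2 := by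
    rw [Fintype.sum_prod_type]
    exact Finset.sum_congr rfl fun a _ => (Fintype.sum_prod_type' (f := g a)).symm
  rw [e, ← Finset.sum_subset (Finset.subset_univ
    {(u, v, w), (u, w, v), (v, u, w), (v, w, u), (w, u, v), (w, v, u)})]
  · have h1 := huv.symm
    have h2 := huw.symm
    have h3 := hvw.symm
    rw [Finset.sum_insert, Finset.sum_insert, Finset.sum_insert, Finset.sum_insert,
      Finset.sum_pair]
    · ring
    all_goals simp [huv, huw, hvw, h1, h2, h3]
  · rintro ⟨a, b, c⟩ - h
    refine hg a b c ?_
    simp only [Finset.mem_insert, Finset.mem_singleton, Prod.mk.injEq, not_or] at h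
    by_contra h'
    simp only [not_or, not_and_or, not_not] at h'
    obtain ⟨h1, h2, h3⟩ := h'
    rcases h1 with rfl | rfl | rfl <;> rcases h2 with rfl | rfl | rfl <;>
      rcases h3 with rfl | rfl | rfl <;> simp_all

/-- The character has odd size, so the betweenness constraints drop out by complementation; arcs
that miss `u` or `v` drop out by a flip. The two arcs left have coefficients `1/4` and `-1/4`, with
weight `1/2`. -/
theorem mean_gain_arc (C : Multiset (Constraint V)) {u v : V} (huv : u ≠ v) :
    mean (fun x => (gain C x : ℝ) * character (arcSupport u v) x) =
      ((arcMult C u v : ℝ) - arcMult C v u) / 8 := by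
  have hb : ∀ a b c, mean (fun x => (betweenSign (label x a) (label x b) (label x c) : ℝ) *
      character (arcSupport u v) x) = 0 := by
    intro a b c
    refine mean_eq_zero_of_compl fun x => ?_
    simp only [character_arcSupport huv, label, betweenSign_not, sign_not]
    push_cast
    ring
  rw [mean_gain_mul]
  simp only [hb, mul_zero, Finset.sum_const_zero, add_zero]
  rw [sum_two huv]
  · have h1 := mean_four huv fun p q r s =>
      arcSign (level p q) (level r s) * (sign p * sign r * sign s)
    have h2 := mean_four huv fun p q r s =>
      arcSign (level r s) (level p q) * (sign p * sign r * sign s)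
    rw [show ∑ p, ∑ q, ∑ r, ∑ s,
      arcSign (level p q) (level r s) * (sign p * sign r * sign s) = 4 by decide] at h1
    rw [show ∑ p, ∑ q, ∑ r, ∑ s,
      arcSign (level r s) (level p q) * (sign p * sign r * sign s) = -4 by decide] at h2
    have e1 : mean (fun x => (arcSign (label x u) (label x v) : ℝ) *
        character (arcSupport u v) x) = 1 / 4 := by
      simp only [character_arcSupport huv, label, ← Int.cast_mul]
      rw [h1]
      norm_num
    have e2 : mean (fun x => (arcSign (label x v) (label x u) : ℝ) *
        character (arcSupport u v) x) = -1 / 4 := by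
      simp only [character_arcSupport huv, label, ← Int.cast_mul]
      rw [h2]
      norm_num
    rw [e1, e2]
    ring
  · rintro a b (h | h)
    · rw [mean_mul_character_eq_zero (S := arcSupport u v) (w := u) (p := true)
        (by simp [arcSupport]) (fun l => (arcSign (l a) (l b) : ℝ))
        (fun l l' hl => by simp only [hl a h.1.symm, hl b h.2.symm]), mul_zero]
    · rw [mean_mul_character_eq_zero (S := arcSupport u v) (w := v) (p := true)
        (by simp [arcSupport]) (fun l => (arcSign (l a) (l b) : ℝ))
        (fun l l' hl => by simp only [hl a h.1.symm, hl b h.2.symm]), mul_zero]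

theorem betweenMult_comm (C : Multiset (Constraint V)) (a b c : V) :
    betweenMult C a c b = betweenMult C a b c := by
  unfold betweenMult
  rw [Finset.pair_comm]

/-- The character has even size, so the arcs drop out by complementation; constraints that miss one
of the three vertices drop out by a flip. The coefficients of the three rotations are `1/8`, `-1/4`,
`1/8`; each occurs for two orders of its pair, with weight `1/12`. -/
theorem mean_gain_between (C : Multiset (Constraint V)) {a b c : V} (hab : a ≠ b) (hac : a ≠ c)
    (hbc : b ≠ c) :
    mean (fun x => (gain C x : ℝ) * character (betweenSupport a b c) x) =
      ((betweenMult C a b c : ℝ) - 2 * betweenMult C b c a + betweenMult C c a b) / 48 := by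
  have ha : ∀ u v, mean (fun x => (arcSign (label x u) (label x v) : ℝ) *
      character (betweenSupport a b c) x) = 0 := by
    intro u v
    refine mean_eq_zero_of_compl fun x => ?_
    simp only [character_betweenSupport hab hac, label, arcSign_not, sign_not]
    push_cast
    ring
  rw [mean_gain_mul]
  simp only [ha, mul_zero, Finset.sum_const_zero, zero_add]
  rw [sum_six hab hac hbc]
  · have h1 := mean_six hab hac hbc fun p q r s t z =>
      betweenSign (level p q) (level r s) (level t z) * (sign p * sign q * sign r * sign z)
    have h2 := mean_six hab hac hbc fun p q r s t z =>
      betweenSign (level r s) (level t z) (level p q) * (sign p * sign q * sign r * sign z)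
    have h3 := mean_six hab hac hbc fun p q r s t z =>
      betweenSign (level t z) (level p q) (level r s) * (sign p * sign q * sign r * sign z)
    rw [show ∑ p, ∑ q, ∑ r, ∑ s, ∑ t, ∑ z, betweenSign (level p q) (level r s) (level t z) *
      (sign p * sign q * sign r * sign z) = 8 by decide] at h1
    rw [show ∑ p, ∑ q, ∑ r, ∑ s, ∑ t, ∑ z, betweenSign (level r s) (level t z) (level p q) *
      (sign p * sign q * sign r * sign z) = -16 by decide] at h2
    rw [show ∑ p, ∑ q, ∑ r, ∑ s, ∑ t, ∑ z, betweenSign (level t z) (level p q) (level r s) *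
      (sign p * sign q * sign r * sign z) = 8 by decide] at h3
    have e1 : mean (fun x => (betweenSign (label x a) (label x b) (label x c) : ℝ) *
        character (betweenSupport a b c) x) = 1 / 8 := by
      simp only [character_betweenSupport hab hac, label, ← Int.cast_mul]
      rw [h1]
      norm_num
    have e2 : mean (fun x => (betweenSign (label x b) (label x c) (label x a) : ℝ) *
        character (betweenSupport a b c) x) = -1 / 4 := by
      simp only [character_betweenSupport hab hac, label, ← Int.cast_mul]
      rw [h2]
      norm_num
    have e3 : mean (fun x => (betweenSign (label x c) (label x a) (label x b) : ℝ) *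
        character (betweenSupport a b c) x) = 1 / 8 := by
      simp only [character_betweenSupport hab hac, label, ← Int.cast_mul]
      rw [h3]
      norm_num
    simp only [betweenMult_comm C a b c, betweenMult_comm C b c a, betweenMult_comm C c a b,
      fun x : V × Bool → Bool => betweenSign_comm (label x a) (label x c) (label x b),
      fun x : V × Bool → Bool => betweenSign_comm (label x b) (label x a) (label x c),
      fun x : V × Bool → Bool => betweenSign_comm (label x c) (label x b) (label x a)]
    rw [e1, e2, e3]
    ring
  · rintro u v w (h | h | h)
    · rw [mean_mul_character_eq_zero (S := betweenSupport a b c) (w := a) (p := true)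
        (by simp [betweenSupport]) (fun l => (betweenSign (l u) (l v) (l w) : ℝ))
        (fun l l' hl => by simp only [hl u h.1.symm, hl v h.2.1.symm, hl w h.2.2.symm]), mul_zero]
    · rw [mean_mul_character_eq_zero (S := betweenSupport a b c) (w := b) (p := true)
        (by simp [betweenSupport]) (fun l => (betweenSign (l u) (l v) (l w) : ℝ))
        (fun l l' hl => by simp only [hl u h.1.symm, hl v h.2.1.symm, hl w h.2.2.symm]), mul_zero]
    · rw [mean_mul_character_eq_zero (S := betweenSupport a b c) (w := c) (p := false)
        (by simp [betweenSupport]) (fun l => (betweenSign (l u) (l v) (l w) : ℝ))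
        (fun l l' hl => by simp only [hl u h.1.symm, hl v h.2.1.symm, hl w h.2.2.symm]), mul_zero]

theorem card_reduceArcs (C : Multiset (Constraint V)) :
    (Multiset.card (reduceArcs (arcs C)) : ℚ) = ∑ u, ∑ v, (arcMult C u v : ℚ) := by
  have := sum_arcs (reduceArcs (arcs C)) fun _ _ => 1
  simpa [arcMult] using this

theorem two_mul_card_reduceBetweenness (C : Multiset (Constraint V)) :
    2 * (Multiset.card (reduceBetweenness (betweenness C)) : ℚ) =
      ∑ a, ∑ b, ∑ c, (betweenMult C a b c : ℚ) := by
  have hp : ∀ x ∈ reduceBetweenness (betweenness C), IsProper x :=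
    fun x hx => isProper_of_mem_reduceBetweenness hx
  have h := sum_proper _ hp fun _ _ _ => 1
  have h2 : (reduceBetweenness (betweenness C)).map
      (fun b => ∑ p ∈ b.2.offDiag, (1 : ℚ)) = (reduceBetweenness (betweenness C)).map fun _ => 2 := by
    refine Multiset.map_congr rfl fun b hb => ?_
    rw [Finset.sum_const, Finset.offDiag_card, (hp b hb).1]
    norm_num
  rw [h2] at h
  simp only [Multiset.map_const', Multiset.sum_replicate, nsmul_eq_mul, mul_one] at h
  rw [mul_comm, h]
  rfl

/-- Bessel's inequality over all ordered pairs of distinct vertices; the coefficients are the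
differences of opposite multiplicities, divided by `8`. -/
theorem arcs_le_mean_gain_sq (C : Multiset (Constraint V)) :
    (Multiset.card (reduceArcs (arcs C)) : ℝ) ≤ 64 * mean (fun x => (gain C x : ℝ) ^ 2) := by
  have hB := sum_sq_le_mean_sq (Finset.univ.offDiag : Finset (V × V))
    (fun p => arcSupport p.1 p.2) (by
      -- The support determines the pair: `v` is the only vertex that appears with `false`, and `u`
      -- is the other vertex.
      rintro ⟨u, v⟩ h ⟨u', v'⟩ - he
      simp only [Finset.coe_offDiag, Set.mem_offDiag] at h
      have h1 : (v, false) ∈ arcSupport u' v' := by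
        simp only at he
        rw [← he]
        simp [arcSupport]
      have h2 : (u, true) ∈ arcSupport u' v' := by
        simp only at he
        rw [← he]
        simp [arcSupport]
      simp [arcSupport] at h1 h2
      subst h1
      rcases h2 with rfl | rfl
      · rfl
      · exact absurd rfl h.2.2) fun x => (gain C x : ℝ)
  have h1 : ∀ p ∈ (Finset.univ.offDiag : Finset (V × V)), (arcMult C p.1 p.2 : ℝ) / 64 ≤
      mean (fun x => (gain C x : ℝ) * character (arcSupport p.1 p.2) x) ^ 2 := by
    rintro ⟨u, v⟩ hp
    simp only [Finset.mem_offDiag, Finset.mem_univ, true_and] at hp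
    rw [mean_gain_arc C hp]
    simp only [arcMult_eq C u v, arcMult_eq C v u]
    -- After deletion one of two opposite arcs has multiplicity zero, so nothing cancels in the
    -- difference; and `n ≤ n ^ 2`.
    rcases le_total ((arcs C).count (u, v)) ((arcs C).count (v, u)) with h | h
    · rw [Nat.sub_eq_zero_of_le h]
      push_cast
      rw [zero_div]
      positivity
    · rw [Nat.sub_eq_zero_of_le h]
      set n := (arcs C).count (u, v) - (arcs C).count (v, u)
      have : (n : ℝ) ≤ (n : ℝ) ^ 2 := by
        exact_mod_cast Nat.le_self_pow (by norm_num) n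
      push_cast
      linarith
  have h2 := (Finset.sum_le_sum h1).trans hB
  have h3 : ∑ p ∈ (Finset.univ.offDiag : Finset (V × V)), (arcMult C p.1 p.2 : ℝ) / 64 =
      ∑ u, ∑ v, (arcMult C u v : ℝ) / 64 := by
    rw [← Fintype.sum_prod_type' (f := fun u v => (arcMult C u v : ℝ) / 64)]
    refine Finset.sum_subset (Finset.subset_univ _) ?_
    rintro ⟨u, v⟩ - h
    simp only [Finset.mem_offDiag, Finset.mem_univ, true_and, not_not] at h
    subst h
    simp [arcMult_self]
  have h4 : (Multiset.card (reduceArcs (arcs C)) : ℝ) = ∑ u, ∑ v, (arcMult C u v : ℝ) := by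
    exact_mod_cast card_reduceArcs C
  rw [h3] at h2
  simp only [← Finset.sum_div] at h2
  rw [h4]
  linarith

/-- A single coefficient may vanish by cancellation, so the coefficients of the three rotations are
estimated together. The sum over ordered triples counts each constraint twice, whence `2304 / 2 =
1152`. -/
theorem betweenness_le_mean_gain_sq (C : Multiset (Constraint V)) :
    (Multiset.card (reduceBetweenness (betweenness C)) : ℝ) ≤
      1152 * mean (fun x => (gain C x : ℝ) ^ 2) := by
  set J : Finset (V × V × V) :=
    Finset.univ.filter fun p => p.1 ≠ p.2.1 ∧ p.1 ≠ p.2.2 ∧ p.2.1 ≠ p.2.2 with hJ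
  have hB := sum_sq_le_mean_sq J (fun p => betweenSupport p.1 p.2.1 p.2.2) (by
      -- The support determines the triple: `a` appears with both bits, `b` only with `true`, `c`
      -- only with `false`.
      rintro ⟨a, b, c⟩ h ⟨a', b', c'⟩ h' he
      simp only [hJ, Finset.coe_filter, Finset.mem_univ, true_and, Set.mem_ofPred_eq] at h h'
      simp only at he
      have h1 : (a, true) ∈ betweenSupport a' b' c' := by
        rw [← he]
        simp [betweenSupport]
      have h2 : (a, false) ∈ betweenSupport a' b' c' := by
        rw [← he]
        simp [betweenSupport]
      have h3 : (b, true) ∈ betweenSupport a' b' c' := by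
        rw [← he]
        simp [betweenSupport]
      have h4 : (c, false) ∈ betweenSupport a' b' c' := by
        rw [← he]
        simp [betweenSupport]
      simp [betweenSupport] at h1 h2 h3 h4
      have ha : a = a' := by
        rcases h1 with rfl | rfl
        · rfl
        · rcases h2 with rfl | rfl
          · rfl
          · exact absurd rfl h'.2.2
      subst ha
      rcases h3 with rfl | rfl
      · exact absurd rfl h.1
      · rcases h4 with rfl | rfl
        · exact absurd rfl h.2.1
        · rfl) fun x => (gain C x : ℝ)
  set D : V → V → V → ℝ := fun a b c =>
    (betweenMult C a b c : ℝ) - 2 * betweenMult C b c a + betweenMult C c a b with hD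
  have hz : ∀ a b c, ¬ (a ≠ b ∧ a ≠ c ∧ b ≠ c) → betweenMult C a b c = 0 ∧
      betweenMult C b c a = 0 ∧ betweenMult C c a b = 0 := fun a b c h =>
    ⟨betweenMult_eq_zero C h, betweenMult_eq_zero C (by tauto), betweenMult_eq_zero C (by tauto)⟩
  have h1 : ∑ p ∈ J, mean (fun x => (gain C x : ℝ) *
      character (betweenSupport p.1 p.2.1 p.2.2) x) ^ 2 = ∑ a, ∑ b, ∑ c, D a b c ^ 2 / 2304 := by
    have e : ∑ a, ∑ b, ∑ c, D a b c ^ 2 / 2304 =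
        ∑ p : V × V × V, D p.1 p.2.1 p.2.2 ^ 2 / 2304 := by
      rw [Fintype.sum_prod_type]
      exact Finset.sum_congr rfl fun a _ =>
        (Fintype.sum_prod_type' (f := fun b c => D a b c ^ 2 / 2304)).symm
    rw [e, ← Finset.sum_subset (Finset.subset_univ J)]
    · refine Finset.sum_congr rfl fun p hp => ?_
      simp only [hJ, Finset.mem_filter, Finset.mem_univ, true_and] at hp
      rw [mean_gain_between C hp.1 hp.2.1 hp.2.2, div_pow]
      norm_num [hD]
    · intro p _ hp
      simp only [hJ, Finset.mem_filter, Finset.mem_univ, true_and] at hp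
      obtain ⟨h1, h2, h3⟩ := hz _ _ _ hp
      simp [hD, h1, h2, h3]
  rw [h1] at hB
  have rot : ∀ g : V → V → V → ℝ, ∑ a, ∑ b, ∑ c, g a b c = ∑ a, ∑ b, ∑ c, g b c a := by
    intro g
    rw [Finset.sum_comm]
    calc _ = ∑ b, ∑ c, ∑ a, g a b c := Finset.sum_congr rfl fun b _ => Finset.sum_comm
      _ = ∑ c, ∑ b, ∑ a, g a b c := Finset.sum_comm
      _ = ∑ c, ∑ a, ∑ b, g a b c := Finset.sum_congr rfl fun b _ => Finset.sum_comm
  have h2 : ∑ a, ∑ b, ∑ c, ((betweenMult C a b c : ℝ) + betweenMult C b c a +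
      betweenMult C c a b) / 2304 ≤
      ∑ a, ∑ b, ∑ c, (D a b c ^ 2 / 2304 + D b c a ^ 2 / 2304 + D c a b ^ 2 / 2304) := by
    refine Finset.sum_le_sum fun a _ => Finset.sum_le_sum fun b _ => Finset.sum_le_sum fun c _ => ?_
    by_cases hd : a ≠ b ∧ a ≠ c ∧ b ≠ c
    · have hmin : betweenMult C a b c = 0 ∨ betweenMult C b c a = 0 ∨ betweenMult C c a b = 0 := by
        rw [betweenMult_eq C hd.1 hd.2.1 hd.2.2, betweenMult_eq C hd.2.2 hd.1.symm hd.2.1.symm,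
          betweenMult_eq C hd.2.1.symm hd.2.2.symm hd.1]
        omega
      have hsq : ∀ n : ℕ, (n : ℝ) ≤ (n : ℝ) ^ 2 := fun n => by
        exact_mod_cast Nat.le_self_pow (by norm_num) n
      have s1 := hsq (betweenMult C a b c)
      have s2 := hsq (betweenMult C b c a)
      have s3 := hsq (betweenMult C c a b)
      have p1 : (0 : ℝ) ≤ betweenMult C a b c := Nat.cast_nonneg _
      have p2 : (0 : ℝ) ≤ betweenMult C b c a := Nat.cast_nonneg _
      have p3 : (0 : ℝ) ≤ betweenMult C c a b := Nat.cast_nonneg _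
      simp only [hD]
      rcases hmin with h | h | h <;> rw [h] at * <;> push_cast at * <;> nlinarith
    · obtain ⟨h1, h2, h3⟩ := hz _ _ _ hd
      simp [hD, h1, h2, h3]
  have r1 := rot fun a b c => D a b c ^ 2 / 2304
  have r2 := rot fun a b c => D b c a ^ 2 / 2304
  have r3 := rot fun a b c => (betweenMult C a b c : ℝ)
  have r4 := rot fun a b c => (betweenMult C b c a : ℝ)
  simp only [← Finset.sum_div, Finset.sum_add_distrib] at h2 r1 r2 r3 r4 hB
  have h4 : 2 * (Multiset.card (reduceBetweenness (betweenness C)) : ℝ) =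
      ∑ a, ∑ b, ∑ c, (betweenMult C a b c : ℝ) := by
    exact_mod_cast two_mul_card_reduceBetweenness C
  linarith

/-- An instance in which many arcs and betweenness constraints remain is a yes-instance. -/
theorem isYes_of_le_remaining (C : Multiset (Constraint V)) (k : ℕ)
    (h : 2 ^ 36 * k ^ 2 ≤ remaining C) : IsYes {1} C k := by
  by_contra hno
  have hlt : ∀ x, (gain C x : ℝ) < 2 * k := fun x => by
    exact_mod_cast gain_lt_of_not_isYes hno x
  -- For `k = 0` a no-instance would have negative gain everywhere, although the mean is zero.
  rcases Nat.eq_zero_or_pos k with rfl | hk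
  · have h1 : ∑ x, (gain C x : ℝ) < ∑ _x : V × Bool → Bool, (0 : ℝ) :=
      Finset.sum_lt_sum_of_nonempty Finset.univ_nonempty fun x _ => by simpa using hlt x
    have h2 := mean_gain C
    rw [mean, div_eq_zero_iff] at h2
    have := card_pos (ι := V × Bool)
    rcases h2 with h2 | h2
    · simp [h2] at h1
    · linarith
  -- With degree 6 and upper bound `2 * k`, the constant is `(64 + 1152) * 9 ^ 7 * 4 < 2 ^ 36`.
  · have h1 := mean_sq_le_of_le (gain_mem_lowDegree C) (mean_gain C) fun x => (hlt x).le
    have h2 := arcs_le_mean_gain_sq C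
    have h3 := betweenness_le_mean_gain_sq C
    have h4 : ((2 ^ 36 * k ^ 2 : ℕ) : ℝ) ≤ (remaining C : ℝ) := by exact_mod_cast h
    have h5 : (1 : ℝ) ≤ (k : ℝ) ^ 2 := one_le_pow₀ (by exact_mod_cast hk)
    unfold remaining at h4
    push_cast at h4
    rw [mul_pow] at h1
    norm_num at h1 h4
    linarith

end Lower

end PermCSP

/-! ## The kernelization as an expression -/

namespace PermCSP

open StackProgram

/-- The alphabet of encoded instances with parameter. -/
abbrev Symbol : Type := Bool ⊕ Bool

section Values

/-- The number of separators among the first `p` letters. -/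
def separators (w : List Symbol) (p : ℕ) : ℕ :=
  ∑ q ∈ Finset.range p, if w[q]? = some (.inl false) then 1 else 0

/-- The number in position `j` of the list of numbers that is encoded by a word. -/
def entry (w : List Symbol) (j : ℕ) : ℕ :=
  ∑ p ∈ Finset.range w.length,
    (if w[p]? = some (.inl true) then 1 else 0) * (if separators w p = j then 1 else 0)

/-- The number of arcs `(u, v)`. -/
def arcCount (w : List Symbol) (u v : ℕ) : ℕ :=
  ∑ i ∈ Finset.range w.length,
    ((if entry w (3 * i + 1) = u then 1 else 0) * (if entry w (3 * i + 2) = v then 1 else 0) +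
      (if entry w (3 * i + 2) = u then 1 else 0) * (if entry w (3 * i + 3) = v then 1 else 0))

/-- The number of remaining arcs `(u, v)`. -/
def arcRest (w : List Symbol) (u v : ℕ) : ℕ := arcCount w u v - arcCount w v u

/-- The number of betweenness constraints `(a, {b, c})`. -/
def betweenCount (w : List Symbol) (a b c : ℕ) : ℕ :=
  ∑ i ∈ Finset.range w.length, (if entry w (3 * i + 2) = a then 1 else 0) *
    ((if entry w (3 * i + 1) = b then 1 else 0) * (if entry w (3 * i + 3) = c then 1 else 0) +
      (if entry w (3 * i + 1) = c then 1 else 0) * (if entry w (3 * i + 3) = b then 1 else 0))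

/-- The number of remaining betweenness constraints `(a, {b, c})`. -/
def betweenRest (w : List Symbol) (a b c : ℕ) : ℕ :=
  -- The outer factors express distinctness; `x - (x - y)` is the minimum of `x` and `y`.
  (1 - if a = b then 1 else 0) * ((1 - if a = c then 1 else 0) * ((1 - if b = c then 1 else 0) *
    (betweenCount w a b c - (betweenCount w b c a - (betweenCount w b c a - betweenCount w c a b)))))

/-- The multiplicity of a new triple. -/
def tripleMult (w : List Symbol) (x y z : ℕ) : ℕ :=
  -- The number `entry w 0`, which is the number of old variables, stands for `ω`.
  (if x = entry w 0 then 1 else 0) * arcRest w y z +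
    ((if y = entry w 0 then 1 else 0) * arcRest w x z +
      ((if z = entry w 0 then 1 else 0) * arcRest w x y + betweenRest w y x z))

/-- The number of new triples in which `x` occurs, counted by positions. -/
def occurrences (w : List Symbol) (x : ℕ) : ℕ :=
  ∑ y ∈ Finset.range (entry w 0 + 1), ∑ z ∈ Finset.range (entry w 0 + 1),
    (tripleMult w x y z + (tripleMult w y x z + tripleMult w y z x))

/-- The number of variables below `x` that occur in new triples. -/
def rank (w : List Symbol) (x : ℕ) : ℕ :=
  ∑ y ∈ Finset.range x, (1 - (1 - occurrences w y))

/-- The number of new triples. -/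
def tripleCount (w : List Symbol) : ℕ :=
  ∑ x ∈ Finset.range (entry w 0 + 1), ∑ y ∈ Finset.range (entry w 0 + 1),
    ∑ z ∈ Finset.range (entry w 0 + 1), tripleMult w x y z

/-- The number of powers of two that are at most `m`. -/
def powerCount (m : ℕ) : ℕ :=
  -- A positive number fails to be a power of two exactly if it has a divisor of the form `2 * i +
  -- 3`.
  ∑ t ∈ Finset.range m, (1 - ∑ i ∈ Finset.range (t + 1), ∑ j ∈ Finset.range (t + 1),
    if (2 * i + 3) * (j + 1) = t + 1 then 1 else 0)

/-- The number of binary digits of the parameter. -/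
def digitCount (w : List Symbol) : ℕ :=
  ∑ p ∈ Finset.range w.length, ((if w[p]? = some (.inr true) then 1 else 0) +
    if w[p]? = some (.inr false) then 1 else 0)

/-- The indicator of the instances that are not solved at once. -/
def openFlag (w : List Symbol) : ℕ :=
  (1 - (1 - digitCount w)) * (1 - (powerCount (tripleCount w) - (2 * digitCount w + 38)))

/-- The digits of the parameter. -/
def digits (w : List Symbol) : List Symbol :=
  (List.range w.length).flatMap fun p =>
    List.replicate (if w[p]? = some (.inr true) then 1 else 0) (.inr true) ++
      List.replicate (if w[p]? = some (.inr false) then 1 else 0) (.inr false)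

/-- A number in unary, closed by a separator. -/
def block (a : ℕ) : List Symbol := List.replicate a (.inl true) ++ [.inl false]

/-- The encoded new instance. -/
def newWord (w : List Symbol) : List Symbol :=
  block (rank w (entry w 0 + 1)) ++
    (((List.range (entry w 0 + 1)).flatMap fun x => (List.range (entry w 0 + 1)).flatMap fun y =>
      (List.range (entry w 0 + 1)).flatMap fun z =>
        (List.replicate (tripleMult w x y z)
          (block (rank w x) ++ (block (rank w y) ++ block (rank w z)))).flatten) ++
      (.inr false :: digits w))

/-- The output of the kernelization. -/
def outputWord (w : List Symbol) : List Symbol :=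
  if openFlag w = 0 then [.inl false] else newWord w

end Values

/-! ### Expressions for these quantities, and their values -/

namespace Expr

variable {V : Type}

/-- The numerical value of an expression. -/
def val (w : List Symbol) (e : Ex Symbol ℕ) : ℕ := (e.eval (.inl true) w).length

def one : Ex Symbol V := .emit (.inl true)

def const : ℕ → Ex Symbol V
  | 0 => .nil
  | n + 1 => .app (const n) one

def mul (a b : Ex Symbol V) : Ex Symbol V := .rep a fun _ => b

def compl (a : Ex Symbol V) : Ex Symbol V := .sub one a

/-- Both truncated differences vanish exactly when the values agree. -/
def eq (a b : Ex Symbol V) : Ex Symbol V := compl (.app (.sub a b) (.sub b a))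

def separators (p : Ex Symbol V) : Ex Symbol V := .rep p fun q => .test (.inl false) (.var q)

def entry (j : Ex Symbol V) : Ex Symbol V :=
  .rep .len fun p => mul (.test (.inl true) (.var p)) (eq (separators (.var p)) j)

def arcCount (u v : Ex Symbol V) : Ex Symbol V :=
  .rep .len fun i => .app
    (mul (eq (entry (.app (mul (const 3) (.var i)) (const 1))) u)
      (eq (entry (.app (mul (const 3) (.var i)) (const 2))) v))
    (mul (eq (entry (.app (mul (const 3) (.var i)) (const 2))) u)
      (eq (entry (.app (mul (const 3) (.var i)) (const 3))) v))

def arcRest (u v : Ex Symbol V) : Ex Symbol V := .sub (arcCount u v) (arcCount v u)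

def betweenCount (a b c : Ex Symbol V) : Ex Symbol V :=
  .rep .len fun i => mul (eq (entry (.app (mul (const 3) (.var i)) (const 2))) a) (.app
    (mul (eq (entry (.app (mul (const 3) (.var i)) (const 1))) b)
      (eq (entry (.app (mul (const 3) (.var i)) (const 3))) c))
    (mul (eq (entry (.app (mul (const 3) (.var i)) (const 1))) c)
      (eq (entry (.app (mul (const 3) (.var i)) (const 3))) b)))

def betweenRest (a b c : Ex Symbol V) : Ex Symbol V :=
  mul (compl (eq a b)) (mul (compl (eq a c)) (mul (compl (eq b c))
    (.sub (betweenCount a b c)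
      (.sub (betweenCount b c a) (.sub (betweenCount b c a) (betweenCount c a b))))))

def tripleMult (x y z : Ex Symbol V) : Ex Symbol V :=
  .app (mul (eq x (entry .nil)) (arcRest y z)) (.app (mul (eq y (entry .nil)) (arcRest x z))
    (.app (mul (eq z (entry .nil)) (arcRest x y)) (betweenRest y x z)))

def bound : Ex Symbol V := .app (entry .nil) one

def occurrences (x : Ex Symbol V) : Ex Symbol V :=
  .rep bound fun y => .rep bound fun z => .app (tripleMult x (.var y) (.var z))
    (.app (tripleMult (.var y) x (.var z)) (tripleMult (.var y) (.var z) x))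

def rank (x : Ex Symbol V) : Ex Symbol V :=
  .rep x fun y => compl (compl (occurrences (.var y)))

def tripleCount : Ex Symbol V :=
  .rep bound fun x => .rep bound fun y => .rep bound fun z =>
    tripleMult (.var x) (.var y) (.var z)

def powerCount (m : Ex Symbol V) : Ex Symbol V :=
  .rep m fun t => compl (.rep (.app (.var t) one) fun i => .rep (.app (.var t) one) fun j =>
    eq (mul (.app (mul (const 2) (.var i)) (const 3)) (.app (.var j) one)) (.app (.var t) one))

def digitCount : Ex Symbol V :=
  .rep .len fun p => .app (.test (.inr true) (.var p)) (.test (.inr false) (.var p))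

def openFlag : Ex Symbol V :=
  mul (compl (compl digitCount))
    (compl (.sub (powerCount tripleCount) (.app (mul (const 2) digitCount) (const 38))))

def block (a : Ex Symbol V) : Ex Symbol V :=
  .app (.rep a fun _ => .emit (.inl true)) (.emit (.inl false))

def digits : Ex Symbol V :=
  .rep .len fun p => .app (.rep (.test (.inr true) (.var p)) fun _ => .emit (.inr true))
    (.rep (.test (.inr false) (.var p)) fun _ => .emit (.inr false))

def newWord : Ex Symbol V :=
  .app (block (rank bound))
    (.app (.rep bound fun x => .rep bound fun y => .rep bound fun z =>
        .rep (tripleMult (.var x) (.var y) (.var z)) fun _ =>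
          .app (block (rank (.var x))) (.app (block (rank (.var y))) (block (rank (.var z)))))
      (.app (.emit (.inr false)) digits))

/-- The expression for the kernelization. -/
def output : Ex Symbol V :=
  -- The flag is `0` or `1`, so repetition serves as case distinction.
  .app (.rep (compl openFlag) fun _ => .emit (.inl false)) (.rep openFlag fun _ => newWord)

section Values

variable (w : List Symbol)

@[simp] theorem val_nil : val w .nil = 0 := rfl

@[simp] theorem val_one : val w one = 1 := rfl

@[simp] theorem val_app (a b : Ex Symbol ℕ) : val w (.app a b) = val w a + val w b := by
  simp [val, Ex.eval]

@[simp] theorem val_var (x : ℕ) : val w (.var x) = x := by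
  simp [val, Ex.eval]

@[simp] theorem val_len : val w .len = w.length := by
  simp [val, Ex.eval]

@[simp] theorem val_test (a : Symbol) (e : Ex Symbol ℕ) :
    val w (.test a e) = if w[val w e]? = some a then 1 else 0 := by
  change (if w[val w e]? = some a then [Sum.inl true] else []).length = _
  split_ifs <;> rfl

@[simp] theorem val_sub (a b : Ex Symbol ℕ) : val w (.sub a b) = val w a - val w b := by
  simp [val, Ex.eval]

@[simp] theorem val_rep (e : Ex Symbol ℕ) (f : ℕ → Ex Symbol ℕ) :
    val w (.rep e f) = ∑ i ∈ Finset.range (val w e), val w (f i) := by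
  simp only [val, Ex.eval, List.length_flatMap]
  rfl

@[simp] theorem val_const (n : ℕ) : val w (const n) = n := by
  induction n with
  | zero => rfl
  | succ n ih => simp [const, ih]

@[simp] theorem val_mul (a b : Ex Symbol ℕ) : val w (mul a b) = val w a * val w b := by
  simp [mul]

@[simp] theorem val_compl (a : Ex Symbol ℕ) : val w (compl a) = 1 - val w a := by
  simp [compl]

@[simp] theorem val_eq (a b : Ex Symbol ℕ) :
    val w (eq a b) = if val w a = val w b then 1 else 0 := by
  simp only [eq, val_compl, val_app, val_sub]
  split_ifs <;> omega

@[simp] theorem val_separators (p : Ex Symbol ℕ) :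
    val w (separators p) = PermCSP.separators w (val w p) := by
  simp [separators, PermCSP.separators]

@[simp] theorem val_entry (j : Ex Symbol ℕ) :
    val w (entry j) = PermCSP.entry w (val w j) := by
  simp only [entry, PermCSP.entry, val_rep, val_len, val_mul, val_test, val_eq, val_separators,
    val_var]

@[simp] theorem val_arcCount (u v : Ex Symbol ℕ) :
    val w (arcCount u v) = PermCSP.arcCount w (val w u) (val w v) := by
  simp only [arcCount, PermCSP.arcCount, val_rep, val_len, val_mul, val_eq, val_entry, val_app,
    val_const, val_var]

@[simp] theorem val_arcRest (u v : Ex Symbol ℕ) :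
    val w (arcRest u v) = PermCSP.arcRest w (val w u) (val w v) := by
  simp only [arcRest, PermCSP.arcRest, val_sub, val_arcCount]

@[simp] theorem val_betweenCount (a b c : Ex Symbol ℕ) :
    val w (betweenCount a b c) = PermCSP.betweenCount w (val w a) (val w b) (val w c) := by
  simp only [betweenCount, PermCSP.betweenCount, val_rep, val_len, val_mul, val_eq, val_entry,
    val_app, val_const, val_var]

@[simp] theorem val_betweenRest (a b c : Ex Symbol ℕ) :
    val w (betweenRest a b c) = PermCSP.betweenRest w (val w a) (val w b) (val w c) := by
  simp only [betweenRest, PermCSP.betweenRest, val_mul, val_compl, val_eq, val_sub,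
    val_betweenCount]

@[simp] theorem val_tripleMult (x y z : Ex Symbol ℕ) :
    val w (tripleMult x y z) = PermCSP.tripleMult w (val w x) (val w y) (val w z) := by
  simp only [tripleMult, PermCSP.tripleMult, val_mul, val_eq, val_entry, val_app, val_nil,
    val_arcRest, val_betweenRest]

@[simp] theorem val_bound : val w bound = PermCSP.entry w 0 + 1 := by
  simp only [bound, val_app, val_entry, val_nil, val_one]

@[simp] theorem val_occurrences (x : Ex Symbol ℕ) :
    val w (occurrences x) = PermCSP.occurrences w (val w x) := by
  simp only [occurrences, PermCSP.occurrences, val_rep, val_bound, val_app, val_tripleMult, val_var]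

@[simp] theorem val_rank (x : Ex Symbol ℕ) : val w (rank x) = PermCSP.rank w (val w x) := by
  simp only [rank, PermCSP.rank, val_rep, val_compl, val_occurrences, val_var]

@[simp] theorem val_tripleCount : val w tripleCount = PermCSP.tripleCount w := by
  simp only [tripleCount, PermCSP.tripleCount, val_rep, val_bound, val_tripleMult, val_var]

@[simp] theorem val_powerCount (m : Ex Symbol ℕ) :
    val w (powerCount m) = PermCSP.powerCount (val w m) := by
  simp only [powerCount, PermCSP.powerCount, val_rep, val_compl, val_eq, val_mul, val_app,
    val_const, val_var, val_one]

@[simp] theorem val_digitCount : val w digitCount = PermCSP.digitCount w := by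
  simp only [digitCount, PermCSP.digitCount, val_rep, val_len, val_app, val_test, val_var]

@[simp] theorem val_openFlag : val w openFlag = PermCSP.openFlag w := by
  simp only [openFlag, PermCSP.openFlag, val_mul, val_compl, val_sub, val_powerCount,
    val_tripleCount, val_app, val_const, val_digitCount]

theorem eval_rep (e : Ex Symbol ℕ) (f : ℕ → Ex Symbol ℕ) :
    (Ex.rep e f).eval (.inl true) w =
      (List.range (val w e)).flatMap fun i => (f i).eval (.inl true) w := rfl

theorem eval_app (a b : Ex Symbol ℕ) :
    (Ex.app a b).eval (.inl true) w = a.eval (.inl true) w ++ b.eval (.inl true) w := rfl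

theorem eval_emit (a : Symbol) : (Ex.emit a : Ex Symbol ℕ).eval (.inl true) w = [a] := rfl

theorem flatMap_range_const {α : Type} (n : ℕ) (l : List α) :
    ((List.range n).flatMap fun _ => l) = (List.replicate n l).flatten := by
  rw [List.flatMap_def, List.map_const', List.length_range]

theorem eval_block (a : Ex Symbol ℕ) :
    (block a).eval (.inl true) w = PermCSP.block (val w a) := by
  unfold block PermCSP.block
  rw [eval_app, eval_rep]
  simp only [eval_emit]
  rw [flatMap_range_const, List.flatten_replicate_singleton]

theorem eval_digits : (digits : Ex Symbol ℕ).eval (.inl true) w = PermCSP.digits w := by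
  unfold digits PermCSP.digits
  simp only [eval_rep, eval_app, eval_emit, val_len, val_test, val_var, flatMap_range_const,
    List.flatten_replicate_singleton]

theorem eval_newWord : (newWord : Ex Symbol ℕ).eval (.inl true) w = PermCSP.newWord w := by
  unfold newWord PermCSP.newWord
  simp only [eval_rep, eval_app, eval_emit, val_bound, val_tripleMult, val_var, flatMap_range_const,
    eval_block, eval_digits, val_rank, List.singleton_append]

theorem eval_output : (output : Ex Symbol ℕ).eval (.inl true) w = outputWord w := by
  unfold output outputWord
  simp only [eval_app, eval_emit, eval_rep, val_compl, val_openFlag, eval_newWord]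
  have h : PermCSP.openFlag w ≤ 1 := by
    unfold PermCSP.openFlag
    exact (Nat.mul_le_mul (Nat.sub_le _ _) (Nat.sub_le _ _)).trans (by norm_num)
  split_ifs with h0
  · simp [h0]
  · simp [show PermCSP.openFlag w = 1 by omega]

end Values

/-! ### Parametricity of the expressions in the representation of variables -/

section Related

open Ex

variable {W : Type} {G : List (V × W)}

theorem related_weaken {G' : List (V × W)} {e : Ex Symbol V} {e' : Ex Symbol W}
    (h : Related G e e') (hG : G ⊆ G') : Related G' e e' := by
  induction h generalizing G' with
  | nil => exact .nil
  | emit a => exact .emit a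
  | app _ _ ih ih' => exact .app (ih hG) (ih' hG)
  | var hx => exact .var (hG hx)
  | len => exact .len
  | test a _ ih => exact .test a (ih hG)
  | sub _ _ ih ih' => exact .sub (ih hG) (ih' hG)
  | rep _ _ ih ihf => exact .rep (ih hG) fun x x' => ihf x x' (List.cons_subset_cons _ hG)

theorem related_cons {p : V × W} {e : Ex Symbol V} {e' : Ex Symbol W} (h : Related G e e') :
    Related (p :: G) e e' :=
  related_weaken h (List.subset_cons_self _ _)

theorem related_bound_var {x : V} {x' : W} : Related (Γ := Symbol) ((x, x') :: G) (.var x) (.var x') :=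
  .var List.mem_cons_self

variable {a b c : Ex Symbol V} {a' b' c' : Ex Symbol W}

theorem related_const (n : ℕ) : Related G (const n) (const n) := by
  induction n with
  | zero => exact .nil
  | succ n ih => exact .app ih (.emit _)

theorem related_mul (ha : Related G a a') (hb : Related G b b') :
    Related G (mul a b) (mul a' b') :=
  .rep ha fun _ _ => related_cons hb

theorem related_compl (ha : Related G a a') : Related G (compl a) (compl a') :=
  .sub (.emit _) ha

theorem related_eq (ha : Related G a a') (hb : Related G b b') : Related G (eq a b) (eq a' b') :=
  related_compl (.app (.sub ha hb) (.sub hb ha))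

theorem related_entry (ha : Related G a a') : Related G (entry a) (entry a') :=
  .rep .len fun _ _ => related_mul (.test _ related_bound_var)
    (related_eq (.rep related_bound_var fun _ _ => .test _ related_bound_var) (related_cons ha))

theorem related_entry_affine (n : ℕ) {x : V} {x' : W} :
    Related ((x, x') :: G) (entry (.app (mul (const 3) (.var x)) (const n)))
      (entry (.app (mul (const 3) (.var x')) (const n))) :=
  related_entry (.app (related_mul (related_const _) related_bound_var) (related_const _))

theorem related_arcCount (ha : Related G a a') (hb : Related G b b') :
    Related G (arcCount a b) (arcCount a' b') :=
  .rep .len fun _ _ => .app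
    (related_mul (related_eq (related_entry_affine _) (related_cons ha))
      (related_eq (related_entry_affine _) (related_cons hb)))
    (related_mul (related_eq (related_entry_affine _) (related_cons ha))
      (related_eq (related_entry_affine _) (related_cons hb)))

theorem related_arcRest (ha : Related G a a') (hb : Related G b b') :
    Related G (arcRest a b) (arcRest a' b') :=
  .sub (related_arcCount ha hb) (related_arcCount hb ha)

theorem related_betweenCount (ha : Related G a a') (hb : Related G b b') (hc : Related G c c') :
    Related G (betweenCount a b c) (betweenCount a' b' c') :=
  .rep .len fun _ _ => related_mul (related_eq (related_entry_affine _) (related_cons ha)) (.app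
    (related_mul (related_eq (related_entry_affine _) (related_cons hb))
      (related_eq (related_entry_affine _) (related_cons hc)))
    (related_mul (related_eq (related_entry_affine _) (related_cons hc))
      (related_eq (related_entry_affine _) (related_cons hb))))

theorem related_betweenRest (ha : Related G a a') (hb : Related G b b') (hc : Related G c c') :
    Related G (betweenRest a b c) (betweenRest a' b' c') :=
  related_mul (related_compl (related_eq ha hb)) (related_mul (related_compl (related_eq ha hc))
    (related_mul (related_compl (related_eq hb hc)) (.sub (related_betweenCount ha hb hc)
      (.sub (related_betweenCount hb hc ha)
        (.sub (related_betweenCount hb hc ha) (related_betweenCount hc ha hb))))))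

theorem related_tripleMult (ha : Related G a a') (hb : Related G b b') (hc : Related G c c') :
    Related G (tripleMult a b c) (tripleMult a' b' c') :=
  .app (related_mul (related_eq ha (related_entry .nil)) (related_arcRest hb hc))
    (.app (related_mul (related_eq hb (related_entry .nil)) (related_arcRest ha hc))
      (.app (related_mul (related_eq hc (related_entry .nil)) (related_arcRest ha hb))
        (related_betweenRest hb ha hc)))

theorem related_bound : Related G bound bound :=
  .app (related_entry .nil) (.emit _)

theorem related_occurrences (ha : Related G a a') :
    Related G (occurrences a) (occurrences a') :=
  .rep related_bound fun _ _ => .rep related_bound fun _ _ =>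
    .app (related_tripleMult (related_cons (related_cons ha)) (related_cons related_bound_var)
      related_bound_var)
      (.app (related_tripleMult (related_cons related_bound_var) (related_cons (related_cons ha))
        related_bound_var)
        (related_tripleMult (related_cons related_bound_var) related_bound_var
          (related_cons (related_cons ha))))

theorem related_rank (ha : Related G a a') : Related G (rank a) (rank a') :=
  .rep ha fun _ _ => related_compl (related_compl (related_occurrences related_bound_var))

theorem related_powerCount (ha : Related G a a') : Related G (powerCount a) (powerCount a') :=
  .rep ha fun _ _ => related_compl (.rep (.app related_bound_var (.emit _)) fun _ _ =>
    .rep (.app (related_cons related_bound_var) (.emit _)) fun _ _ =>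
      related_eq (related_mul
        (.app (related_mul (related_const _) (related_cons related_bound_var)) (related_const _))
        (.app related_bound_var (.emit _)))
        (.app (related_cons (related_cons related_bound_var)) (.emit _)))

theorem related_openFlag : Related G openFlag openFlag := by
  have h : Related G digitCount digitCount :=
    .rep .len fun _ _ => .app (.test _ related_bound_var) (.test _ related_bound_var)
  refine related_mul (related_compl (related_compl h)) (related_compl (.sub (related_powerCount ?_)
    (.app (related_mul (related_const _) h) (related_const _))))
  exact .rep related_bound fun _ _ => .rep related_bound fun _ _ => .rep related_bound fun _ _ =>
    related_tripleMult (related_cons (related_cons related_bound_var))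
      (related_cons related_bound_var) related_bound_var

theorem related_block (ha : Related G a a') : Related G (block a) (block a') :=
  .app (.rep ha fun _ _ => .emit _) (.emit _)

theorem related_newWord : Related G newWord newWord :=
  .app (related_block (related_rank related_bound)) (.app
    (.rep related_bound fun _ _ => .rep related_bound fun _ _ => .rep related_bound fun _ _ =>
      .rep (related_tripleMult (related_cons (related_cons related_bound_var))
        (related_cons related_bound_var) related_bound_var) fun _ _ =>
        .app (related_block (related_rank
          (related_cons (related_cons (related_cons related_bound_var)))))
          (.app (related_block (related_rank (related_cons (related_cons related_bound_var))))
            (related_block (related_rank (related_cons related_bound_var)))))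
    (.app (.emit _) (.rep .len fun _ _ => .app
      (.rep (.test _ related_bound_var) fun _ _ => .emit _)
      (.rep (.test _ related_bound_var) fun _ _ => .emit _))))

theorem related_output : Related G output output :=
  .app (.rep (related_compl related_openFlag) fun _ _ => .emit _)
    (.rep related_openFlag fun _ _ => related_newWord)

end Related

end Expr

end PermCSP

/-! ## The kernelization on encoded instances -/

namespace PermCSP

section Decoding

theorem separators_cons (a : Symbol) (w : List Symbol) (p : ℕ) :
    separators (a :: w) (p + 1) = separators w p + if a = .inl false then 1 else 0 := by
  simp only [separators, Finset.sum_range_succ', List.getElem?_cons_succ,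
    List.getElem?_cons_zero, Option.some.injEq]

theorem entry_cons (a : Symbol) (w : List Symbol) (j : ℕ) :
    entry (a :: w) j = (∑ p ∈ Finset.range w.length, (if w[p]? = some (.inl true) then 1 else 0) *
      (if (separators w p + if a = .inl false then 1 else 0) = j then 1 else 0)) +
        (if a = .inl true then 1 else 0) * (if 0 = j then 1 else 0) := by
  simp only [entry, List.length_cons, Finset.sum_range_succ', List.getElem?_cons_succ,
    separators_cons, List.getElem?_cons_zero, Option.some.injEq]
  simp [separators]

theorem entry_true_cons (w : List Symbol) (j : ℕ) :
    entry (.inl true :: w) j = entry w j + if 0 = j then 1 else 0 := by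
  rw [entry_cons]; simp [entry]

theorem entry_false_cons_zero (w : List Symbol) : entry (.inl false :: w) 0 = 0 := by
  rw [entry_cons]; simp

theorem entry_false_cons_succ (w : List Symbol) (j : ℕ) :
    entry (.inl false :: w) (j + 1) = entry w j := by
  rw [entry_cons]; simp [entry]

theorem entry_map_inr (b : List Bool) (j : ℕ) : entry (b.map .inr) j = 0 := by
  induction b with
  | nil => rfl
  | cons a b ih => rw [List.map_cons, entry_cons]; simp

theorem entry_replicate (a : ℕ) (w : List Symbol) (j : ℕ) :
    entry (List.replicate a (.inl true) ++ w) j = entry w j + a * if 0 = j then 1 else 0 := by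
  induction a with
  | zero => simp
  | succ a ih => rw [List.replicate_succ, List.cons_append, entry_true_cons, ih]; ring

theorem map_unaryWord_cons (a : ℕ) (l : List ℕ) :
    ((unaryWord (a :: l)).map .inl : List Symbol) = block a ++ (unaryWord l).map .inl := by
  simp [unaryWord, block]

/-- Digits of the parameter are neither unary marks nor separators, and positions beyond the list
read as `0`. -/
theorem entry_unaryWord (l : List ℕ) (b : List Bool) (j : ℕ) :
    entry ((unaryWord l).map .inl ++ b.map .inr) j = l.getD j 0 := by
  induction l generalizing j with
  | nil => simpa [unaryWord] using entry_map_inr b j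
  | cons a l ih =>
    rw [map_unaryWord_cons, block, List.append_assoc, List.append_assoc, entry_replicate,
      List.singleton_append]
    cases j with
    | zero => rw [entry_false_cons_zero]; simp
    | succ j => rw [entry_false_cons_succ, ih]; simp

theorem digits_cons (a : Symbol) (w : List Symbol) :
    digits (a :: w) = List.replicate (if a = .inr true then 1 else 0) (.inr true) ++
      List.replicate (if a = .inr false then 1 else 0) (.inr false) ++ digits w := by
  simp [digits, List.range_succ_eq_map, List.flatMap_map]

theorem digits_map_append (l b : List Bool) :
    digits (l.map .inl ++ b.map .inr) = b.map .inr := by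
  induction l with
  | nil =>
    induction b with
    | nil => rfl
    | cons a b ih =>
      simp only [List.map_nil, List.nil_append] at ih ⊢
      rw [List.map_cons, digits_cons, ih]
      cases a <;> simp
  | cons a l ih =>
    rw [List.map_cons, List.cons_append, digits_cons, ih]
    simp

theorem digitCount_eq_length (w : List Symbol) : digitCount w = (digits w).length := by
  rw [digits, List.length_flatMap]
  simp only [List.length_append, List.length_replicate]
  rfl

/-- Positions beyond the list of constraints read as triples of zeros. -/
theorem sum_entries {n : ℕ} (g : ℕ → ℕ → ℕ → ℕ) (L : List (Constraint (Fin n))) (N : ℕ)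
    (hN : L.length ≤ N) :
    ∑ i ∈ Finset.range N,
      g ((L.flatMap fun c => [(c 0 : ℕ), (c 1 : ℕ), (c 2 : ℕ)]).getD (3 * i) 0)
        ((L.flatMap fun c => [(c 0 : ℕ), (c 1 : ℕ), (c 2 : ℕ)]).getD (3 * i + 1) 0)
        ((L.flatMap fun c => [(c 0 : ℕ), (c 1 : ℕ), (c 2 : ℕ)]).getD (3 * i + 2) 0) =
      (L.map fun c => g (c 0) (c 1) (c 2)).sum + (N - L.length) * g 0 0 0 := by
  induction L generalizing N with
  | nil => simp
  | cons c L ih =>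
    obtain ⟨N, rfl⟩ : ∃ M, N = M + 1 := ⟨N - 1, by simp at hN; omega⟩
    rw [Finset.sum_range_succ', List.map_cons, List.sum_cons]
    have := ih N (by simpa using hN)
    simp only [List.flatMap_cons, List.cons_append, List.nil_append, Nat.mul_succ, Nat.mul_zero,
      Nat.zero_add, List.getD_cons_succ, List.getD_cons_zero, List.length_cons,
      Nat.add_sub_add_right] at this ⊢
    rw [this]
    ring

theorem countP_eq_sum_map {α : Type*} (p : α → Prop) [DecidablePred p] (L : List α) :
    (L : Multiset α).countP p = (L.map fun a => if p a then 1 else 0).sum := by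
  induction L with
  | nil => rfl
  | cons a L ih =>
    rw [← Multiset.cons_coe, Multiset.countP_cons, ih, List.map_cons, List.sum_cons, add_comm]

end Decoding

section Encoded

/-- The word of an instance, followed by digits. -/
def inputWord (I : Instance) (b : List Bool) : List Symbol :=
  (unaryWord I.code).map .inl ++ b.map .inr

variable (I : Instance) (b : List Bool)

theorem entry_zero : entry (inputWord I b) 0 = I.n := by
  rw [inputWord, entry_unaryWord]; rfl

theorem length_le_length_unaryWord (l : List ℕ) : l.length ≤ (unaryWord l).length := by
  induction l with
  | nil => simp
  | cons a l ih => simp only [unaryWord, List.flatMap_cons, List.length_append,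
      List.length_cons, List.length_replicate, List.length_nil] at ih ⊢; omega

theorem length_le_length_inputWord : I.constraints.length ≤ (inputWord I b).length := by
  have h := length_le_length_unaryWord I.code
  have h' : I.code.length = 3 * I.constraints.length + 1 := by
    simp [Instance.code, List.length_flatMap, mul_comm]
  simp only [inputWord, List.length_append, List.length_map]
  omega

/-- The word is at least as long as the list of constraints; the surplus indices read the triple
`(0, 0, 0)`. -/
theorem sum_entry (g : ℕ → ℕ → ℕ → ℕ) :
    ∑ i ∈ Finset.range (inputWord I b).length, g (entry (inputWord I b) (3 * i + 1))
      (entry (inputWord I b) (3 * i + 2)) (entry (inputWord I b) (3 * i + 3)) =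
      (I.constraints.map fun c => g (c 0) (c 1) (c 2)).sum +
        ((inputWord I b).length - I.constraints.length) * g 0 0 0 := by
  rw [← sum_entries g _ _ (length_le_length_inputWord I b)]
  refine Finset.sum_congr rfl fun i _ => ?_
  simp only [inputWord, entry_unaryWord, Instance.code, List.getD_cons_succ]

/-- The spurious triples `(0, 0, 0)` yield only loops, which are excluded by `u ≠ v`. -/
theorem arcCount_of_ne {u v : ℕ} (h : u ≠ v) :
    arcCount (inputWord I b) u v = (I.constraints.map fun c =>
      (if (c 0 : ℕ) = u then 1 else 0) * (if (c 1 : ℕ) = v then 1 else 0) +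
        (if (c 1 : ℕ) = u then 1 else 0) * (if (c 2 : ℕ) = v then 1 else 0)).sum := by
  rw [arcCount, sum_entry I b fun x y z =>
    (if x = u then 1 else 0) * (if y = v then 1 else 0) +
      (if y = u then 1 else 0) * (if z = v then 1 else 0)]
  rw [Nat.add_eq_left, Nat.mul_eq_zero]
  right
  split_ifs <;> omega

theorem betweenCount_of_ne {x y z : ℕ} (h : x ≠ y) :
    betweenCount (inputWord I b) x y z = (I.constraints.map fun c =>
      (if (c 1 : ℕ) = x then 1 else 0) *
        ((if (c 0 : ℕ) = y then 1 else 0) * (if (c 2 : ℕ) = z then 1 else 0) +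
          (if (c 0 : ℕ) = z then 1 else 0) * (if (c 2 : ℕ) = y then 1 else 0))).sum := by
  rw [betweenCount, sum_entry I b fun p q r => (if q = x then 1 else 0) *
        ((if p = y then 1 else 0) * (if r = z then 1 else 0) +
          (if p = z then 1 else 0) * (if r = y then 1 else 0))]
  rw [Nat.add_eq_left, Nat.mul_eq_zero]
  right
  split_ifs <;> omega

theorem arcCount_fin {u v : Fin I.n} (h : u ≠ v) :
    arcCount (inputWord I b) u v = (arcs I.multiset).count (u, v) := by
  rw [arcCount_of_ne I b (Fin.val_ne_of_ne h), count_arcs, Instance.multiset, countP_eq_sum_map,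
    countP_eq_sum_map, ← List.sum_map_add]
  congr 2
  funext c
  simp only [Fin.ext_iff, ite_and, mul_ite, mul_one, mul_zero]
  split_ifs <;> rfl

theorem betweenCount_fin {x y z : Fin I.n} (h : x ≠ y) (h'' : y ≠ z) :
    betweenCount (inputWord I b) x y z = (betweenness I.multiset).count (x, {y, z}) := by
  rw [betweenCount_of_ne I b (Fin.val_ne_of_ne h), count_betweenness _ h'',
    Instance.multiset, countP_eq_sum_map]
  congr 2
  funext c
  have := Fin.val_ne_of_ne h''
  simp only [Fin.ext_iff]
  simp only [mul_ite, mul_one, mul_zero]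
  split_ifs <;> omega

theorem arcRest_fin (u v : Fin I.n) :
    arcRest (inputWord I b) u v = arcMult I.multiset u v := by
  by_cases h : u = v
  · rw [h, arcMult_self, arcRest, Nat.sub_self]
  · rw [arcRest, arcCount_fin I b h, arcCount_fin I b (Ne.symm h), arcMult_eq]

theorem arcRest_eq_zero {u v : ℕ} (h : u = I.n ∨ v = I.n) : arcRest (inputWord I b) u v = 0 := by
  by_cases huv : u = v
  · rw [huv, arcRest, Nat.sub_self]
  · rw [arcRest, arcCount_of_ne I b huv]
    refine Nat.sub_eq_zero_of_le (le_of_eq_of_le ?_ (Nat.zero_le _))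
    refine List.sum_eq_zero fun t ht => ?_
    obtain ⟨c, -, rfl⟩ := List.mem_map.mp ht
    have h0 := (c 0).2
    have h1 := (c 1).2
    have h2 := (c 2).2
    split_ifs <;> omega

theorem betweenRest_of_not {w : List Symbol} {x y z : ℕ} (h : ¬(x ≠ y ∧ x ≠ z ∧ y ≠ z)) :
    betweenRest w x y z = 0 := by
  unfold betweenRest
  by_cases h1 : x = y
  · simp [h1]
  by_cases h2 : x = z
  · simp [h2]
  by_cases h3 : y = z
  · simp [h3]
  exact absurd ⟨h1, h2, h3⟩ h

theorem betweenRest_of_ne {w : List Symbol} {x y z : ℕ} (h : x ≠ y) (h' : x ≠ z) (h'' : y ≠ z) :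
    betweenRest w x y z = betweenCount w x y z -
      min (betweenCount w y z x) (betweenCount w z x y) := by
  simp only [betweenRest, h, h', h'', if_false, Nat.sub_zero, one_mul]
  omega

theorem betweenRest_fin (x y z : Fin I.n) :
    betweenRest (inputWord I b) x y z = betweenMult I.multiset x y z := by
  by_cases h : x ≠ y ∧ x ≠ z ∧ y ≠ z
  · obtain ⟨h1, h2, h3⟩ := h
    rw [betweenRest_of_ne (Fin.val_ne_of_ne h1) (Fin.val_ne_of_ne h2) (Fin.val_ne_of_ne h3),
      betweenCount_fin I b h1 h3, betweenCount_fin I b h3 h2.symm,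
      betweenCount_fin I b h2.symm h1, betweenMult_eq _ h1 h2 h3]
    omega
  · rw [betweenMult_eq_zero _ h, betweenRest_of_not]
    simpa only [ne_eq, Fin.ext_iff] using h

theorem betweenRest_eq_zero {x y z : ℕ} (h : x = I.n ∨ y = I.n ∨ z = I.n) :
    betweenRest (inputWord I b) x y z = 0 := by
  by_cases hd : x ≠ y ∧ x ≠ z ∧ y ≠ z
  · obtain ⟨h1, h2, h3⟩ := hd
    rw [betweenRest_of_ne h1 h2 h3, betweenCount_of_ne I b h1]
    refine Nat.sub_eq_zero_of_le (le_of_eq_of_le ?_ (Nat.zero_le _))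
    refine List.sum_eq_zero fun t ht => ?_
    obtain ⟨c, -, rfl⟩ := List.mem_map.mp ht
    have h0 := (c 0).2
    have h1 := (c 1).2
    have h2 := (c 2).2
    by_cases e1 : (c 1 : ℕ) = x
    · simp only [e1, if_true, one_mul]
      split_ifs <;> omega
    · simp [e1]
  · exact betweenRest_of_not hd

end Encoded

end PermCSP

namespace PermCSP

/-! ### The new triples, with `ω` numbered `n` -/

section NewTriples

variable (I : Instance) (b : List Bool)

/-- The number of an old or new variable. -/
def index {n : ℕ} (x : Option (Fin n)) : ℕ := x.elim n Fin.val

/-- The variable with a given number. -/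
def ofIndex (n x : ℕ) : Option (Fin n) := if h : x < n then some ⟨x, h⟩ else none

theorem ofIndex_index {n : ℕ} (x : Option (Fin n)) : ofIndex n (index x) = x := by
  cases x <;> simp [ofIndex, index]

theorem index_ofIndex {n x : ℕ} (h : x ≤ n) : index (ofIndex n x) = x := by
  unfold ofIndex
  split_ifs with h'
  · rfl
  · exact le_antisymm (not_lt.mp h') h

theorem sum_range_index {n : ℕ} (f : ℕ → ℕ) :
    ∑ x ∈ Finset.range (n + 1), f x = ∑ x : Option (Fin n), f (index x) := by
  rw [Finset.sum_range_succ, Finset.sum_range, Fintype.sum_option, add_comm]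
  rfl

/-- A multiplicity is the sum of an indicator function, so `sum_newTriples` applies. Since `arcRest`
and `betweenRest` vanish at the number of `ω`, at most one kind of triple contributes at each
position of `ω`. -/
theorem count_newTriples (x y z : Option (Fin I.n)) :
    (newTriples I.multiset).count (x, y, z) =
      tripleMult (inputWord I b) (index x) (index y) (index z) := by
  have h : ((newTriples I.multiset).count (x, y, z) : ℚ) =
      ((newTriples I.multiset).map fun t => if t = (x, y, z) then (1 : ℚ) else 0).sum := by
    induction newTriples I.multiset using Multiset.induction_on with
    | empty => simp
    | cons t M ih =>
      rw [Multiset.count_cons, Multiset.map_cons, Multiset.sum_cons, ← ih]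
      push_cast
      rw [add_comm]
      simp only [eq_comm]
  rw [sum_newTriples] at h
  have ha := arcRest_fin I b
  have hb := betweenRest_fin I b
  have ha' := fun u v => arcRest_eq_zero I b (u := u) (v := v)
  have hb' := fun u v t => betweenRest_eq_zero I b (x := u) (y := v) (z := t)
  have hn := entry_zero I b
  have hlt := fun u : Fin I.n => u.2.ne
  rw [← Nat.cast_inj (R := ℚ), h]
  rcases x with - | x <;> rcases y with - | y <;> rcases z with - | z <;>
    simp [index, tripleMult, ha, hb, ha', hb', hn, hlt, ite_and]

/-- The new triples, with numbers for the variables. -/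
def tripleList (w : List Symbol) : List (ℕ × ℕ × ℕ) :=
  (List.range (entry w 0 + 1)).flatMap fun x => (List.range (entry w 0 + 1)).flatMap fun y =>
    (List.range (entry w 0 + 1)).flatMap fun z => List.replicate (tripleMult w x y z) (x, y, z)

theorem sum_map_range (n : ℕ) (f : ℕ → ℕ) :
    ((List.range n).map f).sum = ∑ i ∈ Finset.range n, f i := rfl

theorem map_tripleList :
    (((tripleList (inputWord I b)).map fun t =>
      (ofIndex I.n t.1, ofIndex I.n t.2.1, ofIndex I.n t.2.2) : List _) : Multiset _) =
      newTriples I.multiset := by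
  ext ⟨x, y, z⟩
  rw [count_newTriples I b, Multiset.coe_count, tripleList]
  simp only [List.map_flatMap, List.map_replicate, List.count_flatMap, Function.comp_def,
    sum_map_range, entry_zero, sum_range_index, List.count_replicate, ofIndex_index, Prod.mk.injEq,
    beq_iff_eq, ite_and, Finset.sum_ite_irrel, Finset.sum_const_zero, Finset.sum_ite_eq',
    Finset.mem_univ, if_true]

theorem length_tripleList (w : List Symbol) : (tripleList w).length = tripleCount w := by
  simp only [tripleList, List.length_flatMap, List.length_replicate, sum_map_range, tripleCount]

theorem card_newTriples :
    Multiset.card (newTriples I.multiset) = tripleCount (inputWord I b) := by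
  rw [← map_tripleList I b, Multiset.coe_card, List.length_map, length_tripleList]

theorem mem_tripleList {w : List Symbol} {x y z : ℕ} :
    (x, y, z) ∈ tripleList w ↔
      x ≤ entry w 0 ∧ y ≤ entry w 0 ∧ z ≤ entry w 0 ∧ tripleMult w x y z ≠ 0 := by
  simp only [tripleList, List.mem_flatMap, List.mem_range, List.mem_replicate, Prod.mk.injEq,
    Nat.lt_succ_iff]
  constructor
  · rintro ⟨x, hx, y, hy, z, hz, h, rfl, rfl, rfl⟩
    exact ⟨hx, hy, hz, h⟩
  · rintro ⟨hx, hy, hz, h⟩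
    exact ⟨x, hx, y, hy, z, hz, h, rfl, rfl, rfl⟩

theorem distinct_of_mem_tripleList {x y z : ℕ} (h : (x, y, z) ∈ tripleList (inputWord I b)) :
    x ≠ y ∧ x ≠ z ∧ y ≠ z := by
  have h' := (mem_tripleList.mp h).2.2.2
  contrapose! h'
  have ha : ∀ u v, u = I.n ∨ v = I.n ∨ u = v → arcRest (inputWord I b) u v = 0 := by
    rintro u v (h | h | h)
    · exact arcRest_eq_zero I b (.inl h)
    · exact arcRest_eq_zero I b (.inr h)
    · rw [h, arcRest, Nat.sub_self]
  rw [tripleMult, entry_zero, betweenRest_of_not (by tauto)]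
  have h1 : (if x = I.n then 1 else 0) * arcRest (inputWord I b) y z = 0 := by
    split_ifs with h
    · rw [ha _ _ (by by_contra; grind)]
    · exact zero_mul _
  have h2 : (if y = I.n then 1 else 0) * arcRest (inputWord I b) x z = 0 := by
    split_ifs with h
    · rw [ha _ _ (by by_contra; grind)]
    · exact zero_mul _
  have h3 : (if z = I.n then 1 else 0) * arcRest (inputWord I b) x y = 0 := by
    split_ifs with h
    · rw [ha _ _ (by by_contra; grind)]
    · exact zero_mul _
  omega

theorem occurrences_ne_zero {w : List Symbol} {x : ℕ} (hx : x ≤ entry w 0) :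
    occurrences w x ≠ 0 ↔ ∃ t ∈ tripleList w, t.1 = x ∨ t.2.1 = x ∨ t.2.2 = x := by
  simp only [occurrences, ne_eq, Finset.sum_eq_zero_iff, Finset.mem_range, Nat.lt_succ_iff,
    Nat.add_eq_zero_iff, not_forall, Prod.exists, mem_tripleList]
  constructor
  · rintro ⟨y, hy, z, hz, h⟩
    by_cases h1 : tripleMult w x y z = 0
    · by_cases h2 : tripleMult w y x z = 0
      · exact ⟨y, z, x, ⟨hy, hz, hx, fun h3 => h ⟨h1, h2, h3⟩⟩, by simp⟩
      · exact ⟨y, x, z, ⟨hy, hx, hz, h2⟩, by simp⟩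
    · exact ⟨x, y, z, ⟨hx, hy, hz, h1⟩, by simp⟩
  · rintro ⟨p, q, r, ⟨hp, hq, hr, h⟩, rfl | rfl | rfl⟩
    · exact ⟨q, hq, r, hr, fun h' => h h'.1⟩
    · exact ⟨p, hp, r, hr, fun h' => h h'.2.1⟩
    · exact ⟨p, hp, q, hq, fun h' => h h'.2.2⟩

/-- This makes `Nat.nth` available as the inverse of the renumbering. -/
theorem rank_eq_count (w : List Symbol) (x : ℕ) :
    rank w x = Nat.count (fun y => occurrences w y ≠ 0) x := by
  rw [Nat.count_eq_card_filter_range, Finset.card_filter, rank]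
  refine Finset.sum_congr rfl fun y _ => ?_
  split_ifs <;> omega

end NewTriples

/-! ### Renumbering of the variables that occur -/

section NewInstance

theorem exists_constraints (n : ℕ) (L : List (ℕ × ℕ × ℕ))
    (h : ∀ t ∈ L, (t.1 < n ∧ t.2.1 < n ∧ t.2.2 < n) ∧ t.1 ≠ t.2.1 ∧ t.1 ≠ t.2.2 ∧ t.2.1 ≠ t.2.2) :
    ∃ C : List (Constraint (Fin n)), (C.map fun c => ((c 0 : ℕ), (c 1 : ℕ), (c 2 : ℕ))) = L := by
  induction L with
  | nil => exact ⟨[], rfl⟩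
  | cons t L ih =>
    obtain ⟨C, hC⟩ := ih fun t ht => h t (List.mem_cons_of_mem _ ht)
    obtain ⟨⟨h0, h1, h2⟩, h3, h4, h5⟩ := h t List.mem_cons_self
    refine ⟨⟨![⟨t.1, h0⟩, ⟨t.2.1, h1⟩, ⟨t.2.2, h2⟩], ?_⟩ :: C, ?_⟩
    · intro i j hij
      fin_cases i <;> fin_cases j <;> simp_all [Ne.symm h3, Ne.symm h4, Ne.symm h5]
    · rw [List.map_cons, hC]
      rfl

theorem map_inl_unaryWord (l : List ℕ) :
    ((unaryWord l).map .inl : List Symbol) = l.flatMap block := by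
  induction l with
  | nil => rfl
  | cons a l ih => rw [map_unaryWord_cons, ih, List.flatMap_cons]

theorem newWord_eq (w : List Symbol) :
    newWord w = (rank w (entry w 0 + 1) ::
      (tripleList w).flatMap fun t => [rank w t.1, rank w t.2.1, rank w t.2.2]).flatMap block ++
        (.inr false :: digits w) := by
  rw [newWord, tripleList, List.flatMap_cons, List.append_assoc]
  have h : ∀ (m : ℕ) (t : ℕ × ℕ × ℕ) (f : ℕ × ℕ × ℕ → List Symbol),
      (List.replicate m t).flatMap f = (List.replicate m (f t)).flatten := fun m t f => by
    rw [List.flatMap_def, List.map_replicate]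
  simp only [List.flatMap_assoc, List.flatMap_cons, List.flatMap_nil, List.append_nil, h]

/-- The new word encodes the new instance. -/
theorem exists_isReencoding (I : Instance) (b : List Bool) :
    ∃ J : Instance, newWord (inputWord I b) = inputWord J (false :: b) ∧ IsReencoding I J ∧
      J.constraints.length = tripleCount (inputWord I b) := by
  set w := inputWord I b with hw
  have hn : entry w 0 = I.n := entry_zero I b
  set p : ℕ → Prop := fun y => occurrences w y ≠ 0 with hp
  have hr : ∀ x, rank w x = Nat.count p x := rank_eq_count w
  have hmem : ∀ t ∈ tripleList w, (t.1 ≤ I.n ∧ p t.1) ∧ (t.2.1 ≤ I.n ∧ p t.2.1) ∧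
      (t.2.2 ≤ I.n ∧ p t.2.2) := by
    intro t ht
    obtain ⟨h1, h2, h3, -⟩ := mem_tripleList.mp ht
    exact ⟨⟨hn ▸ h1, (occurrences_ne_zero h1).mpr ⟨t, ht, by simp⟩⟩,
      ⟨hn ▸ h2, (occurrences_ne_zero h2).mpr ⟨t, ht, by simp⟩⟩,
      ⟨hn ▸ h3, (occurrences_ne_zero h3).mpr ⟨t, ht, by simp⟩⟩⟩
  have hlt : ∀ x, x ≤ I.n ∧ p x → rank w x < rank w (I.n + 1) := fun x hx => by
    rw [hr, hr]
    exact Nat.count_strict_mono hx.2 (Nat.lt_succ_of_le hx.1)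
  have hinj : ∀ x y, p x → p y → rank w x = rank w y → x = y := fun x y hx hy h => by
    rw [hr, hr] at h
    exact Nat.count_injective hx hy h
  obtain ⟨C, hC⟩ := exists_constraints (rank w (I.n + 1))
    ((tripleList w).map fun t => (rank w t.1, rank w t.2.1, rank w t.2.2)) (by
      intro t ht
      obtain ⟨t, ht', rfl⟩ := List.mem_map.mp ht
      obtain ⟨h1, h2, h3⟩ := hmem t ht'
      obtain ⟨d1, d2, d3⟩ := distinct_of_mem_tripleList I b ht'
      exact ⟨⟨hlt _ h1, hlt _ h2, hlt _ h3⟩, fun h => d1 (hinj _ _ h1.2 h2.2 h),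
        fun h => d2 (hinj _ _ h1.2 h3.2 h), fun h => d3 (hinj _ _ h2.2 h3.2 h)⟩)
  have hnth : ∀ x, p x → Nat.nth p (rank w x) = x := fun x hx => by
    rw [hr]
    exact Nat.nth_count hx
  -- Every new number is the rank of an old variable or `ω` that occurs, so the renumbering is onto.
  have hfin : ∀ r, r < rank w (I.n + 1) →
      Nat.nth p r ≤ I.n ∧ p (Nat.nth p r) ∧ rank w (Nat.nth p r) = r := by
    intro r h
    rw [hr] at h
    have hc : ∀ hf : (Set.ofPred p).Finite, r < hf.toFinset.card := by
      intro hf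
      refine h.trans_le ?_
      rw [Nat.count_eq_card_filter_range]
      exact Finset.card_le_card fun x hx => by simpa using (Finset.mem_filter.mp hx).2
    exact ⟨Nat.lt_succ_iff.mp (Nat.nth_lt_of_lt_count h), Nat.nth_mem r hc, by
      rw [hr]; exact Nat.count_nth hc⟩
  refine ⟨⟨rank w (I.n + 1), C⟩, ?_, ⟨?_, ⟨fun r => ofIndex I.n (Nat.nth p r), ?_⟩, ?_⟩, ?_⟩
  · have hcode : (⟨rank w (I.n + 1), C⟩ : Instance).code = rank w (I.n + 1) ::
        (tripleList w).flatMap fun t => [rank w t.1, rank w t.2.1, rank w t.2.2] := by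
      have h := congrArg (fun L => L.flatMap fun t : ℕ × ℕ × ℕ => [t.1, t.2.1, t.2.2]) hC
      simp only [List.flatMap_map] at h
      rw [← h]
      rfl
    have hd : digits w = b.map .inr := digits_map_append _ b
    rw [newWord_eq, hn, hd, inputWord, hcode, map_inl_unaryWord]
    rfl
  · intro r
    obtain ⟨h1, h2, h3⟩ := hfin r r.2
    obtain ⟨t, ht, h⟩ := (occurrences_ne_zero (h1.trans hn.ge)).mp h2
    have : (rank w t.1, rank w t.2.1, rank w t.2.2) ∈
        C.map fun c => ((c 0 : ℕ), (c 1 : ℕ), (c 2 : ℕ)) :=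
      hC ▸ List.mem_map.mpr ⟨t, ht, rfl⟩
    obtain ⟨c, hc, hct⟩ := List.mem_map.mp this
    simp only [Prod.mk.injEq] at hct
    refine ⟨c, hc, ?_⟩
    rcases h with h | h | h
    · exact ⟨0, Fin.ext (by rw [hct.1, h, h3])⟩
    · exact ⟨1, Fin.ext (by rw [hct.2.1, h, h3])⟩
    · exact ⟨2, Fin.ext (by rw [hct.2.2, h, h3])⟩
  · intro r s h
    have := congrArg index h
    simp only [index_ofIndex (hfin r r.2).1, index_ofIndex (hfin s s.2).1] at this
    exact Fin.ext (by rw [← (hfin r r.2).2.2, this, (hfin s s.2).2.2])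
  · rw [← map_tripleList I b, Instance.multiset, Multiset.map_coe]
    congr 1
    have : (C.map fun c => (ofIndex I.n (Nat.nth p (c 0)), ofIndex I.n (Nat.nth p (c 1)),
        ofIndex I.n (Nat.nth p (c 2)))) =
        (C.map fun c => ((c 0 : ℕ), (c 1 : ℕ), (c 2 : ℕ))).map fun t =>
          (ofIndex I.n (Nat.nth p t.1), ofIndex I.n (Nat.nth p t.2.1),
            ofIndex I.n (Nat.nth p t.2.2)) := by
      rw [List.map_map]
      rfl
    refine this.trans ?_
    rw [hC, List.map_map]
    refine List.map_congr_left fun t ht => ?_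
    obtain ⟨h1, h2, h3⟩ := hmem t ht
    simp only [Function.comp_apply, hnth _ h1.2, hnth _ h2.2, hnth _ h3.2]
  · have := congrArg List.length hC
    simpa [length_tripleList] using this

end NewInstance

end PermCSP

namespace PermCSP

open Computability

/-! ### Binary size of the number of triples and of the parameter -/

section PowerCount

-- The powers of two up to `m` are the `2 ^ e` with `e < Nat.size m`. Other positive numbers are
-- recognized by an odd prime divisor.
open Classical in
theorem powerCount_eq_size (m : ℕ) : powerCount m = Nat.size m := by
  have h : ∀ t, (1 - ∑ i ∈ Finset.range (t + 1), ∑ j ∈ Finset.range (t + 1),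
      if (2 * i + 3) * (j + 1) = t + 1 then 1 else 0) = if ∃ e, t + 1 = 2 ^ e then 1 else 0 := by
    intro t
    split_ifs with h
    · obtain ⟨e, he⟩ := h
      have h0 : ∀ i j, (2 * i + 3) * (j + 1) ≠ t + 1 := ?_
      · simp [h0]
      intro i j hij
      obtain ⟨f, -, hf⟩ := (Nat.dvd_prime_pow Nat.prime_two).mp (he ▸ Dvd.intro _ hij)
      cases f with
      | zero => omega
      | succ f => rw [pow_succ] at hf; omega
    · obtain ⟨e, he⟩ | ⟨q, hq, ⟨j, hj⟩, i, hi⟩ := Nat.eq_two_pow_or_exists_odd_prime_and_dvd (t + 1)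
      · exact absurd ⟨e, he⟩ h
      have hq2 := hq.two_le
      have hj0 : j ≠ 0 := by rintro rfl; omega
      have hqt : q ≤ t + 1 := Nat.le_of_dvd (by omega) (hj ▸ Dvd.intro _ rfl)
      have hjt : j ≤ t + 1 := Nat.le_of_dvd (by omega) (hj ▸ Dvd.intro_left _ rfl)
      -- The prime `q = 2 * i + 1` with cofactor `j` is the summand at the shifted indices `i - 1`
      -- and `j - 1`.
      refine Nat.sub_eq_zero_of_le ?_
      refine le_trans ?_ (Finset.single_le_sum (f := fun i => ∑ j ∈ Finset.range (t + 1),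
        if (2 * i + 3) * (j + 1) = t + 1 then 1 else 0) (fun _ _ => Nat.zero_le _)
        (Finset.mem_range.mpr (show i - 1 < t + 1 by omega)))
      refine le_trans ?_ (Finset.single_le_sum (f := fun j =>
        if (2 * (i - 1) + 3) * (j + 1) = t + 1 then 1 else 0) (fun _ _ => Nat.zero_le _)
        (Finset.mem_range.mpr (show j - 1 < t + 1 by omega)))
      have h1 : 2 * (i - 1) + 3 = q := by omega
      have h2 : j - 1 + 1 = j := by omega
      simp only [h1, h2, hj]
      simp
  simp only [powerCount, h]
  rw [← Finset.card_filter]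
  have : (Finset.range m).filter (fun t => ∃ e, t + 1 = 2 ^ e) =
      (Finset.range (Nat.size m)).image fun e => 2 ^ e - 1 := by
    ext t
    simp only [Finset.mem_filter, Finset.mem_range, Finset.mem_image, Nat.lt_size]
    constructor
    · rintro ⟨ht, e, he⟩
      exact ⟨e, by omega, by omega⟩
    · rintro ⟨e, he, rfl⟩
      have := Nat.one_le_two_pow (n := e)
      exact ⟨by omega, e, by omega⟩
  rw [this, Finset.card_image_of_injective, Finset.card_range]
  intro x y hxy
  have h1 := Nat.one_le_two_pow (n := x)
  have h2 := Nat.one_le_two_pow (n := y)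
  exact Nat.pow_right_injective le_rfl (show 2 ^ x = 2 ^ y by simp only at hxy; omega)

end PowerCount

section Digits

theorem encodePosNum_bounds (p : PosNum) :
    2 ^ (encodePosNum p).length ≤ 2 * (p : ℕ) ∧ (p : ℕ) < 2 ^ (encodePosNum p).length := by
  induction p with
  | one => simp [encodePosNum]
  | bit0 p ih | bit1 p ih =>
    simp only [encodePosNum, List.length_cons, pow_succ, PosNum.cast_bit0, PosNum.cast_bit1]
    omega

theorem exists_posNum {k : ℕ} (hk : k ≠ 0) : ∃ p : PosNum, (p : ℕ) = k ∧ (k : Num) = .pos p := by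
  have h : ((k : Num) : ℕ) = k := Num.to_of_nat k
  cases hn : (k : Num) with
  | zero => rw [hn] at h; exact absurd h.symm hk
  | pos p => rw [hn] at h; exact ⟨p, h, rfl⟩

/-- With `L` digits, `4 ^ L` lies between `k ^ 2` and `4 * k ^ 2`; so `L` determines a threshold of
order `k ^ 2`. -/
theorem encodeNat_bounds {k : ℕ} (hk : k ≠ 0) :
    2 ^ (encodeNat k).length ≤ 2 * k ∧ k < 2 ^ (encodeNat k).length := by
  obtain ⟨p, hp, hkp⟩ := exists_posNum hk
  rw [encodeNat, hkp, encodeNum]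
  simpa [hp] using encodePosNum_bounds p

/-- The least significant digit comes first. Zero is excluded because its code is the empty word. -/
theorem encodeNat_two_mul {k : ℕ} (hk : k ≠ 0) : encodeNat (2 * k) = false :: encodeNat k := by
  obtain ⟨p, hp, hkp⟩ := exists_posNum hk
  have h : ((2 * k : ℕ) : Num) = .pos p.bit0 := by
    rw [← Num.to_nat_inj, Num.to_of_nat]
    change 2 * k = ((p.bit0 : PosNum) : ℕ)
    rw [PosNum.cast_bit0, hp]
    ring
  rw [encodeNat, encodeNat, h, hkp]
  rfl

theorem length_encodeNat_eq_zero {k : ℕ} : (encodeNat k).length = 0 ↔ k = 0 := by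
  constructor
  · intro h
    by_contra hk
    have := (encodeNat_bounds hk).2
    rw [h] at this
    omega
  · rintro rfl
    rfl

end Digits

/-! ### The kernelization and its bounds -/

section Kernel

theorem tripleCount_le (I : Instance) (b : List Bool) :
    tripleCount (inputWord I b) ≤ 3 * remaining I.multiset := by
  have h : (tripleCount (inputWord I b) : ℚ) = 3 * Multiset.card (reduceArcs (arcs I.multiset)) +
      2 * Multiset.card (reduceBetweenness (betweenness I.multiset)) := by
    rw [two_mul_card_reduceBetweenness, card_reduceArcs, ← card_newTriples]
    have := sum_newTriples I.multiset fun _ => 1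
    rw [Multiset.map_const', Multiset.sum_replicate] at this
    rw [← nsmul_one, this]
    simp only [mul_one, Finset.mul_sum]
    congr 1
    refine Finset.sum_congr rfl fun u _ => Finset.sum_congr rfl fun v _ => ?_
    ring
  have h' : tripleCount (inputWord I b) = 3 * Multiset.card (reduceArcs (arcs I.multiset)) +
      2 * Multiset.card (reduceBetweenness (betweenness I.multiset)) := by exact_mod_cast h
  rw [h', remaining]
  omega

/-- Bit lengths are compared instead of numbers: `k` in unary may be exponentially longer than its
code. -/
theorem openFlag_eq_zero (I : Instance) (k : ℕ) :
    openFlag (inputWord I (encodeNat k)) = 0 ↔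
      k = 0 ∨ 2 ^ (2 * (encodeNat k).length + 38) ≤ tripleCount (inputWord I (encodeNat k)) := by
  have hd : digitCount (inputWord I (encodeNat k)) = (encodeNat k).length := by
    rw [digitCount_eq_length, inputWord, digits_map_append, List.length_map]
  rw [openFlag, hd, powerCount_eq_size, ← Nat.lt_size, Nat.mul_eq_zero]
  have hk := length_encodeNat_eq_zero (k := k)
  omega

/-- The image of an instance under the kernelization. -/
theorem exists_image (I : Instance) (k : ℕ) : ∃ y : Instance × ℕ,
    outputWord (inputWord I (encodeNat k)) = inputWord y.1 (encodeNat y.2) ∧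
    ((openFlag (inputWord I (encodeNat k)) = 0 ∧ y = (⟨0, []⟩, 0)) ∨
      (openFlag (inputWord I (encodeNat k)) ≠ 0 ∧ IsReencoding I y.1 ∧ y.2 = 2 * k ∧
        y.1.constraints.length = tripleCount (inputWord I (encodeNat k)))) := by
  by_cases h : openFlag (inputWord I (encodeNat k)) = 0
  -- A lone separator encodes the empty instance with parameter `0`, which is a yes-instance.
  · exact ⟨(⟨0, []⟩, 0), by rw [outputWord, if_pos h]; rfl, .inl ⟨h, rfl⟩⟩
  · obtain ⟨J, hJ, hIJ, hl⟩ := exists_isReencoding I (encodeNat k)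
    refine ⟨(J, 2 * k), ?_, .inr ⟨h, hIJ, rfl, hl⟩⟩
    rw [outputWord, if_neg h, hJ, encodeNat_two_mul]
    rintro rfl
    exact h ((openFlag_eq_zero I 0).mpr (.inl rfl))

/-- Every variable occurs, and a constraint has three positions. -/
theorem IsReencoding.n_le {I J : Instance} (h : IsReencoding I J) :
    J.n ≤ 3 * J.constraints.length := by
  have hsub : (Finset.univ : Finset (Fin J.n)) ⊆
      (J.constraints.flatMap fun c => [c 0, c 1, c 2]).toFinset := by
    intro x _
    obtain ⟨c, hc, i, rfl⟩ := h.1 x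
    rw [List.mem_toFinset, List.mem_flatMap]
    refine ⟨c, hc, ?_⟩
    fin_cases i <;> simp
  have := (Finset.card_le_card hsub).trans (List.toFinset_card_le _)
  simpa [List.length_flatMap, mul_comm] using this

theorem length_unaryWord_code_le (J : Instance) :
    (unaryWord J.code).length ≤ (3 * J.constraints.length + 1) * (J.n + 1) := by
  have h : ∀ a ∈ J.code, a ≤ J.n := by
    intro a ha
    simp only [Instance.code, List.mem_cons, List.mem_flatMap, List.not_mem_nil, or_false] at ha
    obtain rfl | ⟨c, -, rfl | rfl | rfl⟩ := ha
    · exact le_rfl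
    all_goals exact (Fin.is_lt _).le
  have h' : J.code.length = 3 * J.constraints.length + 1 := by
    simp [Instance.code, List.length_flatMap, mul_comm]
  rw [unaryWord, List.length_flatMap, ← h', ← smul_eq_mul]
  have := List.sum_le_card_nsmul
    (J.code.map fun a => (List.replicate a true ++ [false]).length) (J.n + 1) (by
      intro m hm
      obtain ⟨a, ha, rfl⟩ := List.mem_map.mp hm
      simpa using h a ha)
  simpa using this

/-- Linear Ordering Above Average has a kernel with quadratically many variables and
constraints. -/
theorem exists_kernelization :
    ∃ f : Instance × ℕ → Instance × ℕ,
      ParamProblem.IsKernelization linearOrderingAA f ∧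
      (∃ K : ℕ, ∀ (I : Instance) (k : ℕ),
        (f (I, k)).1.n ≤ K * k ^ 2 ∧ (f (I, k)).1.constraints.length ≤ K * k ^ 2) ∧
      ∃ c : ℕ, 0 < c ∧ ∀ (I : Instance) (k : ℕ),
        (c * k ^ 2 ≤ remaining I.multiset → linearOrderingAA.Yes I k) ∧
        (remaining I.multiset < c * k ^ 2 →
          IsReencoding I (f (I, k)).1 ∧ (f (I, k)).2 = 2 * k) := by
  choose f hw hf using fun x : Instance × ℕ => exists_image x.1 x.2
  have hyes : ∀ (I : Instance) (k : ℕ), 2 ^ 36 * k ^ 2 ≤ remaining I.multiset →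
      linearOrderingAA.Yes I k := fun I k h => isYes_of_le_remaining I.multiset k h
  have hbound : ∀ (I : Instance) (k : ℕ), (f (I, k)).1.n ≤ 2 ^ 42 * k ^ 2 ∧
      (f (I, k)).1.constraints.length ≤ 2 ^ 40 * k ^ 2 := by
    intro I k
    obtain ⟨-, h⟩ | ⟨h0, hIJ, -, hl⟩ := hf (I, k)
    · rw [h]
      exact ⟨Nat.zero_le _, Nat.zero_le _⟩
    · have hn := hIJ.n_le
      rw [Ne, openFlag_eq_zero, not_or, not_le] at h0
      obtain ⟨hk, ht⟩ := h0
      -- Here `4 ^ L ≤ 4 * k ^ 2`, so there are fewer than `2 ^ 38 * 4 * k ^ 2 = 2 ^ 40 * k ^ 2`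
      -- triples, with at most three times as many variables.
      have h2 := Nat.pow_le_pow_left (encodeNat_bounds hk).1 2
      rw [← pow_mul, mul_comm _ 2, mul_pow] at h2
      rw [pow_add] at ht
      simp only at hn hl ht h2
      constructor <;> omega
  have hiff : ∀ (I : Instance) (k : ℕ),
      IsYes {1} I.multiset k ↔ IsYes {1} (f (I, k)).1.multiset (f (I, k)).2 := by
    intro I k
    obtain ⟨h0, h⟩ | ⟨-, hIJ, hk, -⟩ := hf (I, k)
    · refine iff_of_true (hyes I k ?_) ?_
      · rw [openFlag_eq_zero] at h0
        obtain rfl | h0 := h0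
        · exact Nat.zero_le _
        · by_cases hk : k = 0
          · rw [hk]
            exact Nat.zero_le _
          -- Now `k ^ 2 ≤ 4 ^ L`, so there are at least `2 ^ 38 * k ^ 2` triples, at most three per
          -- remaining constraint; hence at least `2 ^ 36 * k ^ 2` constraints remain.
          have h1 := Nat.pow_le_pow_left (encodeNat_bounds hk).2.le 2
          rw [← pow_mul, mul_comm _ 2] at h1
          have h2 := tripleCount_le I (encodeNat k)
          rw [pow_add] at h0
          simp only at h0 h1 h2
          omega
      · rw [h]
        refine ⟨Fintype.equivFin _, ?_⟩
        simp [Instance.multiset]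
    · rw [hk]
      exact yes_iff_of_isReencoding hIJ k
  have hparam : ∀ (I : Instance) (k : ℕ), (f (I, k)).2 ≤ 2 * k := by
    intro I k
    obtain ⟨-, h⟩ | ⟨-, -, hk, -⟩ := hf (I, k)
    · rw [h]
      exact Nat.zero_le _
    · exact hk.le
  refine ⟨f, ⟨?_, ?_, ⟨fun k => 2 * k, ?_⟩,
    ⟨fun k => (3 * (2 ^ 40 * k ^ 2) + 1) * (2 ^ 42 * k ^ 2 + 1), ?_⟩⟩,
    ⟨2 ^ 42, fun I k => ⟨(hbound I k).1, (hbound I k).2.trans ?_⟩⟩,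
    2 ^ 36, by norm_num, fun I k => ⟨hyes I k, fun h => ?_⟩⟩
  · exact StackProgram.computable_of_eval (Γ := Symbol) (.inl true) Expr.output
      Expr.related_output fun x => (Expr.eval_output _).trans (hw x)
  · exact fun I k => hiff I k
  · exact fun I k => hparam I k
  · intro I k
    refine (length_unaryWord_code_le _).trans (Nat.mul_le_mul ?_ ?_)
    · exact Nat.add_le_add_right (Nat.mul_le_mul_left 3 (hbound I k).2) 1
    · exact Nat.add_le_add_right (hbound I k).1 1
  · exact Nat.mul_le_mul_right _ (by norm_num)
  · have hk : k ≠ 0 := by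
      rintro rfl
      simp at h
    -- Fewer than `3 * 2 ^ 36 * k ^ 2 < 2 ^ 38 * k ^ 2` triples are below the threshold, so the
    -- trivial instance is not the output.
    obtain ⟨h0, -⟩ | ⟨-, hIJ, hk', -⟩ := hf (I, k)
    · rw [openFlag_eq_zero] at h0
      obtain h0 | h0 := h0
      · exact absurd h0 hk
      have h1 := Nat.pow_le_pow_left (encodeNat_bounds hk).2.le 2
      rw [← pow_mul, mul_comm _ 2] at h1
      have h2 := tripleCount_le I (encodeNat k)
      rw [pow_add] at h0
      simp only at h0 h1 h2
      omega
    · exact ⟨hIJ, hk'⟩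

end Kernel

end PermCSP

theorem theorem3 :
    ∃ f : PermCSP.Instance × ℕ → PermCSP.Instance × ℕ,
      ParamProblem.IsKernelization PermCSP.linearOrderingAA f ∧
      (∃ K : ℕ, ∀ (I : PermCSP.Instance) (k : ℕ),
        (f (I, k)).1.n ≤ K * k ^ 2 ∧ (f (I, k)).1.constraints.length ≤ K * k ^ 2) ∧
      ∃ c : ℕ, 0 < c ∧ ∀ (I : PermCSP.Instance) (k : ℕ),
        (c * k ^ 2 ≤ PermCSP.remaining I.multiset → PermCSP.linearOrderingAA.Yes I k) ∧
        (PermCSP.remaining I.multiset < c * k ^ 2 →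
          PermCSP.IsReencoding I (f (I, k)).1 ∧ (f (I, k)).2 = 2 * k) :=
  PermCSP.exists_kernelization
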